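/- Let $\kappa\in(0,4]$ and $c_{\mathrm m}=1-6\big(\tfrac{2}{\sqrt\kappa}-\tfrac{\sqrt\kappa}{2}\big)^2$. Let $\mathcal E$ be the set of injective holomorphic maps $f$ of the unit disc that extend continuously and injectively to the closed disc, with $f(0)=0$, $f'(0)=1$; write $f(z)=z\big(1+\sum_{m\ge1}a_mz^m\big)$. Identify a Jordan curve $\eta\subset\mathbb C\setminus\{0\}$ separating $0$ from $\infty$ with the pair $(c,f)\in\mathbb R\times\mathcal E$ such that $e^cf$ maps the unit disc onto the interior of $\eta$. For $n\in\mathbb Z$ let $v_n(z)=-z^{n+1}$, with complex-time flow $\partial_t\phi_t=v_n\circ\phi_t$, $\phi_0=\mathrm{id}$, near $\eta$, and let $\mathcal L_nF$ be the $(1,0)$-part of the derivative of a function $F$ of curves: $$F(\phi_t(\eta))=F(\eta)+t\,\mathcal L_nF(\eta)+\bar t\,\bar{\mathcal L}_nF(\eta)+o(t),\qquad t\to0\text{ in }\mathbb C .$$ Let $P_{n,0},P_{n,m},Q_{n,0}\in\mathbb C[(a_m)_{m\ge1}]$ ($m\ge1$) be the polynomials determined by $$\mathcal L_nc=e^{nc}P_{n,0},\qquad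 \mathcal L_na_m=e^{nc}P_{n,m},\qquad -\frac{c_{\mathrm m}}{12}\,\frac{e^{-c}}{2i\pi}\oint \mathcal S f^{-1}(z)\,v_n(e^cz)\,dz=e^{nc}Q_{n,0},$$ where $\mathcal S f=(f''/f')'-\tfrac12(f''/f')^2$ is the Schwarzian derivative and the contour is a small circle around $0$. For $\lambda\in\mathbb C$ let $\mathbf L_n^\lambda$ be the endomorphism of $\mathbb C[(a_m)_{m\ge1}]$ $$\mathbf L_n^\lambda=-P_{n,0}\,(2\lambda+\mathbf N)+Q_{n,0}+\sum_{m\ge1}P_{n,m}\,\partial_{a_m},\qquad \mathbf N=\sum_{m\ge1}m\,a_m\partial_{a_m}.$$ Then, for $\lambda\in\big\{\tfrac{6-\kappa}{2\kappa},\tfrac{3\kappa-8}{16}\big\}$, the level-2 singular vector vanishes: in $\mathbb C[(a_m)_{m\ge1}]$, $$\Big((\mathbf L_{-1}^\lambda)^2-\tfrac23(2\lambda+1)\,\mathbf L_{-2}^\lambda\Big)\,1=0 .$$ -/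

import Mathlib

open Filter Topology Asymptotics

namespace SLELoop

noncomputable section

/-- The space `𝓔` of normalised conformal maps of the unit disc: `f` is holomorphic in the open
unit disc, extends continuously and injectively to the closed unit disc, `f 0 = 0` and
`f' 0 = 1`. (Values of `f` outside the closed unit disc carry no meaning and are never used.) -/
structure Shape where
  f : ℂ → ℂ
  diffCont : DiffContOnCl ℂ f (Metric.ball 0 1)
  injOn : Set.InjOn f (Metric.closedBall 0 1)
  map_zero : f 0 = 0
  deriv_zero : deriv f 0 = 1

/-- The Jordan curves in `ℂ ∖ {0}` separating `0` from `∞`, in the coordinates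
`(c, f) ∈ ℝ × 𝓔`: the pair `(c, f)` stands for the curve whose interior is
uniformised by `e ^ c f`. -/
structure Curve where
  c : ℝ
  shape : Shape

/-- The trace of the curve with coordinates `(c, f)`, i.e. the image of the unit circle under
`e ^ c f`. -/
def Curve.trace (η : Curve) : Set ℂ :=
  (fun z : ℂ => Complex.exp (η.c : ℂ) * η.shape.f z) '' Metric.sphere (0 : ℂ) 1

/-- The coordinate `a_m`: the coefficient of `z ^ (m + 1)` in the power series
`f z = z (1 + ∑_{m ≥ 1} a_m z ^ m)`. -/
def Curve.a (η : Curve) (m : ℕ+) : ℂ :=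
  iteratedDeriv ((m : ℕ) + 1) η.shape.f 0 / (Nat.factorial ((m : ℕ) + 1) : ℂ)

/-- The (coefficient of the) vector field `v_n = - z ^ (n + 1) ∂_z`. -/
def vecField (n : ℤ) (z : ℂ) : ℂ := -z ^ (n + 1)

/-- `φ t` is the flow of the vector field `v ∂_z`, defined in a neighbourhood of `K` for small
complex times `t`: `∂_t φ_t = v ∘ φ_t`, `φ_0 = id`. -/
def IsFlowNear (v : ℂ → ℂ) (K : Set ℂ) (φ : ℂ → ℂ → ℂ) : Prop :=
  ∃ U : Set ℂ, IsOpen U ∧ K ⊆ U ∧ ∃ ε : ℝ, 0 < ε ∧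
    ∀ z ∈ U, φ 0 z = z ∧ ∀ t : ℂ, ‖t‖ < ε → HasDerivAt (fun s => φ s z) (v (φ t z)) t

/-- `F` is differentiable at the curve `η` in direction `v ∂_z`, with `(1,0)`-part `α = 𝓛_v F(η)`
and `(0,1)`-part `β`: with `φ_t` the flow of `v ∂_z`,
`F(φ_t · η) = F(η) + t α + conj(t) β + o(t)` as `t → 0` in `ℂ`, where `φ_t · η` is the curve
whose trace is the image of the trace of `η` under `φ_t`. -/
def HasLieDerivAt (v : ℂ → ℂ) (F : Curve → ℂ) (η : Curve) (α β : ℂ) : Prop :=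
  ∃ φ : ℂ → ℂ → ℂ, IsFlowNear v η.trace φ ∧
    ∃ ηt : ℂ → Curve, (∀ᶠ t in 𝓝 (0 : ℂ), (ηt t).trace = φ t '' η.trace) ∧
      (fun t : ℂ => F (ηt t) - F η - t * α - (starRingEnd ℂ) t * β) =o[𝓝 0] (fun t : ℂ => t)

/-- The value at `η` of the function `e ^ (n c) p((a_m)_{m ≥ 1})`, for `p ∈ ℂ[(a_m)_{m ≥ 1}]`. -/
def Curve.scaledEval (η : Curve) (n : ℤ) (p : MvPolynomial ℕ+ ℂ) : ℂ :=
  Complex.exp ((n : ℂ) * (η.c : ℂ)) * MvPolynomial.eval η.a p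

/-- `𝓛_n F = e ^ (n c) p` at every curve, where `𝓛_n = 𝓛_{v_n}` is the `(1,0)`-part of the Lie
derivative in direction `v_n`. -/
def IsLieCoeff (n : ℤ) (F : Curve → ℂ) (p : MvPolynomial ℕ+ ℂ) : Prop :=
  ∀ η : Curve, ∃ β : ℂ, HasLieDerivAt (vecField n) F η (η.scaledEval n p) β

/-- `P_{n,0}`: the polynomial with `𝓛_n c = e ^ (n c) P_{n,0}`, so that `e ^ (n c) P_{n,0}` is the
coefficient of `∂_c` in `𝓛_n`. -/
def coeffP0 (n : ℤ) : MvPolynomial ℕ+ ℂ :=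
  Classical.epsilon (IsLieCoeff n fun η => (η.c : ℂ))

/-- `P_{n,m}`, `m ≥ 1`: the polynomial with `𝓛_n a_m = e ^ (n c) P_{n,m}`, so that
`e ^ (n c) P_{n,m}` is the coefficient of `∂_{a_m}` in `𝓛_n`. -/
def coeffP (n : ℤ) (m : ℕ+) : MvPolynomial ℕ+ ℂ :=
  Classical.epsilon (IsLieCoeff n fun η => η.a m)

/-- The Schwarzian derivative `𝓢 g = (g'' / g')' - (1/2) (g'' / g') ^ 2`. -/
def schwarzian (g : ℂ → ℂ) (z : ℂ) : ℂ :=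
  deriv (fun w => deriv (deriv g) w / deriv g w) z - 1 / 2 * (deriv (deriv g) z / deriv g z) ^ 2

/-- The inverse of the conformal map `f` of the unit disc onto its image. -/
def Shape.inv (s : Shape) : ℂ → ℂ := Function.invFunOn s.f (Metric.ball 0 1)

/-- `ϑ_{e ^ c f}(v ∂_z) = e ^ (-c) / (2 i π) ∮ 𝓢 f⁻¹(z) v(e ^ c z) dz`, the contour being a small
circle around `0` (the integral does not depend on the radius `r` once it is small enough). -/
def vartheta (η : Curve) (v : ℂ → ℂ) : ℂ :=
  limUnder (𝓝[>] (0 : ℝ)) fun r : ℝ =>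
    Complex.exp (-(η.c : ℂ)) / (2 * Complex.I * Real.pi) *
      ∮ z in C(0, r), schwarzian η.shape.inv z * v (Complex.exp (η.c : ℂ) * z)

/-- The central charge `c_m = 1 - 6 (2 / √κ - √κ / 2) ^ 2`. -/
def centralCharge (κ : ℝ) : ℝ := 1 - 6 * (2 / Real.sqrt κ - Real.sqrt κ / 2) ^ 2

/-- `Q_{n,0}`: the polynomial with `- (c_m / 12) ϑ(v_n) = e ^ (n c) Q_{n,0}`, the zeroth order term
of `𝐋_n = 𝓛_n - (c_m / 12) ϑ(v_n)`. -/
def coeffQ0 (κ : ℝ) (n : ℤ) : MvPolynomial ℕ+ ℂ :=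
  Classical.epsilon fun q => ∀ η : Curve,
    -((centralCharge κ : ℂ) / 12) * vartheta η (vecField n) = η.scaledEval n q

/-- The degree operator `𝐍 = ∑_{m ≥ 1} m a_m ∂_{a_m}` on `ℂ[(a_m)_{m ≥ 1}]`. -/
def degreeOp : Module.End ℂ (MvPolynomial ℕ+ ℂ) :=
  (MvPolynomial.mkDerivation ℂ fun m : ℕ+ =>
    (m : ℂ) • (MvPolynomial.X m : MvPolynomial ℕ+ ℂ)).toLinearMap

/-- The diagonal operator `𝐋_0^λ` on `ℂ[(a_m)_{m ≥ 1}]`: its eigenvalue is `λ + N` on polynomials of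
left degree `N`. -/
def opL0 (lam : ℂ) : Module.End ℂ (MvPolynomial ℕ+ ℂ) := lam • 1 + degreeOp

/-- The conjugate operator of `𝐋_0^λ`, restricted to `ℂ[(a_m)_{m ≥ 1}]`: polynomials in the `a_m` have
right degree `0`, hence eigenvalue `λ`. -/
def opL0bar (lam : ℂ) : Module.End ℂ (MvPolynomial ℕ+ ℂ) := lam • 1

/-- The operator `𝐋_n^λ` on `ℂ[(a_m)_{m ≥ 1}]`, obtained from `𝐋_n` by removing the prefactor
`e ^ (n c)` and replacing `∂_c` by minus the sum of `𝐋_0^λ` and its conjugate: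
`𝐋_n^λ = - P_{n,0} (𝐋_0^λ + conjugate) + Q_{n,0} + ∑_{m ≥ 1} P_{n,m} ∂_{a_m}`.
(The terms of `𝐋_n` in the derivatives `∂` with respect to the conjugate variables vanish on
`ℂ[(a_m)_{m ≥ 1}]`.) -/
def opL (κ : ℝ) (lam : ℂ) (n : ℤ) : Module.End ℂ (MvPolynomial ℕ+ ℂ) :=
  -(LinearMap.mulLeft ℂ (coeffP0 n) * (opL0 lam + opL0bar lam))
    + LinearMap.mulLeft ℂ (coeffQ0 κ n)
    + (MvPolynomial.mkDerivation ℂ (coeffP n)).toLinearMap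

end

end SLELoop

/-! ### The algebra of the level-2 relation -/

namespace SLELoop

/-! Only five coefficients enter the relation. Since `𝐋_{-1} 1` is a multiple of `a_1` and `1` is
killed by derivations, the vector depends on `P_{-1,0} = a_1`, `P_{-1,1} = 3 a_2 - 3 a_1²`,
`P_{-2,0} = 2 a_2 - (7/2) a_1²`, `Q_{-1,0} = 0` and `Q_{-2,0} = -(c_m/2)(a_2 - a_1²)`. It is then a
combination of `a_2` and `a_1²`, and both of its coefficients vanish exactly when `c_m (2λ + 1) = 2λ
(5 - 8λ)`. This is the Kac relation for a degenerate vector at level 2, and the two given values of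
`λ` are its solutions for `c_m = 13 - 24/κ - 3κ/2`.

The analysis lies in computing these coefficients, which are `Classical.epsilon` choices and so need
both existence and uniqueness. Uniqueness: the flow of `v_n` is determined for small times
(`HasUniqueFlow`); a trace determines `c` and `f`, by Schwarz's lemma in both directions
(`Curve.eqOn_of_trace_eq`); the `(1,0)`-part of a first-order expansion is unique; and a polynomial
in the `a_m` is determined by its values on curves, because small polynomial perturbations of the
identity are admissible (`eq_of_eval_a_eq`).

Existence requires the conformal map of the curve moved by `φ_t`, to first order in `t`. With `g =
e^c f`, put `ψ = g⁻¹ ∘ φ_t ∘ g`, a map close to the identity in an annulus. The new interior is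
obtained by gluing the disc with coordinate `g` to a collar of the boundary with coordinate `φ_t ∘
g`, along `ψ`. To uniformise it, look for coordinate changes `w e^{-K(w)}` near `0` and `w e^{k(w)}`
near the unit circle that agree after `ψ`, that is, `K ∘ ψ + k = log (ψ(s)/s)`. The choice `k(s) =
κ(1/s) - conj (κ(conj s))` makes `k` imaginary on the unit circle, so that the circle is preserved.
For `ψ = id` this equation is solved by the Laurent decomposition; for `ψ` close to `id` the same
recipe, with a Cauchy transform taken in the coordinate `ψ`, leaves an error of relative size `O(ε)`
on the same annulus, and iteration gives an exact solution (`exists_gluing_solution`). This replaces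
any appeal to the Riemann mapping theorem or to boundary regularity: the curve is arbitrary, and all
estimates take place in a fixed annulus inside the disc (`exists_perturbed_curve`).

The new coordinates are `c + Re K(0)` and `e^{Re K(0)} (a_1 + K'(0))`. To first order `K + k = t
X/s` with `X = v(g)/g'`, and Fourier coefficients on `|s| = 1/2` give `K(0)` and `K'(0)`. The
`(1,0)`-parts are thus Laurent coefficients of `X`, read off from the Taylor expansion of `g`. The
`Q`-terms are the value of `𝓢 f⁻¹` at `0`, by Cauchy's formula. -/

open MvPolynomial in
lemma singular_vector_of_coeff (κ : ℝ) (hκ0 : 0 < κ) (lam : ℂ)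
    (hlam : lam = (6 - (κ : ℂ)) / (2 * (κ : ℂ)) ∨ lam = (3 * (κ : ℂ) - 8) / 16)
    (h1 : coeffP0 (-1) = X 1) (h2 : coeffP (-1) 1 = C 3 * X 2 - C 3 * X 1 ^ 2)
    (h3 : coeffP0 (-2) = C 2 * X 2 - C (7 / 2) * X 1 ^ 2)
    (h4 : coeffQ0 κ (-1) = 0)
    (h5 : coeffQ0 κ (-2) = C (-(centralCharge κ : ℂ) / 2) * (X 2 - X 1 ^ 2)) :
    (opL κ lam (-1) ^ 2 - (2 / 3 * (2 * lam + 1)) • opL κ lam (-2))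
      (1 : MvPolynomial ℕ+ ℂ) = 0 := by
  have hκ : (κ : ℂ) ≠ 0 := by exact_mod_cast hκ0.ne'
  have hc : (centralCharge κ : ℂ) = 13 - 24 / κ - 3 * κ / 2 := by
    have : centralCharge κ = 13 - 24 / κ - 3 * κ / 2 := by
      have hs := Real.sq_sqrt hκ0.le
      have hs0 : Real.sqrt κ ≠ 0 := (Real.sqrt_pos.2 hκ0).ne'
      unfold centralCharge
      have : (2 / Real.sqrt κ - Real.sqrt κ / 2) ^ 2
          = 4 / (Real.sqrt κ ^ 2) - 2 + Real.sqrt κ ^ 2 / 4 := by field_simp; ring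
      rw [this, hs]
      field_simp
      ring
    rw [this]; push_cast; ring
  have e1 : opL κ lam (-1) 1 = C (-(2 * lam)) * X 1 := by
    simp [opL, opL0, opL0bar, degreeOp, h1, h4, smul_eq_C_mul, map_ofNat C]
    ring
  have e2 : opL κ lam (-1) (C (-(2 * lam)) * X 1)
      = C (2 * lam * (2 * lam + 4)) * X 1 ^ 2 - C (6 * lam) * X 2 := by
    have hD (D : Derivation ℂ (MvPolynomial ℕ+ ℂ) (MvPolynomial ℕ+ ℂ)) : D 2 = 0 := by
      exact_mod_cast D.map_natCast 2
    simp [hD, opL, opL0, opL0bar, degreeOp, h1, h2, h4, smul_eq_C_mul, mkDerivation_X, map_ofNat C]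
    ring
  have e3 : opL κ lam (-2) 1 = C (-(4 * lam + centralCharge κ / 2)) * X 2
      + C (7 * lam + centralCharge κ / 2) * X 1 ^ 2 := by
    have h7 : (C (7 / 2) : MvPolynomial ℕ+ ℂ) * 2 = 7 := by
      rw [← map_ofNat C, ← C_mul]; norm_num [map_ofNat C]
    simp [opL, opL0, opL0bar, degreeOp, h3, h5, smul_eq_C_mul, map_ofNat C]
    rw [neg_div, C_neg]
    linear_combination C lam * X 1 ^ 2 * h7
  -- This identity (the coefficient of `a_1²`) and the next one (that of `a_2`) are both equivalent
  -- to `c_m (2λ + 1) = 2λ (5 - 8λ)`.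
  have k1 : 2 * lam * (2 * lam + 4) = (2 / 3 * (2 * lam + 1)) * (7 * lam + centralCharge κ / 2) := by
    rw [hc]
    rcases hlam with rfl | rfl <;> field_simp <;> ring
  have k2 : - (6 * lam) = (2 / 3 * (2 * lam + 1)) * (-(4 * lam + centralCharge κ / 2)) := by
    rw [hc]
    rcases hlam with rfl | rfl <;> field_simp <;> ring
  rw [LinearMap.sub_apply, LinearMap.smul_apply, pow_two, Module.End.mul_apply, e1, e2, e3, k1,
    sub_eq_add_neg (C _ * _), ← neg_mul, ← C_neg, k2, smul_eq_C_mul]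
  simp only [C_mul]
  ring

end SLELoop

namespace SLELoop

open Metric

/-! ### A curve is determined by its trace -/

/-- The conformal map `e ^ c f` onto the interior of the curve. -/
noncomputable def Curve.map (η : Curve) (z : ℂ) : ℂ := Complex.exp (η.c : ℂ) * η.shape.f z

namespace Curve

variable (η : Curve)

lemma trace_eq : η.trace = η.map '' sphere 0 1 := rfl

lemma map_diffCont : DiffContOnCl ℂ η.map (ball 0 1) :=
  η.shape.diffCont.const_smul (Complex.exp (η.c : ℂ))

lemma map_continuousOn : ContinuousOn η.map (closedBall 0 1) := by
  have := η.map_diffCont.continuousOn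
  rwa [closure_ball _ one_ne_zero] at this

lemma map_differentiableOn : DifferentiableOn ℂ η.map (ball 0 1) := η.map_diffCont.differentiableOn

lemma map_injOn : Set.InjOn η.map (closedBall 0 1) := fun _ hx _ hy h =>
  η.shape.injOn hx hy (mul_left_cancel₀ (Complex.exp_ne_zero _) h)

lemma map_zero : η.map 0 = 0 := by simp [map, η.shape.map_zero]

lemma deriv_map (z : ℂ) : deriv η.map z = Complex.exp (η.c : ℂ) * deriv η.shape.f z := by
  unfold map; rw [deriv_const_mul_field]

lemma deriv_map_zero : deriv η.map 0 = Complex.exp (η.c : ℂ) := by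
  rw [deriv_map, η.shape.deriv_zero, mul_one]

lemma isOpen_image_map {U : Set ℂ} (hU : IsOpen U) (hU1 : U ⊆ ball 0 1) : IsOpen (η.map '' U) := by
  have hA : AnalyticOnNhd ℂ η.map (ball 0 1) :=
    η.map_differentiableOn.analyticOnNhd isOpen_ball
  rcases hA.is_constant_or_isOpen (convex_ball (0 : ℂ) 1).isPreconnected with ⟨w, hw⟩ | h
  · exfalso
    have h2 : (1 / 2 : ℂ) ∈ ball (0 : ℂ) 1 := by norm_num
    have h0 : (0 : ℂ) ∈ ball (0 : ℂ) 1 := by simp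
    have := η.map_injOn (ball_subset_closedBall h0) (ball_subset_closedBall h2)
      ((hw _ h0).trans (hw _ h2).symm)
    norm_num at this
  · exact h U hU1 hU

lemma image_ball_eq : η.map '' ball 0 1 = η.map '' closedBall 0 1 \ η.trace := by
  rw [trace_eq, ← η.map_injOn.image_sdiff_subset sphere_subset_closedBall, closedBall_sdiff_sphere]

/-- The complement of the trace is the disjoint union of two open sets, the image of the open disc
and the complement of the compact image of the closed disc, and the first is connected. The interior
is thereby recovered from the trace alone, without the Jordan curve theorem. -/
lemma image_ball_eq_connectedComponentIn : η.map '' ball 0 1 = connectedComponentIn η.traceᶜ 0 := by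
  have hpre : IsPreconnected (η.map '' ball 0 1) :=
    (convex_ball (0 : ℂ) 1).isPreconnected.image _ (η.map_continuousOn.mono ball_subset_closedBall)
  have h0 : (0 : ℂ) ∈ η.map '' ball 0 1 := ⟨0, by simp, η.map_zero⟩
  have hsub : η.map '' ball 0 1 ⊆ η.traceᶜ := by
    rw [image_ball_eq]; exact fun x hx => hx.2
  apply Set.Subset.antisymm (hpre.subset_connectedComponentIn h0 hsub)
  have hclosed : IsClosed (η.map '' closedBall 0 1) :=
    ((isCompact_closedBall _ _).image_of_continuousOn η.map_continuousOn).isClosed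
  have hC := isPreconnected_connectedComponentIn (x := (0 : ℂ)) (F := η.traceᶜ)
  have := hC.subset_left_of_subset_union (η.isOpen_image_map isOpen_ball subset_rfl)
    hclosed.isOpen_compl ?_ ?_ ⟨0, mem_connectedComponentIn (hsub h0), h0⟩
  · exact this
  · rw [Set.disjoint_compl_right_iff_subset]; exact Set.image_mono ball_subset_closedBall
  · intro x hx
    have hx' := connectedComponentIn_subset _ _ hx
    by_cases h : x ∈ η.map '' closedBall 0 1
    · left; rw [image_ball_eq]; exact ⟨h, hx'⟩
    · right; exact h

end Curve

/-! ### Inverses of injective holomorphic maps -/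

section Inverse

variable {f G : ℂ → ℂ} {U : Set ℂ}

lemma nhds_le_map_of_injOn (hU : IsOpen U) (hf : DifferentiableOn ℂ f U)
    (hi : Set.InjOn f U) {z : ℂ} (hz : z ∈ U) : 𝓝 (f z) ≤ map f (𝓝 z) := by
  rcases (hf.analyticAt (hU.mem_nhds hz)).eventually_constant_or_nhds_le_map_nhds with h | h
  · exfalso
    obtain ⟨y, ⟨h1, h2⟩, h3⟩ :=
      (((h.and (hU.mem_nhds hz)).filter_mono nhdsWithin_le_nhds).and
        (self_mem_nhdsWithin : {z}ᶜ ∈ 𝓝[≠] z)).exists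
    exact h3 (hi h2 hz h1)
  · exact h

lemma continuousAt_leftInvOn (hU : IsOpen U) (hf : DifferentiableOn ℂ f U)
    (hi : Set.InjOn f U) (hG : Set.LeftInvOn G f U) {z : ℂ} (hz : z ∈ U) :
    ContinuousAt G (f z) := by
  have h := map_mono (m := G) (nhds_le_map_of_injOn hU hf hi hz)
  rw [map_map, map_congr (show G ∘ f =ᶠ[𝓝 z] id from
    (hU.eventually_mem hz).mono fun y hy => hG hy), map_id] at h
  unfold ContinuousAt Tendsto
  rwa [hG hz]

lemma eventually_rightInv (hU : IsOpen U) (hf : DifferentiableOn ℂ f U)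
    (hi : Set.InjOn f U) (hG : Set.LeftInvOn G f U) {z : ℂ} (hz : z ∈ U) :
    ∀ᶠ w in 𝓝 (f z), f (G w) = w := by
  refine nhds_le_map_of_injOn hU hf hi hz ?_
  rw [mem_map]
  filter_upwards [hU.mem_nhds hz] with y hy
  simp [hG hy]

/-- The inverse of an injective holomorphic map is holomorphic. -/
lemma analyticAt_leftInvOn (hU : IsOpen U) (hf : DifferentiableOn ℂ f U)
    (hi : Set.InjOn f U) (hG : Set.LeftInvOn G f U) {z : ℂ} (hz : z ∈ U) :
    AnalyticAt ℂ G (f z) := by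
  -- It is not yet known that `deriv f z ≠ 0`. Zeros of `deriv f` are isolated, so `G` is
  -- differentiable on a punctured neighbourhood of `f z`, and continuity removes the singularity.
  refine Complex.analyticAt_of_differentiable_on_punctured_nhds_of_continuousAt ?_
    (continuousAt_leftInvOn hU hf hi hG hz)
  rw [eventually_nhdsWithin_iff]
  refine nhds_le_map_of_injOn hU hf hi hz ?_
  have hd : AnalyticAt ℂ (deriv f) z := (hf.analyticAt (hU.mem_nhds hz)).deriv
  rcases hd.eventually_eq_zero_or_eventually_ne_zero with h | h
  · exfalso
    obtain ⟨r, hr, hb⟩ := Metric.mem_nhds_iff.1 (h.and (hU.mem_nhds hz))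
    have hsub : ball z r ⊆ U := fun y hy => (hb hy).2
    obtain ⟨y, hy, hne⟩ := (((isOpen_ball.eventually_mem (mem_ball_self hr)).filter_mono
      nhdsWithin_le_nhds).and (self_mem_nhdsWithin : {z}ᶜ ∈ 𝓝[≠] z)).exists
    refine hne (hi (hsub hy) hz ?_)
    exact isOpen_ball.is_const_of_deriv_eq_zero (convex_ball z r).isPreconnected (hf.mono hsub)
      (fun w hw => (hb hw).1) hy (mem_ball_self hr)
  · rw [eventually_nhdsWithin_iff] at h
    rw [mem_map]
    filter_upwards [h, hU.mem_nhds hz] with y hy hyU hne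
    have hyz : y ≠ z := fun h => hne (by simp [h])
    refine (HasDerivAt.of_local_left_inverse (f := f) (f' := deriv f y)
      (continuousAt_leftInvOn hU hf hi hG hyU) ?_ (hy hyz)
      (eventually_rightInv hU hf hi hG hyU)).differentiableAt
    rw [hG hyU]
    exact (hf.differentiableAt (hU.mem_nhds hyU)).hasDerivAt

lemma deriv_leftInvOn_mul (hU : IsOpen U) (hf : DifferentiableOn ℂ f U)
    (hi : Set.InjOn f U) (hG : Set.LeftInvOn G f U) {z : ℂ} (hz : z ∈ U) :
    deriv G (f z) * deriv f z = 1 := by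
  have h1 := (analyticAt_leftInvOn hU hf hi hG hz).differentiableAt.hasDerivAt.comp z
    (hf.differentiableAt (hU.mem_nhds hz)).hasDerivAt
  have h2 : HasDerivAt (G ∘ f) 1 z := (hasDerivAt_id z).congr_of_eventuallyEq
    ((hU.eventually_mem hz).mono fun y hy => hG hy)
  exact h1.unique h2

lemma deriv_ne_zero_of_injOn (hU : IsOpen U) (hf : DifferentiableOn ℂ f U)
    (hi : Set.InjOn f U) {z : ℂ} (hz : z ∈ U) : deriv f z ≠ 0 :=
  right_ne_zero_of_mul_eq_one (deriv_leftInvOn_mul hU hf hi hi.leftInvOn_invFunOn hz)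

end Inverse

/-- The norm of the derivative of a conformal map at `0` is at most that of any conformal map with
larger image. -/
lemma norm_deriv_le_of_image_subset {g h : ℂ → ℂ} (hg : DifferentiableOn ℂ g (ball 0 1))
    (hgi : Set.InjOn g (ball 0 1)) (hh : DifferentiableOn ℂ h (ball 0 1)) (hg0 : g 0 = 0)
    (hh0 : h 0 = 0) (hsub : h '' ball 0 1 ⊆ g '' ball 0 1) :
    ‖deriv h 0‖ ≤ ‖deriv g 0‖ ∧
      (‖deriv h 0‖ = ‖deriv g 0‖ → ∃ a : ℂ, ∀ z ∈ ball (0 : ℂ) 1, a * z ∈ ball (0 : ℂ) 1 ∧ h z = g (a * z)) := by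
  -- Schwarz's lemma will be applied to `G ∘ h`, which maps the disc to itself and fixes `0`; its
  -- equality case gives the rotation `a`.
  set G := Function.invFunOn g (ball 0 1)
  have hG : Set.LeftInvOn G g (ball 0 1) := hgi.leftInvOn_invFunOn
  have h0 : (0 : ℂ) ∈ ball (0 : ℂ) 1 := by simp
  have hmaps : Set.MapsTo (G ∘ h) (ball 0 1) (ball 0 1) := by
    intro z hz
    obtain ⟨w, hw, hwz⟩ := hsub ⟨z, hz, rfl⟩
    simp only [Function.comp, ← hwz]
    rwa [hG hw]
  have hcomp (z) (hz : z ∈ ball (0 : ℂ) 1) : g (G (h z)) = h z := by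
    obtain ⟨w, hw, hwz⟩ := hsub ⟨z, hz, rfl⟩
    rw [← hwz, hG hw]
  have hd : DifferentiableOn ℂ (G ∘ h) (ball 0 1) := by
    intro z hz
    obtain ⟨w, hw, hwz⟩ := hsub ⟨z, hz, rfl⟩
    have := (analyticAt_leftInvOn isOpen_ball hg hgi hG hw).differentiableAt
    rw [hwz] at this
    exact (this.comp z (hh.differentiableAt (isOpen_ball.mem_nhds hz))).differentiableWithinAt
  have hG0 : G 0 = 0 := by simpa [hg0] using hG h0
  have h00 : (G ∘ h) 0 = 0 := by simp [hh0, hG0]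
  have hder : deriv (G ∘ h) 0 * deriv g 0 = deriv h 0 := by
    have h1 := deriv_leftInvOn_mul isOpen_ball hg hgi hG h0
    have h2 := (analyticAt_leftInvOn isOpen_ball hg hgi hG h0).differentiableAt
    rw [hg0] at h1 h2
    rw [deriv_comp, hh0]
    · linear_combination deriv h 0 * h1
    · rwa [hh0]
    · exact hh.differentiableAt (isOpen_ball.mem_nhds h0)
  have hle : ‖deriv (G ∘ h) 0‖ ≤ 1 :=
    Complex.norm_deriv_le_one_of_mapsTo_ball hd
      (by rw [h00]; exact hmaps.mono_right ball_subset_closedBall) one_pos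
  have hgne := deriv_ne_zero_of_injOn isOpen_ball hg hgi h0
  rw [← hder, norm_mul]
  refine ⟨mul_le_of_le_one_left (norm_nonneg _) hle, fun heq => ?_⟩
  have hone : ‖deriv (G ∘ h) 0‖ = 1 := by
    have : ‖deriv g 0‖ ≠ 0 := norm_ne_zero_iff.2 hgne
    exact mul_right_cancel₀ this (by rw [heq, one_mul])
  have := Complex.affine_of_mapsTo_ball_of_norm_dslope_eq_div (c := 0) (R₁ := 1) (R₂ := 1) (z₀ := 0) hd
    (by rw [h00]; exact hmaps.mono_right ball_subset_closedBall) h0 (by rw [dslope_same, hone]; norm_num)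
  refine ⟨dslope (G ∘ h) 0 0, fun z hz => ?_⟩
  have hz' := this hz
  simp only [h00, sub_zero, smul_eq_mul, zero_add] at hz'
  rw [mul_comm, ← hz']
  exact ⟨hmaps hz, (hcomp z hz).symm⟩

namespace Curve

/-- Both maps have the same image, so Schwarz's lemma in both directions equates the moduli of the
derivatives at `0`, which are `e^c`. The equality case leaves a rotation, which is trivial because
both derivatives are positive. -/
lemma eqOn_of_trace_eq {η η' : Curve} (h : η.trace = η'.trace) :
    η.c = η'.c ∧ Set.EqOn η.shape.f η'.shape.f (ball 0 1) := by
  have himg : η.map '' ball 0 1 = η'.map '' ball 0 1 := by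
    rw [image_ball_eq_connectedComponentIn, image_ball_eq_connectedComponentIn, h]
  have key := norm_deriv_le_of_image_subset η'.map_differentiableOn
    (η'.map_injOn.mono ball_subset_closedBall) η.map_differentiableOn η'.map_zero η.map_zero himg.le
  have key' := norm_deriv_le_of_image_subset η.map_differentiableOn
    (η.map_injOn.mono ball_subset_closedBall) η'.map_differentiableOn η.map_zero η'.map_zero himg.ge
  have hnorm := le_antisymm key.1 key'.1
  have hc : η.c = η'.c := by
    simpa [deriv_map_zero, Complex.norm_exp] using hnorm
  refine ⟨hc, ?_⟩
  obtain ⟨a, ha⟩ := key.2 hnorm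
  have h0 : (0 : ℂ) ∈ ball (0 : ℂ) 1 := by simp
  have ha1 : a = 1 := by
    have h1 : deriv η.map 0 = deriv (fun z => η'.map (a * z)) 0 := by
      apply Filter.EventuallyEq.deriv_eq
      filter_upwards [isOpen_ball.mem_nhds h0] with z hz using (ha z hz).2
    rw [deriv_comp_mul_left, mul_zero, deriv_map_zero, deriv_map_zero, hc, smul_eq_mul] at h1
    exact (mul_eq_right₀ (Complex.exp_ne_zero _)).1 h1.symm
  intro z hz
  have := (ha z hz).2
  rw [ha1, one_mul] at this
  simp only [map, hc] at this
  exact mul_left_cancel₀ (Complex.exp_ne_zero _) this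

lemma a_eq_of_trace_eq {η η' : Curve} (h : η.trace = η'.trace) (m : ℕ+) : η.a m = η'.a m := by
  unfold a
  congr 1
  apply Filter.EventuallyEq.iteratedDeriv_eq
  filter_upwards [isOpen_ball.mem_nhds (show (0 : ℂ) ∈ ball (0 : ℂ) 1 by simp)] with z hz
  exact (eqOn_of_trace_eq h).2 hz

end Curve

end SLELoop

namespace SLELoop

open Metric

/-! ### Polynomials in the coordinates `a_m` are determined by their values on curves -/

lemma norm_pow_sub_pow_le {z w : ℂ} (hz : ‖z‖ ≤ 1) (hw : ‖w‖ ≤ 1) (n : ℕ) :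
    ‖z ^ n - w ^ n‖ ≤ n * ‖z - w‖ := by
  induction n with
  | zero => simp
  | succ n ih =>
    have : z ^ (n + 1) - w ^ (n + 1) = z ^ n * (z - w) + (z ^ n - w ^ n) * w := by ring
    rw [this]
    have h1 : ‖z ^ n‖ ≤ 1 := by rw [norm_pow]; exact pow_le_one₀ (norm_nonneg _) hz
    calc ‖z ^ n * (z - w) + (z ^ n - w ^ n) * w‖ ≤ ‖z ^ n‖ * ‖z - w‖ + ‖z ^ n - w ^ n‖ * ‖w‖ := by
          rw [← norm_mul, ← norm_mul]; exact norm_add_le _ _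
      _ ≤ 1 * ‖z - w‖ + (n * ‖z - w‖) * 1 := by gcongr
      _ = ((n + 1 : ℕ) : ℝ) * ‖z - w‖ := by push_cast; ring

/-- The polynomial `z + ∑ x_m z^(m+1)` is injective on the closed disc, since its nonlinear part is
a strict contraction there when `∑ (m+1) |x_m| < 1`. -/
lemma exists_shape_of_sum_lt_one (s : Finset ℕ+) (x : ℕ+ → ℂ)
    (hx : ∑ m ∈ s, ((m : ℕ) + 1 : ℝ) * ‖x m‖ < 1) :
    ∃ η : Curve, ∀ m ∈ s, η.a m = x m := by
  set f : ℂ → ℂ := fun z => z + ∑ m ∈ s, x m * z ^ ((m : ℕ) + 1) with hf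
  have hfd : Differentiable ℂ f := by fun_prop
  have hit (k : ℕ) (hk : 1 ≤ k) : iteratedDeriv (k + 1) f 0
      = (Nat.factorial (k + 1) : ℂ) * ∑ m ∈ s, if (m : ℕ) = k then x m else 0 := by
    have h1 : iteratedDeriv (k + 1) f 0 = iteratedDeriv (k + 1) (fun z : ℂ => z) 0
        + iteratedDeriv (k + 1) (fun z => ∑ m ∈ s, x m * z ^ ((m : ℕ) + 1)) 0 :=
      iteratedDeriv_fun_add (by fun_prop) (by fun_prop)
    rw [h1, iteratedDeriv_fun_sum (fun i _ => by fun_prop), iteratedDeriv_fun_id_zero, if_neg (by omega),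
      zero_add, Finset.mul_sum]
    refine Finset.sum_congr rfl fun m _ => ?_
    rw [iteratedDeriv_const_mul_field, iteratedDeriv_fun_pow_zero]
    by_cases h : (m : ℕ) = k
    · simp [h, mul_comm]
    · rw [if_neg (by omega), if_neg h]; simp
  refine ⟨⟨0, f, hfd.diffContOnCl, ?_, by simp [hf], ?_⟩, fun m hm => ?_⟩
  · intro z hz w hw h
    by_contra hne
    have hz' : ‖z‖ ≤ 1 := by simpa using hz
    have hw' : ‖w‖ ≤ 1 := by simpa using hw
    have hpos : 0 < ‖z - w‖ := norm_pos_iff.2 (sub_ne_zero.2 hne)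
    have e : z - w = ∑ m ∈ s, x m * (w ^ ((m : ℕ) + 1) - z ^ ((m : ℕ) + 1)) := by
      simp only [mul_sub, Finset.sum_sub_distrib]
      simp only [hf] at h
      linear_combination h
    have : ‖z - w‖ ≤ (∑ m ∈ s, ((m : ℕ) + 1 : ℝ) * ‖x m‖) * ‖z - w‖ := by
      conv_lhs => rw [e]
      refine (norm_sum_le _ _).trans ?_
      rw [Finset.sum_mul]
      refine Finset.sum_le_sum fun m _ => ?_
      rw [norm_mul]
      calc ‖x m‖ * ‖w ^ ((m : ℕ) + 1) - z ^ ((m : ℕ) + 1)‖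
          ≤ ‖x m‖ * (((m : ℕ) + 1 : ℕ) * ‖w - z‖) := by gcongr; exact norm_pow_sub_pow_le hw' hz' _
        _ = _ := by rw [norm_sub_rev]; push_cast; ring
    nlinarith
  · have : HasDerivAt f (1 + ∑ m ∈ s, x m * (((m : ℕ) + 1 : ℕ) * 0 ^ (m : ℕ))) 0 :=
      (hasDerivAt_id (0 : ℂ)).add (HasDerivAt.fun_sum fun m _ => (hasDerivAt_pow _ 0).const_mul _)
    rw [this.deriv]
    simp
  · have := hit m m.2
    unfold Curve.a
    simp only [this, PNat.coe_inj, Finset.sum_ite_eq', hm, if_true]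
    field_simp [Nat.factorial_ne_zero]

/-- Only finitely many variables occur, and curves realise every value of these in a product of
small discs; polynomials agreeing on a product of infinite sets are equal. -/
lemma eq_of_eval_a_eq {p q : MvPolynomial ℕ+ ℂ}
    (h : ∀ η : Curve, MvPolynomial.eval η.a p = MvPolynomial.eval η.a q) : p = q := by
  set s := p.vars ∪ q.vars
  have hr (m : ℕ+) : 0 < 1 / (((m : ℕ) + 1 : ℝ) * (s.card + 1)) := by positivity
  -- With these radii each of the `s.card` terms of `∑ (m+1) |x_m|` is at most `1 / (s.card + 1)`,
  -- so the sum is below `1`.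
  refine MvPolynomial.funext_set (fun m => ball (0 : ℂ) (1 / (((m : ℕ) + 1 : ℝ) * (s.card + 1))))
    (fun m => ?_) fun x hx => ?_
  · exact infinite_of_mem_nhds (0 : ℂ) (ball_mem_nhds _ (hr m))
  · have hsum : ∑ m ∈ s, ((m : ℕ) + 1 : ℝ) * ‖x m‖ < 1 := by
      calc ∑ m ∈ s, ((m : ℕ) + 1 : ℝ) * ‖x m‖ ≤ ∑ m ∈ s, 1 / (s.card + 1 : ℝ) := by
            refine Finset.sum_le_sum fun m _ => ?_
            have : ‖x m‖ ≤ 1 / (((m : ℕ) + 1 : ℝ) * (s.card + 1)) := by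
              exact (mem_ball_zero_iff.1 (hx m trivial)).le
            calc _ ≤ ((m : ℕ) + 1 : ℝ) * (1 / (((m : ℕ) + 1 : ℝ) * (s.card + 1))) := by gcongr
              _ = _ := by field_simp
        _ < 1 := by
            rw [Finset.sum_const, nsmul_eq_mul, mul_one_div, div_lt_one (by positivity)]
            linarith
    obtain ⟨η, hη⟩ := exists_shape_of_sum_lt_one s x hsum
    have hc (r : MvPolynomial ℕ+ ℂ) (hr : r.vars ⊆ s) :
        MvPolynomial.eval x r = MvPolynomial.eval η.a r := by
      refine MvPolynomial.eval₂Hom_congr' rfl (fun i hi _ => ?_) rfl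
      exact (hη i (hr hi)).symm
    rw [hc p Finset.subset_union_left, hc q Finset.subset_union_right, h η]

lemma eq_of_scaledEval_eq {n : ℤ} {p q : MvPolynomial ℕ+ ℂ}
    (h : ∀ η : Curve, η.scaledEval n p = η.scaledEval n q) : p = q :=
  eq_of_eval_a_eq fun η => mul_left_cancel₀ (Complex.exp_ne_zero _) (h η)

/-! ### Uniqueness of the Lie derivative -/

/-- Along the rays of directions `1` and `i` the hypothesis gives `a + b = 0` and `i (a - b) = 0`.
-/
lemma eq_zero_of_isLittleO {a b : ℂ}
    (h : (fun t : ℂ => t * a + (starRingEnd ℂ) t * b) =o[𝓝 0] (fun t : ℂ => t)) : a = 0 := by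
  have key (u : ℂ) (hu : ‖u‖ = 1) : u * a + (starRingEnd ℂ) u * b = 0 := by
    have ht : Tendsto (fun s : ℝ => (s : ℂ) * u) (𝓝[>] 0) (𝓝 0) := by
      have : Continuous fun s : ℝ => (s : ℂ) * u := by fun_prop
      simpa using (this.tendsto 0).mono_left nhdsWithin_le_nhds
    have h2 := (h.comp_tendsto ht).norm_norm
    have h3 : (fun s : ℝ => s * ‖u * a + (starRingEnd ℂ) u * b‖) =o[𝓝[>] 0] fun s : ℝ => s := by
      refine h2.congr' ?_ ?_
      · filter_upwards [self_mem_nhdsWithin] with s hs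
        have : (s : ℂ) * u * a + (starRingEnd ℂ) ((s : ℂ) * u) * b
            = s * (u * a + (starRingEnd ℂ) u * b) := by
          rw [map_mul, Complex.conj_ofReal]; ring
        simp only [Function.comp, this, norm_mul, Complex.norm_real, Real.norm_of_nonneg (le_of_lt hs)]
      · filter_upwards [self_mem_nhdsWithin] with s hs
        simp only [Function.comp, norm_mul, hu, Complex.norm_real, Real.norm_of_nonneg (le_of_lt hs), mul_one]
    by_contra hne
    have hne' := norm_pos_iff.2 hne
    have h4 := (isLittleO_iff.1 h3) (half_pos hne')
    obtain ⟨s, hs, hs0⟩ := (h4.and self_mem_nhdsWithin).exists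
    have hs0 : (0 : ℝ) < s := hs0
    rw [norm_mul, Real.norm_of_nonneg hs0.le, norm_norm] at hs
    nlinarith
  have h1 := key 1 (by simp)
  have h2 := key Complex.I (by simp)
  simp only [map_one, one_mul, Complex.conj_I] at h1 h2
  have hI : Complex.I * (a - b) = 0 := by linear_combination h2
  have : a - b = 0 := (mul_eq_zero.1 hI).resolve_left Complex.I_ne_zero
  linear_combination (h1 + this) / 2

/-- Flows of `v` agree, for small times, near any set satisfying pointwise-uniform uniqueness. -/
def HasUniqueFlow (v : ℂ → ℂ) : Prop :=
  ∀ K : Set ℂ, IsCompact K → 0 ∉ K → ∀ φ φ' : ℂ → ℂ → ℂ, IsFlowNear v K φ → IsFlowNear v K φ' →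
    ∀ᶠ t in 𝓝 (0 : ℂ), Set.EqOn (φ t) (φ' t) K

lemma Curve.isCompact_trace (η : Curve) : IsCompact η.trace :=
  (isCompact_sphere _ _).image_of_continuousOn (η.map_continuousOn.mono sphere_subset_closedBall)

lemma Curve.zero_notMem_trace (η : Curve) : 0 ∉ η.trace := by
  rintro ⟨z, hz, h⟩
  have hz' : z = 0 := η.map_injOn (sphere_subset_closedBall hz) (by simp) (h.trans η.map_zero.symm)
  simp [hz'] at hz

/-- The choices of flow and of representing curves drop out: for small times both moved curves have
the same trace, and `F` depends only on the trace. Subtracting the two expansions leaves a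
real-linear function of `t` that is `o(t)`. -/
lemma HasLieDerivAt.unique {v : ℂ → ℂ} (hv : HasUniqueFlow v) {F : Curve → ℂ}
    (hF : ∀ η η' : Curve, η.trace = η'.trace → F η = F η') {η : Curve} {α β α' β' : ℂ}
    (h : HasLieDerivAt v F η α β) (h' : HasLieDerivAt v F η α' β') : α = α' := by
  obtain ⟨φ, hφ, ηt, ht, ho⟩ := h
  obtain ⟨φ', hφ', ηt', ht', ho'⟩ := h'
  have hu := hv _ η.isCompact_trace η.zero_notMem_trace φ φ' hφ hφ'
  have hd := ho'.sub ho
  have : (fun t : ℂ => t * (α - α') + (starRingEnd ℂ) t * (β - β')) =o[𝓝 0] (fun t : ℂ => t) := by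
    refine hd.congr' ?_ EventuallyEq.rfl
    filter_upwards [ht, ht', hu] with t h1 h2 h3
    have : F (ηt t) = F (ηt' t) := hF _ _ (by rw [h1, h2, h3.image_eq])
    rw [this]; ring
  exact sub_eq_zero.1 (eq_zero_of_isLittleO this)

/-- The chosen polynomial satisfies the specification as soon as some `p` does, and then uniqueness
of the `(1,0)`-part identifies it with `p`. -/
lemma epsilon_isLieCoeff_eq {n : ℤ} (hv : HasUniqueFlow (vecField n)) {F : Curve → ℂ}
    (hF : ∀ η η' : Curve, η.trace = η'.trace → F η = F η') {p : MvPolynomial ℕ+ ℂ}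
    (hp : IsLieCoeff n F p) : Classical.epsilon (IsLieCoeff n F) = p := by
  have h : IsLieCoeff n F (Classical.epsilon (IsLieCoeff n F)) := Classical.epsilon_spec ⟨p, hp⟩
  refine eq_of_scaledEval_eq (n := n) fun η => ?_
  exact HasLieDerivAt.unique hv hF (h η).choose_spec (hp η).choose_spec

/-! ### The flows of `v_{-1}` and `v_{-2}` -/

lemma hasUniqueFlow_vecField_neg_one : HasUniqueFlow (vecField (-1)) := by
  intro K _ _ φ φ' ⟨U, _, hKU, ε, hε, h⟩ ⟨U', _, hKU', ε', hε', h'⟩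
  filter_upwards [ball_mem_nhds (0 : ℂ) (lt_min hε hε')] with t ht z hz
  have hc (φ : ℂ → ℂ → ℂ) (ε : ℝ) (h0 : φ 0 z = z) (hε : ‖t‖ < ε)
      (h : ∀ t : ℂ, ‖t‖ < ε → HasDerivAt (fun s => φ s z) (vecField (-1) (φ t z)) t) :
      φ t z = z - t := by
    have hd (s : ℂ) (hs : s ∈ ball (0 : ℂ) ε) : HasDerivAt (fun s => φ s z + s) 0 s := by
      have := (h s (by simpa using hs)).fun_add (hasDerivAt_id' s)
      simpa [vecField] using this
    have h00 : (0 : ℂ) ∈ ball (0 : ℂ) ε := by simpa using (norm_nonneg t).trans_lt hε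
    have := isOpen_ball.is_const_of_deriv_eq_zero (convex_ball (0 : ℂ) ε).isPreconnected
      (fun s hs => (hd s hs).differentiableAt.differentiableWithinAt)
      (fun s hs => (hd s hs).deriv) (x := t) (y := 0) (by simpa using hε) h00
    simp only [h0, add_zero] at this
    exact eq_sub_of_add_eq this
  have ht' : ‖t‖ < min ε ε' := by simpa using ht
  rw [hc φ ε (h z (hKU hz)).1 (ht'.trans_le (min_le_left _ _)) (h z (hKU hz)).2,
    hc φ' ε' (h' z (hKU' hz)).1 (ht'.trans_le (min_le_right _ _)) (h' z (hKU' hz)).2]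

/-- The flow `√(z² - 2 t)` of `v_{-2} = - z⁻¹ ∂_z`. -/
noncomputable def sqrtFlow (t z : ℂ) : ℂ := z * Complex.exp (Complex.log (1 - 2 * t / z ^ 2) / 2)

lemma one_sub_mem_slitPlane {x : ℂ} (hx : ‖x‖ < 1) : 1 - x ∈ Complex.slitPlane := by
  have := Complex.mem_slitPlane_of_norm_lt_one (z := -x) (by simpa using hx)
  rwa [← sub_eq_add_neg] at this

lemma norm_two_mul_div_sq_lt {t z : ℂ} {ρ : ℝ} (hρ : 0 < ρ) (hz : ρ ≤ ‖z‖) (ht : ‖t‖ < ρ ^ 2 / 2) :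
    ‖2 * t / z ^ 2‖ < 1 := by
  have hz0 : 0 < ‖z‖ := hρ.trans_le hz
  rw [norm_div, norm_mul, norm_pow, div_lt_one (by positivity)]
  have : ρ ^ 2 ≤ ‖z‖ ^ 2 := by gcongr
  simp only [Complex.norm_ofNat]
  linarith

lemma sqrtFlow_sq {t z : ℂ} (hz : z ≠ 0) (h : ‖2 * t / z ^ 2‖ < 1) :
    sqrtFlow t z ^ 2 = z ^ 2 - 2 * t := by
  have h1 := Complex.slitPlane_ne_zero (one_sub_mem_slitPlane h)
  rw [sqrtFlow, mul_pow, ← Complex.exp_nat_mul]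
  push_cast
  rw [mul_div_cancel₀ _ two_ne_zero, Complex.exp_log h1]
  field_simp

lemma sqrtFlow_ne_zero {t z : ℂ} (hz : z ≠ 0) : sqrtFlow t z ≠ 0 :=
  mul_ne_zero hz (Complex.exp_ne_zero _)

lemma sqrtFlow_zero (z : ℂ) : sqrtFlow 0 z = z := by simp [sqrtFlow]

lemma hasDerivAt_sqrtFlow {t z : ℂ} (hz : z ≠ 0) (h : ‖2 * t / z ^ 2‖ < 1) :
    HasDerivAt (fun s => sqrtFlow s z) (-(sqrtFlow t z)⁻¹) t := by
  have h1 : HasDerivAt (fun s : ℂ => 1 - 2 * s / z ^ 2) (-(2 * 1 / z ^ 2)) t :=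
    (((hasDerivAt_id' t).const_mul 2).div_const (z ^ 2)).const_sub 1
  have h2 := (((h1.clog (one_sub_mem_slitPlane h)).div_const 2).cexp).const_mul z
  refine h2.congr_deriv ?_
  have h3 := sqrtFlow_sq hz h
  have h4 := sqrtFlow_ne_zero (t := t) hz
  have h5 : z ^ 2 - 2 * t ≠ 0 := by rw [← h3]; exact pow_ne_zero 2 h4
  have h6 : -(sqrtFlow t z)⁻¹ = -sqrtFlow t z / (z ^ 2 - 2 * t) := by
    rw [← h3]; field_simp
  have h7 : 1 - 2 * t / z ^ 2 ≠ 0 := Complex.slitPlane_ne_zero (one_sub_mem_slitPlane h)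
  rw [h6, sqrtFlow]
  field_simp

lemma vecField_neg_two (z : ℂ) : vecField (-2) z = -z⁻¹ := by
  simp [vecField]

lemma vecField_neg_one (z : ℂ) : vecField (-1) z = -1 := by
  simp [vecField]

/-- The quantity `φ² + 2t` is conserved wherever `φ ≠ 0`. Because `0⁻¹ = 0`, the differential
equation does not itself prevent `φ` from vanishing, so conservation is first obtained only near `t
= 0`. The identity theorem extends it to the whole disc, which shows a posteriori that `φ` has no
zero. The sign of the root is then fixed because the quotient by `sqrtFlow` has zero derivative and
equals `1` at `t = 0`. -/
lemma eq_sqrtFlow {φ : ℂ → ℂ} {z : ℂ} {ρ r : ℝ} (hρ : 0 < ρ) (hz : ρ ≤ ‖z‖) (hr : r ≤ ρ ^ 2 / 2)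
    (h0 : φ 0 = z) (h : ∀ t : ℂ, ‖t‖ < r → HasDerivAt φ (-(φ t)⁻¹) t) {t : ℂ} (ht : ‖t‖ < r) :
    φ t = sqrtFlow t z := by
  have hz0 : z ≠ 0 := norm_pos_iff.1 (hρ.trans_le hz)
  have hr0 : 0 < r := (norm_nonneg t).trans_lt ht
  have hsmall (s : ℂ) (hs : s ∈ ball (0 : ℂ) r) : ‖2 * s / z ^ 2‖ < 1 :=
    norm_two_mul_div_sq_lt hρ hz ((mem_ball_zero_iff.1 hs).trans_le hr)
  have hd (s : ℂ) (hs : s ∈ ball (0 : ℂ) r) := h s (by simpa using hs)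
  have hq (s : ℂ) (hs : s ∈ ball (0 : ℂ) r) :
      HasDerivAt (fun s => φ s ^ 2 + 2 * s) (2 * φ s * -(φ s)⁻¹ + 2) s := by
    have := ((hd s hs).fun_pow 2).fun_add ((hasDerivAt_id' s).const_mul 2)
    simpa using this
  have hqd : DifferentiableOn ℂ (fun s => φ s ^ 2 + 2 * s) (ball 0 r) :=
    fun s hs => (hq s hs).differentiableAt.differentiableWithinAt
  have hb0 : (0 : ℂ) ∈ ball (0 : ℂ) r := by simpa using hr0
  have hne : ∀ᶠ s in 𝓝 (0 : ℂ), φ s ≠ 0 ∧ s ∈ ball (0 : ℂ) r :=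
    ((hd 0 hb0).continuousAt.eventually_ne (by rwa [h0])).and (isOpen_ball.eventually_mem hb0)
  have hloc : (fun s => φ s ^ 2 + 2 * s) =ᶠ[𝓝 0] fun _ => z ^ 2 := by
    obtain ⟨r', hr', hb⟩ := Metric.eventually_nhds_iff_ball.1 hne
    filter_upwards [ball_mem_nhds (0 : ℂ) hr'] with s hs
    have := isOpen_ball.is_const_of_deriv_eq_zero (convex_ball (0 : ℂ) r').isPreconnected
      (hqd.mono fun s hs => (hb s hs).2) (fun s hs => ?_) hs (mem_ball_self hr')
    · simpa [h0] using this
    · rw [(hq s (hb s hs).2).deriv]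
      have := (hb s hs).1
      field_simp; simp
  have hsq : Set.EqOn (fun s => φ s ^ 2 + 2 * s) (fun _ => z ^ 2) (ball 0 r) :=
    (hqd.analyticOnNhd isOpen_ball).eqOn_of_preconnected_of_eventuallyEq analyticOnNhd_const
      (convex_ball (0 : ℂ) r).isPreconnected hb0 hloc
  have hsq' (s) (hs : s ∈ ball (0 : ℂ) r) : φ s ^ 2 = sqrtFlow s z ^ 2 := by
    rw [sqrtFlow_sq hz0 (hsmall s hs)]
    linear_combination hsq hs
  have hφ0 (s) (hs : s ∈ ball (0 : ℂ) r) : φ s ≠ 0 := fun h => by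
    have := hsq' s hs
    rw [h] at this
    exact pow_ne_zero 2 (sqrtFlow_ne_zero hz0) (this.symm.trans (by norm_num))
  have hrat (s) (hs : s ∈ ball (0 : ℂ) r) : HasDerivAt (fun s => φ s / sqrtFlow s z) 0 s := by
    have := (hd s hs).fun_div (hasDerivAt_sqrtFlow hz0 (hsmall s hs)) (sqrtFlow_ne_zero hz0)
    refine this.congr_deriv ?_
    have h1 := hφ0 s hs
    have h2 := sqrtFlow_ne_zero (t := s) hz0
    field_simp
    rw [hsq' s hs]; ring
  have := isOpen_ball.is_const_of_deriv_eq_zero (convex_ball (0 : ℂ) r).isPreconnected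
    (fun s hs => (hrat s hs).differentiableAt.differentiableWithinAt)
    (fun s hs => (hrat s hs).deriv) (x := t) (y := 0) (by simpa using ht) hb0
  rw [h0, sqrtFlow_zero, div_self hz0] at this
  exact (div_eq_one_iff_eq (sqrtFlow_ne_zero hz0)).1 this

lemma exists_pos_le_norm {K : Set ℂ} (hK : IsCompact K) (h0 : 0 ∉ K) :
    ∃ ρ : ℝ, 0 < ρ ∧ ∀ z ∈ K, ρ ≤ ‖z‖ := by
  obtain ⟨ρ, hρ, h⟩ := Metric.mem_nhds_iff.1 (hK.isClosed.isOpen_compl.mem_nhds h0)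
  refine ⟨ρ, hρ, fun z hz => ?_⟩
  by_contra hlt
  exact h (mem_ball_zero_iff.2 (not_le.1 hlt)) hz

lemma hasUniqueFlow_vecField_neg_two : HasUniqueFlow (vecField (-2)) := by
  intro K hK hK0 φ φ' ⟨U, _, hKU, ε, hε, h⟩ ⟨U', _, hKU', ε', hε', h'⟩
  obtain ⟨ρ, hρ, hρK⟩ := exists_pos_le_norm hK hK0
  filter_upwards [ball_mem_nhds (0 : ℂ) (lt_min (lt_min hε hε') (by positivity : 0 < ρ ^ 2 / 2))]
    with t ht z hz
  have ht' : ‖t‖ < min (min ε ε') (ρ ^ 2 / 2) := by simpa using ht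
  simp only [vecField_neg_two] at h h'
  rw [eq_sqrtFlow hρ (hρK z hz) (min_le_right _ _) (h z (hKU hz)).1 (fun s hs => (h z (hKU hz)).2 s
      (hs.trans_le ((min_le_left _ _).trans (min_le_left _ _)))) ht',
    eq_sqrtFlow hρ (hρK z hz) (min_le_right _ _) (h' z (hKU' hz)).1 (fun s hs => (h' z (hKU' hz)).2 s
      (hs.trans_le ((min_le_left _ _).trans (min_le_right _ _)))) ht']

end SLELoop

namespace SLELoop

open Metric

/-! ### Cauchy transforms along circles -/

/-- The Cauchy transform of the density `c` along the image of the circle of radius `R` by `γ`. -/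
noncomputable def cauchyT (R : ℝ) (γ c : ℂ → ℂ) (ω : ℂ) : ℂ :=
  (2 * Real.pi * Complex.I : ℂ)⁻¹ • ∮ u in C(0, R), c u / (γ u - ω)

section CauchyT

variable {R : ℝ} {γ c : ℂ → ℂ}

/-- Differentiation under the integral sign: within half the distance from `ω` to the curve, the
denominators are bounded below uniformly. -/
lemma differentiableAt_cauchyT (hR : 0 ≤ R) (hγ : ContinuousOn γ (sphere 0 R))
    (hc : ContinuousOn c (sphere 0 R)) {ω : ℂ} (hω : ∀ u ∈ sphere (0 : ℂ) R, γ u ≠ ω) :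
    DifferentiableAt ℂ (cauchyT R γ c) ω := by
  obtain ⟨d, hd, hdist⟩ : ∃ d : ℝ, 0 < d ∧ ∀ u ∈ sphere (0 : ℂ) R, d ≤ ‖γ u - ω‖ := by
    have hK := (isCompact_sphere (0 : ℂ) R).image_of_continuousOn hγ
    have hω' : ω ∉ γ '' sphere 0 R := by rintro ⟨u, hu, h⟩; exact hω u hu h
    obtain ⟨d, hd, h⟩ := Metric.mem_nhds_iff.1 (hK.isClosed.isOpen_compl.mem_nhds hω')
    refine ⟨d, hd, fun u hu => ?_⟩
    by_contra hlt
    exact h (by rw [mem_ball, dist_eq_norm]; exact not_le.1 hlt) ⟨u, hu, rfl⟩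
  obtain ⟨m, hm⟩ := (isCompact_sphere (0 : ℂ) R).exists_bound_of_continuousOn hc
  have hmap (θ : ℝ) : circleMap 0 R θ ∈ sphere (0 : ℂ) R := circleMap_mem_sphere _ hR θ
  have hball (ω' : ℂ) (h : ω' ∈ ball ω (d / 2)) (u : ℂ) (hu : u ∈ sphere (0 : ℂ) R) :
      d / 2 ≤ ‖γ u - ω'‖ := by
    have h1 := hdist u hu
    have h2 : ‖ω' - ω‖ < d / 2 := by rwa [mem_ball, dist_eq_norm] at h
    have h3 : ‖γ u - ω‖ ≤ ‖γ u - ω'‖ + ‖ω' - ω‖ := by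
      simpa using norm_add_le (γ u - ω') (ω' - ω)
    linarith
  have hne (ω' : ℂ) (h : ω' ∈ ball ω (d / 2)) (u : ℂ) (hu : u ∈ sphere (0 : ℂ) R) :
      γ u - ω' ≠ 0 := norm_pos_iff.1 ((half_pos hd).trans_le (hball ω' h u hu))
  have hγc : Continuous fun θ => γ (circleMap 0 R θ) :=
    hγ.comp_continuous (continuous_circleMap 0 R) hmap
  have hcc : Continuous fun θ => c (circleMap 0 R θ) :=
    hc.comp_continuous (continuous_circleMap 0 R) hmap
  have hdc : Continuous fun θ => deriv (circleMap 0 R) θ := by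
    simp only [deriv_circleMap]; fun_prop
  have hcont (ω' : ℂ) (h : ω' ∈ ball ω (d / 2)) : Continuous fun θ =>
      deriv (circleMap 0 R) θ • (c (circleMap 0 R θ) / (γ (circleMap 0 R θ) - ω')) :=
    hdc.smul (hcc.div (hγc.sub continuous_const) fun θ => hne ω' h _ (hmap θ))
  have hω0 : ω ∈ ball ω (d / 2) := mem_ball_self (half_pos hd)
  have key := intervalIntegral.hasDerivAt_integral_of_dominated_loc_of_deriv_le
    (𝕜 := ℂ) (E := ℂ) (μ := MeasureTheory.volume) (a := 0) (b := 2 * Real.pi) (x₀ := ω) (s := ball ω (d / 2))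
    (F := fun ω' θ => deriv (circleMap 0 R) θ • (c (circleMap 0 R θ) / (γ (circleMap 0 R θ) - ω')))
    (F' := fun ω' θ => deriv (circleMap 0 R) θ •
      (c (circleMap 0 R θ) / (γ (circleMap 0 R θ) - ω') ^ 2))
    (bound := fun _ => R * (m / (d / 2) ^ 2))
    (isOpen_ball.mem_nhds hω0)
    (by filter_upwards [isOpen_ball.mem_nhds hω0] with ω' h using (hcont ω' h).aestronglyMeasurable)
    ((hcont ω hω0).intervalIntegrable _ _)
    (Continuous.aestronglyMeasurable (hdc.smul (hcc.div ((hγc.sub continuous_const).pow 2)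
      fun θ => pow_ne_zero 2 (hne ω hω0 _ (hmap θ)))))
    (Eventually.of_forall fun θ _ ω' h => ?_) (by simp)
    (Eventually.of_forall fun θ _ ω' h => ?_)
  · exact key.2.differentiableAt.const_smul (2 * Real.pi * Complex.I : ℂ)⁻¹
  · rw [norm_smul, norm_div, norm_pow]
    have h1 : ‖deriv (circleMap 0 R) θ‖ ≤ R := by simp [abs_of_nonneg hR]
    have h2 := hball ω' h _ (hmap θ)
    have h3 := hm _ (hmap θ)
    have h4 : 0 ≤ m := (norm_nonneg _).trans h3
    gcongr
  · have h1 : HasDerivAt (fun ω' => γ (circleMap 0 R θ) - ω') (-1) ω' :=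
      (hasDerivAt_id' ω').const_sub _
    have h2 := ((h1.fun_inv (hne ω' h _ (hmap θ))).const_mul (c (circleMap 0 R θ))).const_smul
      (deriv (circleMap 0 R) θ)
    simp only [div_eq_mul_inv]
    refine h2.congr_deriv ?_
    simp

lemma norm_cauchyT_le (hR : 0 ≤ R) {m d : ℝ} (hd : 0 < d) {ω : ℂ}
    (hc : ∀ u ∈ sphere (0 : ℂ) R, ‖c u‖ ≤ m)
    (hω : ∀ u ∈ sphere (0 : ℂ) R, d ≤ ‖γ u - ω‖) : ‖cauchyT R γ c ω‖ ≤ R * (m / d) := by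
  refine circleIntegral.norm_two_pi_i_inv_smul_integral_le_of_norm_le_const hR fun u hu => ?_
  rw [norm_div]
  have h1 := hc u hu
  have h2 := hω u hu
  have h3 : 0 ≤ m := (norm_nonneg _).trans h1
  gcongr

lemma circleIntegral_eq_of_differentiableOn_annulus {f : ℂ → ℂ} {a b r R : ℝ} (hr : 0 < r)
    (har : a < r) (hrR : r ≤ R) (hRb : R < b)
    (hf : DifferentiableOn ℂ f {u | a < ‖u‖ ∧ ‖u‖ < b}) :
    (∮ u in C(0, R), f u) = ∮ u in C(0, r), f u := by
  have ho : IsOpen {u : ℂ | a < ‖u‖ ∧ ‖u‖ < b} :=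
    (isOpen_lt continuous_const continuous_norm).inter (isOpen_lt continuous_norm continuous_const)
  refine Complex.circleIntegral_eq_of_differentiable_on_annulus_off_countable hr hrR
    Set.countable_empty (hf.continuousOn.mono fun u hu => ?_) fun u hu => ?_
  · simp only [Set.mem_sdiff, mem_closedBall_zero_iff, mem_ball_zero_iff, not_lt] at hu
    exact ⟨har.trans_le hu.2, hu.1.trans_lt hRb⟩
  · simp only [Set.mem_sdiff, mem_closedBall_zero_iff, mem_ball_zero_iff, not_le] at hu
    exact hf.differentiableAt (ho.mem_nhds ⟨har.trans hu.1.2, hu.1.1.trans hRb⟩)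

/-- Cauchy's formula in an annulus. -/
lemma cauchyT_sub_cauchyT {f : ℂ → ℂ} {a b r R : ℝ} (hr : 0 < r) (har : a < r) (hRb : R < b)
    (hf : DifferentiableOn ℂ f {u | a < ‖u‖ ∧ ‖u‖ < b}) {w : ℂ} (h1 : r < ‖w‖) (h2 : ‖w‖ < R) :
    cauchyT R (fun u => u) f w - cauchyT r (fun u => u) f w = f w := by
  have ho : IsOpen {u : ℂ | a < ‖u‖ ∧ ‖u‖ < b} :=
    (isOpen_lt continuous_const continuous_norm).inter (isOpen_lt continuous_norm continuous_const)
  have hw : {u : ℂ | a < ‖u‖ ∧ ‖u‖ < b} ∈ 𝓝 w := ho.mem_nhds ⟨har.trans h1, h2.trans hRb⟩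
  have hR : 0 < R := hr.trans (h1.trans h2)
  -- The difference quotient of `f` at `w` is holomorphic across `w`, so its integrals over the two
  -- circles coincide; splitting each of them leaves the Cauchy integrals of `f` and the winding
  -- numbers `1` and `0`.
  have hd := circleIntegral_eq_of_differentiableOn_annulus hr har (h1.trans h2).le hRb
    ((Complex.differentiableOn_dslope hw).2 hf)
  have key (ρ : ℝ) (hρ : 0 < ρ) (hρw : ρ ≠ ‖w‖) (hρa : a < ρ) (hρb : ρ < b) :
      (∮ u in C(0, ρ), dslope f w u)
        = (∮ u in C(0, ρ), f u / (u - w)) - f w * ∮ u in C(0, ρ), (u - w)⁻¹ := by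
    have hne (u : ℂ) (hu : u ∈ sphere (0 : ℂ) ρ) : u - w ≠ 0 := by
      intro h
      rw [sub_eq_zero.1 h, mem_sphere_zero_iff_norm] at hu
      exact hρw hu.symm
    have hinv : ContinuousOn (fun u => (u - w)⁻¹) (sphere (0 : ℂ) ρ) :=
      (continuousOn_id.sub continuousOn_const).inv₀ hne
    have hfc : ContinuousOn f (sphere (0 : ℂ) ρ) := hf.continuousOn.mono fun u hu => by
      rw [mem_sphere_zero_iff_norm] at hu
      exact ⟨hu ▸ hρa, hu ▸ hρb⟩
    rw [← circleIntegral.integral_const_mul, ← circleIntegral.integral_sub]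
    · refine circleIntegral.integral_congr hρ.le fun u hu => ?_
      have h := hne u hu
      rw [dslope_of_ne _ (sub_ne_zero.1 h), slope_def_field]
      field_simp
    · simp only [div_eq_mul_inv]
      exact (hfc.mul hinv).circleIntegrable hρ.le
    · exact (continuousOn_const.mul hinv).circleIntegrable hρ.le
  rw [key R hR h2.ne' (har.trans (h1.trans h2)) hRb, key r hr h1.ne har (h1.trans (h2.trans hRb)),
    circleIntegral.integral_sub_inv_of_mem_ball (by simpa using h2)] at hd
  have h0 : (∮ u in C(0, r), (u - w)⁻¹) = 0 := by
    refine Complex.circleIntegral_eq_zero_of_differentiable_on_off_countable hr.le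
      Set.countable_empty ?_ ?_
    · refine (continuousOn_id.sub continuousOn_const).inv₀ fun u hu h => ?_
      have h : u = w := sub_eq_zero.1 h
      rw [h, mem_closedBall_zero_iff] at hu
      linarith
    · rintro u ⟨hu, -⟩
      refine (differentiableAt_id.sub_const w).inv fun h => ?_
      have h : u = w := sub_eq_zero.1 h
      rw [h, mem_ball_zero_iff] at hu
      linarith
  rw [h0] at hd
  have hpi : (2 * Real.pi * Complex.I : ℂ) ≠ 0 := Complex.two_pi_I_ne_zero
  simp only [cauchyT, smul_eq_mul]
  rw [← mul_sub, inv_mul_eq_iff_eq_mul₀ hpi]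
  linear_combination hd

end CauchyT

end SLELoop

namespace SLELoop

open Metric

/-- The open annulus `a < |u| < b`. -/
def annulus (a b : ℝ) : Set ℂ := {u | a < ‖u‖ ∧ ‖u‖ < b}

lemma isOpen_annulus (a b : ℝ) : IsOpen (annulus a b) :=
  (isOpen_lt continuous_const continuous_norm).inter (isOpen_lt continuous_norm continuous_const)

/-! ### Almost identical gluing maps -/

/-- `ψ` is holomorphic and `ε`-close to the identity in a fixed annulus. -/
structure NearId (ε : ℝ) (ψ : ℂ → ℂ) : Prop where
  diff : DifferentiableOn ℂ ψ (annulus (1 / 8) (7 / 8))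
  close : ∀ w ∈ annulus (1 / 8) (7 / 8), ‖ψ w - w‖ ≤ ε

namespace NearId

variable {ε : ℝ} {ψ : ℂ → ℂ}

lemma nonneg (h : NearId ε ψ) : 0 ≤ ε :=
  (norm_nonneg _).trans (h.close (1 / 2) ⟨by norm_num, by norm_num⟩)

lemma mem_of_norm_sub_lt {u s : ℂ} (h1 : 1 / 4 ≤ ‖u‖) (h2 : ‖u‖ ≤ 3 / 4) (hs : ‖s - u‖ < 1 / 8) :
    s ∈ annulus (1 / 8) (7 / 8) := by
  have h3 : ‖u‖ ≤ ‖s‖ + ‖s - u‖ := by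
    have := norm_sub_le s (s - u); simpa using this
  have h4 : ‖s‖ ≤ ‖u‖ + ‖s - u‖ := by
    have := norm_add_le u (s - u); simpa using this
  exact ⟨by linarith, by linarith⟩

lemma norm_deriv_sub_one_le' (h : NearId ε ψ) {u s : ℂ} (h1 : 1 / 4 ≤ ‖u‖) (h2 : ‖u‖ ≤ 3 / 4)
    (hs : ‖s - u‖ < 1 / 16) : ‖deriv (fun w => ψ w - w) s‖ ≤ 16 * ε := by
  have hsub : closedBall s (1 / 16) ⊆ annulus (1 / 8) (7 / 8) := fun x hx => by
    refine mem_of_norm_sub_lt h1 h2 ?_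
    rw [mem_closedBall, dist_eq_norm] at hx
    have := norm_add_le (x - s) (s - u)
    rw [sub_add_sub_cancel] at this
    linarith
  have hd : DifferentiableOn ℂ (fun w => ψ w - w) (annulus (1 / 8) (7 / 8)) :=
    h.diff.sub differentiableOn_id
  have hdc : DiffContOnCl ℂ (fun w => ψ w - w) (ball s (1 / 16)) :=
    (hd.mono (closure_ball_subset_closedBall.trans hsub)).diffContOnCl
  have := Complex.norm_deriv_le_of_forall_mem_sphere_norm_le (by norm_num) hdc
    (fun z hz => h.close z (hsub (sphere_subset_closedBall hz)))
  calc _ ≤ ε / (1 / 16) := this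
    _ = 16 * ε := by ring

lemma norm_deriv_sub_one_le (h : NearId ε ψ) {u : ℂ} (h1 : 1 / 4 ≤ ‖u‖) (h2 : ‖u‖ ≤ 3 / 4) :
    ‖deriv ψ u - 1‖ ≤ 16 * ε := by
  have := h.norm_deriv_sub_one_le' h1 h2 (s := u) (by simp)
  have hu : u ∈ annulus (1 / 8) (7 / 8) := mem_of_norm_sub_lt h1 h2 (by simp)
  rwa [deriv_fun_sub (h.diff.differentiableAt ((isOpen_annulus _ _).mem_nhds hu))
    differentiableAt_fun_id, deriv_id''] at this

lemma norm_sub_sub_le (h : NearId ε ψ) {u s : ℂ} (h1 : 1 / 4 ≤ ‖u‖) (h2 : ‖u‖ ≤ 3 / 4)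
    (hs : ‖s - u‖ < 1 / 16) : ‖(ψ s - s) - (ψ u - u)‖ ≤ 16 * ε * ‖s - u‖ := by
  refine (convex_ball u (1 / 16)).norm_image_sub_le_of_norm_deriv_le (𝕜 := ℂ)
    (f := fun w => ψ w - w) (fun x hx => ?_) (fun x hx => ?_) (by simp)
    (by rwa [mem_ball, dist_eq_norm])
  · rw [mem_ball, dist_eq_norm] at hx
    exact (h.diff.differentiableAt ((isOpen_annulus _ _).mem_nhds
      (mem_of_norm_sub_lt h1 h2 (by linarith)))).sub differentiableAt_id
  · rw [mem_ball, dist_eq_norm] at hx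
    exact h.norm_deriv_sub_one_le' h1 h2 hx

/-- Equal images force `‖s - u‖ ≤ 2ε`, so both points lie in one small disc, where `ψ - id` is
Lipschitz with constant `16ε < 1`. Only `u` needs to lie in the middle annulus. -/
lemma eq_of_map_eq (h : NearId ε ψ) (hε : ε < 1 / 64) {u s : ℂ} (h1 : 1 / 4 ≤ ‖u‖)
    (h2 : ‖u‖ ≤ 3 / 4) (hs : s ∈ annulus (1 / 8) (7 / 8)) (he : ψ s = ψ u) : s = u := by
  have hu : u ∈ annulus (1 / 8) (7 / 8) := mem_of_norm_sub_lt h1 h2 (by simp)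
  have h3 : ‖s - u‖ ≤ 2 * ε := by
    have e : s - u = (ψ u - u) - (ψ s - s) := by rw [he]; ring
    rw [e]
    linarith [norm_sub_le (ψ u - u) (ψ s - s), h.close u hu, h.close s hs]
  have h4 := h.norm_sub_sub_le h1 h2 (s := s) (by linarith)
  have e : (ψ s - s) - (ψ u - u) = -(s - u) := by rw [he]; ring
  rw [e, norm_neg] at h4
  have h5 : ‖s - u‖ = 0 := by nlinarith [norm_nonneg (s - u), h.nonneg]
  exact sub_eq_zero.1 (norm_eq_zero.1 h5)

lemma deriv_ne_zero (h : NearId ε ψ) (hε : ε < 1 / 64) {u : ℂ} (h1 : 1 / 4 ≤ ‖u‖)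
    (h2 : ‖u‖ ≤ 3 / 4) : deriv ψ u ≠ 0 := by
  intro h0
  have := h.norm_deriv_sub_one_le h1 h2
  rw [h0] at this
  norm_num at this
  linarith

lemma sub_le_norm_sub (h : NearId ε ψ) {u s : ℂ} (hu : u ∈ annulus (1 / 8) (7 / 8))
    (hs : s ∈ annulus (1 / 8) (7 / 8)) : ‖u - s‖ - 2 * ε ≤ ‖ψ u - ψ s‖ := by
  have e : u - s = (ψ u - ψ s) - (ψ u - u) + (ψ s - s) := by ring
  have h1 := norm_add_le ((ψ u - ψ s) - (ψ u - u)) (ψ s - s)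
  have h2 := norm_sub_le (ψ u - ψ s) (ψ u - u)
  rw [← e] at h1
  linarith [h.close u hu, h.close s hs]

end NearId

/-! ### The approximate solution of the gluing problem -/

/-- `κ ↦ conj ∘ κ ∘ conj`. -/
noncomputable def conjFun (κ : ℂ → ℂ) (w : ℂ) : ℂ := (starRingEnd ℂ) (κ ((starRingEnd ℂ) w))

lemma DifferentiableAt.conjFun {κ : ℂ → ℂ} {w : ℂ}
    (h : DifferentiableAt ℂ κ ((starRingEnd ℂ) w)) : DifferentiableAt ℂ (conjFun κ) w := by
  have := h.conj_conj
  rwa [Complex.conj_conj] at this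

/-- The principal part of `M`, in the coordinate `1 / w`. -/
noncomputable def principalPart (M : ℂ → ℂ) (x : ℂ) : ℂ :=
  x * cauchyT (1 / 4) (fun u => u⁻¹) (fun u => M u / u) x

/-- The holomorphic part of `M`, transported by `ψ`, together with the reflection of the principal
part. -/
noncomputable def innerPart (ψ M : ℂ → ℂ) (ω : ℂ) : ℂ :=
  cauchyT (3 / 4) ψ (fun u => M u * deriv ψ u) ω + conjFun (principalPart M) ω

/-- The defect between the Cauchy transforms of `M` in the coordinates `ψ` and `id`. -/
noncomputable def kernelDefect (ψ M : ℂ → ℂ) (R : ℝ) (s : ℂ) : ℂ :=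
  cauchyT R ψ (fun u => M u * deriv ψ u) (ψ s) - cauchyT R (fun u => u) M s

/-- The error of the approximate solution of the gluing problem. -/
noncomputable def gluingError (ψ M : ℂ → ℂ) (s : ℂ) : ℂ :=
  (if ‖s‖ < 1 / 2 then kernelDefect ψ M (3 / 4) s else kernelDefect ψ M (1 / 4) s)
    + (conjFun (principalPart M) (ψ s) - conjFun (principalPart M) s)

section Gluing

variable {M ψ : ℂ → ℂ} {m ε : ℝ}

lemma sphere_subset_annulus {R : ℝ} (h1 : 1 / 4 ≤ R) (h2 : R ≤ 3 / 4) :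
    sphere (0 : ℂ) R ⊆ annulus (1 / 8) (7 / 8) := fun u hu => by
  rw [mem_sphere_zero_iff_norm] at hu
  exact ⟨by linarith, by linarith⟩

lemma differentiableAt_principalPart (hM : DifferentiableOn ℂ M (annulus (1 / 8) (7 / 8)))
    {x : ℂ} (hx : ‖x‖ < 4) : DifferentiableAt ℂ (principalPart M) x := by
  have h0 : ∀ u ∈ sphere (0 : ℂ) (1 / 4), u ≠ 0 := fun u hu h => by
    rw [h, mem_sphere_zero_iff_norm] at hu; norm_num at hu
  have hs := sphere_subset_annulus (R := 1 / 4) le_rfl (by norm_num)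
  refine differentiableAt_id.mul (differentiableAt_cauchyT (by norm_num)
    (continuousOn_id.inv₀ h0) ((hM.continuousOn.mono hs).div continuousOn_id h0) fun u hu h => ?_)
  have h : u⁻¹ = x := h
  rw [← h, norm_inv, mem_sphere_zero_iff_norm.1 hu] at hx
  norm_num at hx

/-- The radius `16/5` is the inverse of `5/16`: it leaves the distance `4/5` to the circle of radius
`4` carrying the points `1/u`, and corresponds to `|s| ≥ 5/16` in the variable `s = 1/x`. -/
lemma principalPart_bound (hm : ∀ u ∈ annulus (1 / 8) (7 / 8), ‖M u‖ ≤ m)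
    {x : ℂ} (hx : ‖x‖ ≤ 16 / 5) : ‖principalPart M x‖ ≤ 4 * m := by
  have hs := sphere_subset_annulus (R := 1 / 4) le_rfl (by norm_num)
  have hm0 : 0 ≤ m := (norm_nonneg _).trans (hm (1 / 2) ⟨by norm_num, by norm_num⟩)
  rw [principalPart, norm_mul]
  have := norm_cauchyT_le (R := 1 / 4) (γ := fun u => u⁻¹) (c := fun u => M u / u) (by norm_num)
    (m := 4 * m) (d := 4 / 5) (ω := x) (by norm_num) (fun u hu => ?_) (fun u hu => ?_)
  · calc ‖x‖ * _ ≤ 16 / 5 * (1 / 4 * (4 * m / (4 / 5))) := by gcongr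
      _ = 4 * m := by ring
  · rw [norm_div, mem_sphere_zero_iff_norm.1 hu]
    linarith [hm u (hs hu)]
  · have h1 : ‖(u⁻¹ : ℂ)‖ = 4 := by rw [norm_inv, mem_sphere_zero_iff_norm.1 hu]; norm_num
    linarith [norm_sub_norm_le (u⁻¹) x]

/-- Divide numerator and denominator of the Cauchy kernel by `-u s`. For `|s| > 1/4` the right-hand
side is the part of the Laurent series of `M` with negative powers. -/
lemma principalPart_inv {s : ℂ} (hs : s ≠ 0) :
    principalPart M s⁻¹ = -cauchyT (1 / 4) (fun u => u) M s := by
  simp only [principalPart, cauchyT, smul_eq_mul]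
  have key : (∮ u in C(0, 1 / 4), M u / (u - s))
      = ∮ u in C(0, 1 / 4), -s⁻¹ * (M u / u / (u⁻¹ - s⁻¹)) := by
    refine circleIntegral.integral_congr (by norm_num) fun u hu => ?_
    have hu0 : u ≠ 0 := fun h => by
      rw [h, mem_sphere_zero_iff_norm] at hu; norm_num at hu
    -- At `u = s` both integrands are quotients by zero, hence `0`, so no condition on `|s|` is
    -- needed.
    by_cases h : u = s
    · simp [h]
    · have h1 : u - s ≠ 0 := sub_ne_zero.2 h
      have h2 : s - u ≠ 0 := sub_ne_zero.2 (Ne.symm h)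
      have h3 : u⁻¹ - s⁻¹ = (s - u) / (u * s) := by field_simp
      simp only [h3]
      field_simp
      ring
  rw [key, circleIntegral.integral_const_mul]
  ring

lemma conjFun_bound {κ : ℂ → ℂ} {r b : ℝ} (h : ∀ x, ‖x‖ ≤ r → ‖κ x‖ ≤ b) {x : ℂ} (hx : ‖x‖ ≤ r) :
    ‖conjFun κ x‖ ≤ b := by
  rw [conjFun, RCLike.norm_conj]
  exact h _ (by rwa [RCLike.norm_conj])

lemma differentiableAt_conjFun_principalPart
    (hM : DifferentiableOn ℂ M (annulus (1 / 8) (7 / 8))) {x : ℂ} (hx : ‖x‖ < 4) :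
    DifferentiableAt ℂ (conjFun (principalPart M)) x :=
  DifferentiableAt.conjFun (differentiableAt_principalPart hM (by rwa [RCLike.norm_conj]))

lemma norm_conjFun_principalPart_sub_le (hM : DifferentiableOn ℂ M (annulus (1 / 8) (7 / 8)))
    (hm : ∀ u ∈ annulus (1 / 8) (7 / 8), ‖M u‖ ≤ m) {x y : ℂ} (hx : ‖x‖ < 2) (hy : ‖y‖ < 2) :
    ‖conjFun (principalPart M) x - conjFun (principalPart M) y‖ ≤ 4 * m * ‖x - y‖ := by
  refine (convex_ball (0 : ℂ) 2).norm_image_sub_le_of_norm_deriv_le (𝕜 := ℂ)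
    (fun z hz => differentiableAt_conjFun_principalPart hM ?_) (fun z hz => ?_)
    (by simpa using hy) (by simpa using hx)
  · rw [mem_ball_zero_iff] at hz; linarith
  · rw [mem_ball_zero_iff] at hz
    have hb (w : ℂ) (hw : w ∈ closedBall z 1) : ‖w‖ < 3 := by
      rw [mem_closedBall, dist_eq_norm] at hw
      have := norm_add_le (w - z) z
      rw [sub_add_cancel] at this
      linarith
    have hdc : DiffContOnCl ℂ (conjFun (principalPart M)) (ball z 1) := by
      refine DifferentiableOn.diffContOnCl fun w hw => ?_
      have := hb w (closure_ball_subset_closedBall hw)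
      exact (differentiableAt_conjFun_principalPart hM (by linarith)).differentiableWithinAt
    have := Complex.norm_deriv_le_of_forall_mem_sphere_norm_le one_pos hdc (C := 4 * m)
      (fun w hw => conjFun_bound (r := 16 / 5) (fun x hx => principalPart_bound hm hx)
        (by linarith [hb w (sphere_subset_closedBall hw)]))
    simpa using this

lemma continuousOn_mul_deriv (hψ : NearId ε ψ)
    (hM : DifferentiableOn ℂ M (annulus (1 / 8) (7 / 8))) :
    ContinuousOn (fun u => M u * deriv ψ u) (annulus (1 / 8) (7 / 8)) :=
  hM.continuousOn.mul (hψ.diff.deriv (isOpen_annulus _ _)).continuousOn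

lemma differentiableAt_kernelDefect (hψ : NearId ε ψ) (hε : ε < 1 / 64)
    (hM : DifferentiableOn ℂ M (annulus (1 / 8) (7 / 8))) {R : ℝ} (h1 : 1 / 4 ≤ R) (h2 : R ≤ 3 / 4)
    {s : ℂ} (hs : s ∈ annulus (1 / 8) (7 / 8)) (hsR : ‖s‖ ≠ R) :
    DifferentiableAt ℂ (kernelDefect ψ M R) s := by
  have hsub := sphere_subset_annulus h1 h2
  have hR : 0 ≤ R := by linarith
  refine DifferentiableAt.fun_sub (f := fun s => cauchyT R ψ (fun u => M u * deriv ψ u) (ψ s)) ?_ ?_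
  · refine DifferentiableAt.fun_comp' s ?_ (hψ.diff.differentiableAt ((isOpen_annulus _ _).mem_nhds hs))
    refine differentiableAt_cauchyT hR (hψ.diff.continuousOn.mono hsub)
      ((continuousOn_mul_deriv hψ hM).mono hsub) fun u hu he => hsR ?_
    rw [mem_sphere_zero_iff_norm] at hu
    rw [hψ.eq_of_map_eq hε (by linarith) (by linarith) hs he.symm, hu]
  · refine differentiableAt_cauchyT hR continuousOn_id (hM.continuousOn.mono hsub) fun u hu he => hsR ?_
    rw [← he]; exact mem_sphere_zero_iff_norm.1 hu

lemma kernelDefect_eq_integral (hψ : NearId ε ψ) (hε : ε < 1 / 64)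
    (hM : DifferentiableOn ℂ M (annulus (1 / 8) (7 / 8))) {R : ℝ} (h1 : 1 / 4 ≤ R) (h2 : R ≤ 3 / 4)
    {s : ℂ} (hs : s ∈ annulus (1 / 8) (7 / 8)) (hsR : ‖s‖ ≠ R) :
    kernelDefect ψ M R s = (2 * Real.pi * Complex.I : ℂ)⁻¹ •
      ∮ u in C(0, R), M u * (deriv ψ u / (ψ u - ψ s) - 1 / (u - s)) := by
  have hsub := sphere_subset_annulus h1 h2
  have hR : 0 ≤ R := by linarith
  have hne (u : ℂ) (hu : u ∈ sphere (0 : ℂ) R) : ψ u - ψ s ≠ 0 := fun he => hsR <| by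
    rw [mem_sphere_zero_iff_norm] at hu
    rw [hψ.eq_of_map_eq hε (by linarith) (by linarith) hs (sub_eq_zero.1 he).symm, hu]
  have hne' (u : ℂ) (hu : u ∈ sphere (0 : ℂ) R) : u - s ≠ 0 := fun he => hsR <| by
    rw [← sub_eq_zero.1 he]; exact mem_sphere_zero_iff_norm.1 hu
  rw [kernelDefect, cauchyT, cauchyT, ← smul_sub, ← circleIntegral.integral_sub]
  · congr 1
    refine circleIntegral.integral_congr hR fun u hu => ?_
    simp only [mul_sub, mul_div_assoc, mul_one_div]
  · exact (((continuousOn_mul_deriv hψ hM).mono hsub).div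
      ((hψ.diff.continuousOn.mono hsub).sub continuousOn_const) hne).circleIntegrable hR
  · exact ((hM.continuousOn.mono hsub).div (continuousOn_id.sub continuousOn_const)
      hne').circleIntegrable hR

/-- The difference of kernels `ψ'(u)/(ψ u - ψ s) - 1/(u - s)` is the logarithmic derivative in `u`
of the difference quotient `D` of `ψ` at `s`. As `D` is holomorphic without zeros, the pole at `u =
s` cancels and the contour can be moved across `s`. The two branches in `gluingError` therefore
continue each other, and a contour at distance at least `1/4` from `|s|` is always available. -/
lemma kernelDefect_eq (hψ : NearId ε ψ) (hε : ε < 1 / 64)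
    (hM : DifferentiableOn ℂ M (annulus (1 / 8) (7 / 8)))
    {s : ℂ} (h1 : 1 / 4 < ‖s‖) (h2 : ‖s‖ < 3 / 4) :
    kernelDefect ψ M (3 / 4) s = kernelDefect ψ M (1 / 4) s := by
  have hs : s ∈ annulus (1 / 8) (7 / 8) := ⟨by linarith, by linarith⟩
  have hn := (isOpen_annulus (1 / 8) (7 / 8)).mem_nhds hs
  set D := dslope ψ s
  have hD : DifferentiableOn ℂ D (annulus (1 / 8) (7 / 8)) :=
    (Complex.differentiableOn_dslope hn).2 hψ.diff
  have hD0 (u : ℂ) (hu : u ∈ annulus (1 / 8) (7 / 8)) : D u ≠ 0 := by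
    by_cases h : u = s
    · rw [h]; simp only [D, dslope_same]
      exact hψ.deriv_ne_zero hε h1.le h2.le
    · simp only [D]
      rw [dslope_of_ne _ h, slope_def_field]
      exact div_ne_zero (fun he => h (hψ.eq_of_map_eq hε h1.le h2.le hu (sub_eq_zero.1 he)))
        (sub_ne_zero.2 h)
  have key : DifferentiableOn ℂ (fun u => M u * (deriv D u / D u)) (annulus (1 / 8) (7 / 8)) :=
    hM.mul ((hD.deriv (isOpen_annulus _ _)).div hD hD0)
  have heq (R : ℝ) (hR1 : 1 / 4 ≤ R) (hR2 : R ≤ 3 / 4) (hsR : ‖s‖ ≠ R) :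
      (∮ u in C(0, R), M u * (deriv ψ u / (ψ u - ψ s) - 1 / (u - s)))
        = ∮ u in C(0, R), M u * (deriv D u / D u) := by
    refine circleIntegral.integral_congr (by linarith) fun u hu => ?_
    have hus : u ≠ s := fun h => hsR (by rw [← h]; exact mem_sphere_zero_iff_norm.1 hu)
    have huA := sphere_subset_annulus hR1 hR2 hu
    have hψu := hψ.diff.differentiableAt ((isOpen_annulus _ _).mem_nhds huA)
    have hderD : deriv D u = (deriv ψ u * (u - s) - (ψ u - ψ s)) / (u - s) ^ 2 := by
      have : D =ᶠ[𝓝 u] fun w => (ψ w - ψ s) / (w - s) := by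
        filter_upwards [isOpen_ne.mem_nhds hus] with w hw
        simp only [D]
        rw [dslope_of_ne _ hw, slope_def_field]
      rw [this.deriv_eq]
      have h := (hψu.hasDerivAt.sub_const (ψ s)).fun_div ((hasDerivAt_id' u).sub_const s)
        (sub_ne_zero.2 hus)
      rw [h.deriv]; ring
    have hDu : D u = (ψ u - ψ s) / (u - s) := by
      simp only [D]; rw [dslope_of_ne _ hus, slope_def_field]
    have h3 : ψ u - ψ s ≠ 0 := fun he => hus (hψ.eq_of_map_eq hε h1.le h2.le huA (sub_eq_zero.1 he))
    have h4 := sub_ne_zero.2 hus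
    simp only [hderD, hDu]
    field_simp
  rw [kernelDefect_eq_integral hψ hε hM (by norm_num) le_rfl hs h2.ne,
    kernelDefect_eq_integral hψ hε hM le_rfl (by norm_num) hs h1.ne',
    heq _ (by norm_num) le_rfl h2.ne, heq _ le_rfl (by norm_num) h1.ne',
    circleIntegral_eq_of_differentiableOn_annulus (r := 1 / 4) (by norm_num) (by norm_num)
      (by norm_num) (by norm_num) key]

/-- Over a common denominator the kernel has numerator `(ψ'(u) - 1)(u - s) - ((ψ u - u) - (ψ s -
s))`, bounded by `34ε`, and denominator at least `1/8 · 1/4`; hence `34 · 32 = 1088`. -/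
lemma norm_kernelDefect_le (hψ : NearId ε ψ) (hε : ε < 1 / 64)
    (hM : DifferentiableOn ℂ M (annulus (1 / 8) (7 / 8)))
    (hm : ∀ u ∈ annulus (1 / 8) (7 / 8), ‖M u‖ ≤ m) {R : ℝ} (h1 : 1 / 4 ≤ R) (h2 : R ≤ 3 / 4)
    {s : ℂ} (hs : s ∈ annulus (1 / 8) (7 / 8)) (hsR : 1 / 4 ≤ |R - ‖s‖|) :
    ‖kernelDefect ψ M R s‖ ≤ 1088 * ε * m := by
  have hne : ‖s‖ ≠ R := by
    intro h; rw [h] at hsR; norm_num at hsR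
  have hε0 := hψ.nonneg
  have hm0 : 0 ≤ m := (norm_nonneg _).trans (hm (1 / 2) ⟨by norm_num, by norm_num⟩)
  have hsub := sphere_subset_annulus h1 h2
  rw [kernelDefect_eq_integral hψ hε hM h1 h2 hs hne]
  have := circleIntegral.norm_two_pi_i_inv_smul_integral_le_of_norm_le_const (c := (0 : ℂ)) (R := R)
    (f := fun u => M u * (deriv ψ u / (ψ u - ψ s) - 1 / (u - s))) (C := m * (1088 * ε))
    (by linarith) (fun u hu => ?_)
  · refine this.trans ?_
    have : 0 ≤ m * (1088 * ε) := by positivity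
    nlinarith
  · have huA := hsub hu
    have hun := mem_sphere_zero_iff_norm.1 hu
    have hd : 1 / 4 ≤ ‖u - s‖ := by
      have := abs_norm_sub_norm_le u s
      rw [hun] at this
      linarith
    have hd' : 1 / 8 ≤ ‖ψ u - ψ s‖ := by linarith [hψ.sub_le_norm_sub huA hs]
    have h3 : ψ u - ψ s ≠ 0 := norm_pos_iff.1 (by linarith)
    have h4 : u - s ≠ 0 := norm_pos_iff.1 (by linarith)
    have e : deriv ψ u / (ψ u - ψ s) - 1 / (u - s)
        = ((deriv ψ u - 1) * (u - s) - ((ψ u - u) - (ψ s - s))) / ((ψ u - ψ s) * (u - s)) := by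
      field_simp; ring
    have h5 : ‖u - s‖ ≤ 2 := by linarith [norm_sub_le u s, huA.2, hs.2]
    have h6 := hψ.norm_deriv_sub_one_le (u := u) (by linarith) (by linarith)
    have h7 : ‖(deriv ψ u - 1) * (u - s) - ((ψ u - u) - (ψ s - s))‖ ≤ 34 * ε := by
      refine (norm_sub_le _ _).trans ?_
      rw [norm_mul]
      have h8 : ‖deriv ψ u - 1‖ * ‖u - s‖ ≤ 16 * ε * 2 := by gcongr
      linarith [norm_sub_le (ψ u - u) (ψ s - s), hψ.close u huA, hψ.close s hs]
    rw [norm_mul]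
    refine mul_le_mul (hm u huA) ?_ (norm_nonneg _) hm0
    rw [e, norm_div, norm_mul]
    calc _ ≤ 34 * ε / (1 / 8 * (1 / 4)) := by gcongr
      _ = 1088 * ε := by ring

end Gluing

end SLELoop

/-! ### Exact solution of the gluing problem by iteration -/

namespace SLELoop

open Metric

section Gluing

variable {M ψ : ℂ → ℂ} {m ε : ℝ}

lemma gluingError_eq_of_lt (hψ : NearId ε ψ) (hε : ε < 1 / 64)
    (hM : DifferentiableOn ℂ M (annulus (1 / 8) (7 / 8))) {s : ℂ} (h2 : ‖s‖ < 3 / 4) :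
    gluingError ψ M s = kernelDefect ψ M (3 / 4) s
      + (conjFun (principalPart M) (ψ s) - conjFun (principalPart M) s) := by
  rw [gluingError]
  split_ifs with h
  · rfl
  · rw [kernelDefect_eq hψ hε hM (by linarith) h2]

lemma gluingError_eq_of_gt (hψ : NearId ε ψ) (hε : ε < 1 / 64)
    (hM : DifferentiableOn ℂ M (annulus (1 / 8) (7 / 8))) {s : ℂ} (h1 : 1 / 4 < ‖s‖) :
    gluingError ψ M s = kernelDefect ψ M (1 / 4) s
      + (conjFun (principalPart M) (ψ s) - conjFun (principalPart M) s) := by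
  rw [gluingError]
  split_ifs with h
  · rw [kernelDefect_eq hψ hε hM h1 (by linarith)]
  · rfl

lemma NearId.norm_le (hψ : NearId ε ψ) {s : ℂ} (hs : s ∈ annulus (1 / 8) (7 / 8)) :
    ‖ψ s‖ ≤ ‖s‖ + ε := by
  have := norm_add_le (ψ s - s) s
  rw [sub_add_cancel] at this
  linarith [hψ.close s hs]

lemma NearId.le_norm (hψ : NearId ε ψ) {s : ℂ} (hs : s ∈ annulus (1 / 8) (7 / 8)) :
    ‖s‖ - ε ≤ ‖ψ s‖ := by
  have := norm_sub_le (ψ s) (ψ s - s)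
  rw [sub_sub_cancel] at this
  linarith [hψ.close s hs]

/-- The error is holomorphic on the full annulus where `M` is, since near each point one of the two
contours is away from it. This absence of shrinking of the domain is what allows the iteration to be
repeated indefinitely. -/
lemma differentiableOn_gluingError (hψ : NearId ε ψ) (hε : ε < 1 / 64)
    (hM : DifferentiableOn ℂ M (annulus (1 / 8) (7 / 8))) :
    DifferentiableOn ℂ (gluingError ψ M) (annulus (1 / 8) (7 / 8)) := by
  intro s hs
  refine DifferentiableAt.differentiableWithinAt ?_
  have hψs := hψ.diff.differentiableAt ((isOpen_annulus _ _).mem_nhds hs)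
  have hc : DifferentiableAt ℂ
      (fun s => conjFun (principalPart M) (ψ s) - conjFun (principalPart M) s) s := by
    have h1 := hψ.norm_le hs
    have h2 := hs.2
    exact ((differentiableAt_conjFun_principalPart hM (by linarith)).fun_comp' s hψs).fun_sub
      (differentiableAt_conjFun_principalPart hM (by linarith))
  rcases lt_or_ge ‖s‖ (1 / 2) with h | h
  · refine ((differentiableAt_kernelDefect hψ hε hM (R := 3 / 4) (by norm_num) le_rfl hs
      (by linarith)).fun_add hc).congr_of_eventuallyEq ?_
    filter_upwards [(isOpen_lt continuous_norm continuous_const).mem_nhds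
      (show ‖s‖ < 3 / 4 by linarith)] with x hx
    exact gluingError_eq_of_lt hψ hε hM hx
  · refine ((differentiableAt_kernelDefect hψ hε hM (R := 1 / 4) le_rfl (by norm_num) hs
      (by linarith)).fun_add hc).congr_of_eventuallyEq ?_
    filter_upwards [(isOpen_lt continuous_const continuous_norm).mem_nhds
      (show 1 / 4 < ‖s‖ by linarith)] with x hx
    exact gluingError_eq_of_gt hψ hε hM hx

lemma norm_gluingError_le (hψ : NearId ε ψ) (hε : ε < 1 / 64)
    (hM : DifferentiableOn ℂ M (annulus (1 / 8) (7 / 8)))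
    (hm : ∀ u ∈ annulus (1 / 8) (7 / 8), ‖M u‖ ≤ m) {s : ℂ} (hs : s ∈ annulus (1 / 8) (7 / 8)) :
    ‖gluingError ψ M s‖ ≤ 1100 * ε * m := by
  have hm0 : 0 ≤ m := (norm_nonneg _).trans (hm s hs)
  have hε0 := hψ.nonneg
  have h1 := hψ.norm_le hs
  have h2 := hs.2
  have hc : ‖conjFun (principalPart M) (ψ s) - conjFun (principalPart M) s‖ ≤ 4 * m * ε :=
    (norm_conjFun_principalPart_sub_le hM hm (by linarith) (by linarith)).trans
      (mul_le_mul_of_nonneg_left (hψ.close s hs) (by positivity))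
  have hk : ‖(if ‖s‖ < 1 / 2 then kernelDefect ψ M (3 / 4) s else kernelDefect ψ M (1 / 4) s)‖
      ≤ 1088 * ε * m := by
    split_ifs with h
    · exact norm_kernelDefect_le hψ hε hM hm (by norm_num) le_rfl hs
        (by rw [abs_of_pos] <;> linarith)
    · exact norm_kernelDefect_le hψ hε hM hm le_rfl (by norm_num) hs
        (by rw [abs_of_nonpos] <;> linarith)
  refine (norm_add_le _ _).trans ?_
  nlinarith [mul_nonneg hε0 hm0]

/-- For `ψ = id` this is the Laurent decomposition of `M`: the reflected principal part, subtracted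
to keep the outer term imaginary on the unit circle, is added back to the inner term. In general the
error collects the change of Cauchy kernel and the displacement of the reflected part. -/
lemma innerPart_add_eq (hψ : NearId ε ψ) (hε : ε < 1 / 64)
    (hM : DifferentiableOn ℂ M (annulus (1 / 8) (7 / 8))) {s : ℂ} (h1 : 1 / 4 < ‖s‖)
    (h2 : ‖s‖ < 3 / 4) :
    innerPart ψ M (ψ s) + (principalPart M s⁻¹ - conjFun (principalPart M) s)
      = M s + gluingError ψ M s := by
  have h0 : s ≠ 0 := norm_pos_iff.1 (by linarith)
  rw [gluingError_eq_of_lt hψ hε hM h2, principalPart_inv h0, innerPart, kernelDefect]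
  have := cauchyT_sub_cauchyT (a := 1 / 8) (b := 7 / 8) (r := 1 / 4) (R := 3 / 4) (by norm_num)
    (by norm_num) (by norm_num) hM h1 h2
  linear_combination this

lemma differentiableAt_innerPart (hψ : NearId ε ψ) (hε : ε < 1 / 64)
    (hM : DifferentiableOn ℂ M (annulus (1 / 8) (7 / 8))) {ω : ℂ} (hω : ‖ω‖ < 5 / 8) :
    DifferentiableAt ℂ (innerPart ψ M) ω := by
  have hsub := sphere_subset_annulus (R := 3 / 4) (by norm_num) le_rfl
  refine DifferentiableAt.add (differentiableAt_cauchyT (by norm_num)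
    (hψ.diff.continuousOn.mono hsub) ((continuousOn_mul_deriv hψ hM).mono hsub) fun u hu he => ?_)
    (differentiableAt_conjFun_principalPart hM (by linarith))
  have := hψ.le_norm (hsub hu)
  rw [he, mem_sphere_zero_iff_norm.1 hu] at this
  linarith

lemma norm_innerPart_le (hψ : NearId ε ψ) (hε : ε < 1 / 64)
    (hm : ∀ u ∈ annulus (1 / 8) (7 / 8), ‖M u‖ ≤ m) {ω : ℂ} (hω : ‖ω‖ < 5 / 8) :
    ‖innerPart ψ M ω‖ ≤ 28 * m := by
  have hsub := sphere_subset_annulus (R := 3 / 4) (by norm_num) le_rfl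
  have h1 := norm_cauchyT_le (R := 3 / 4) (γ := ψ) (c := fun u => M u * deriv ψ u) (by norm_num)
    (m := m * 2) (d := 1 / 16) (ω := ω) (by norm_num) (fun u hu => ?_) (fun u hu => ?_)
  · have h2 : ‖conjFun (principalPart M) ω‖ ≤ 4 * m :=
      conjFun_bound (r := 16 / 5) (fun x hx => principalPart_bound hm hx) (by linarith)
    refine (norm_add_le _ _).trans ?_
    linarith
  · have hun := mem_sphere_zero_iff_norm.1 hu
    have h2 := hψ.norm_deriv_sub_one_le (u := u) (by linarith) (by linarith)
    have h3 : ‖deriv ψ u‖ ≤ 2 := by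
      have := norm_add_le (deriv ψ u - 1) 1
      rw [sub_add_cancel, norm_one] at this
      linarith
    rw [norm_mul]
    have := hm u (hsub hu)
    have hm0 : 0 ≤ m := (norm_nonneg _).trans this
    gcongr
  · have h2 := hψ.le_norm (hsub hu)
    rw [mem_sphere_zero_iff_norm.1 hu] at h2
    linarith [norm_sub_norm_le (ψ u) ω]

/-- Solution of the gluing problem `K ∘ ψ + k = L` with `K` holomorphic in a disc and `k`
holomorphic in an annulus around the unit circle, on which it takes imaginary values. -/
theorem exists_gluing_solution (hψ : NearId ε ψ) (hε : ε ≤ 1 / 2200) {L : ℂ → ℂ}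
    (hL : DifferentiableOn ℂ L (annulus (1 / 8) (7 / 8)))
    (hm : ∀ u ∈ annulus (1 / 8) (7 / 8), ‖L u‖ ≤ m) :
    ∃ K κ : ℂ → ℂ, DifferentiableOn ℂ K (ball 0 (5 / 8)) ∧ (∀ ω ∈ ball (0 : ℂ) (5 / 8), ‖K ω‖ ≤ 56 * m) ∧
      DifferentiableOn ℂ κ (ball 0 (16 / 5)) ∧ (∀ x ∈ ball (0 : ℂ) (16 / 5), ‖κ x‖ ≤ 8 * m) ∧
      ∀ s : ℂ, 5 / 16 < ‖s‖ → ‖s‖ < 9 / 16 → K (ψ s) + (κ s⁻¹ - conjFun κ s) = L s := by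
  have hε' : ε < 1 / 64 := by linarith
  have hm0 : 0 ≤ m := (norm_nonneg _).trans (hm (1 / 2) ⟨by norm_num, by norm_num⟩)
  -- Each right-hand side is the negative of the error left by the approximate solution for the
  -- previous one. The bound `1100 ε ≤ 1/2` makes these decay geometrically, and the corresponding
  -- approximate solutions are summed.
  set Ms : ℕ → ℂ → ℂ := fun i => (fun M s => -gluingError ψ M s)^[i] L with hMs
  have hsucc (i : ℕ) (s : ℂ) : Ms (i + 1) s = -gluingError ψ (Ms i) s := by
    simp only [hMs, Function.iterate_succ_apply']
  have hprop (i : ℕ) : DifferentiableOn ℂ (Ms i) (annulus (1 / 8) (7 / 8)) ∧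
      ∀ u ∈ annulus (1 / 8) (7 / 8), ‖Ms i u‖ ≤ m * (1 / 2) ^ i := by
    induction i with
    | zero => exact ⟨hL, fun u hu => by simpa [hMs] using hm u hu⟩
    | succ i ih =>
      have e : Ms (i + 1) = fun s => -gluingError ψ (Ms i) s := funext (hsucc i)
      refine ⟨e ▸ (differentiableOn_gluingError hψ hε' ih.1).fun_neg, fun u hu => ?_⟩
      rw [hsucc, norm_neg]
      refine (norm_gluingError_le hψ hε' ih.1 ih.2 hu).trans ?_
      have : 1100 * ε ≤ 1 / 2 := by linarith
      calc 1100 * ε * (m * (1 / 2) ^ i) ≤ 1 / 2 * (m * (1 / 2) ^ i) := by gcongr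
        _ = m * (1 / 2) ^ (i + 1) := by ring
  have hsum (b : ℝ) : HasSum (fun i : ℕ => b * (m * (1 / 2) ^ i)) (2 * b * m) := by
    have := (hasSum_geometric_two.mul_left m).mul_left b
    convert! this using 1; ring
  have hKb (i : ℕ) (ω : ℂ) (hω : ω ∈ ball (0 : ℂ) (5 / 8)) :
      ‖innerPart ψ (Ms i) ω‖ ≤ 28 * (m * (1 / 2) ^ i) :=
    norm_innerPart_le hψ hε' (hprop i).2 (mem_ball_zero_iff.1 hω)
  have hκb (i : ℕ) (x : ℂ) (hx : x ∈ ball (0 : ℂ) (16 / 5)) :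
      ‖principalPart (Ms i) x‖ ≤ 4 * (m * (1 / 2) ^ i) :=
    principalPart_bound (hprop i).2 (mem_ball_zero_iff.1 hx).le
  refine ⟨fun ω => ∑' i, innerPart ψ (Ms i) ω, fun x => ∑' i, principalPart (Ms i) x, ?_, ?_, ?_, ?_, ?_⟩
  · exact Complex.differentiableOn_tsum_of_summable_norm (hsum 28).summable (fun i ω hω =>
      (differentiableAt_innerPart hψ hε' (hprop i).1
        (mem_ball_zero_iff.1 hω)).differentiableWithinAt) isOpen_ball hKb
  · intro ω hω
    have := tsum_of_norm_bounded (hsum 28) (fun i => hKb i ω hω)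
    linarith
  · exact Complex.differentiableOn_tsum_of_summable_norm (hsum 4).summable (fun i x hx =>
      (differentiableAt_principalPart (hprop i).1
        (by linarith [mem_ball_zero_iff.1 hx])).differentiableWithinAt) isOpen_ball hκb
  · intro x hx
    have := tsum_of_norm_bounded (hsum 4) (fun i => hκb i x hx)
    linarith
  · intro s h1 h2
    have hs : s ∈ annulus (1 / 8) (7 / 8) := ⟨by linarith, by linarith⟩
    -- The bounds `5/16 < |s| < 9/16` place `s⁻¹` in the domain of `κ` and `ψ s` in that of `K`, as
    -- `9/16 + ε < 5/8`.
    have hψs : ψ s ∈ ball (0 : ℂ) (5 / 8) := by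
      rw [mem_ball_zero_iff]; linarith [hψ.norm_le hs]
    have hsi : s⁻¹ ∈ ball (0 : ℂ) (16 / 5) := by
      rw [mem_ball_zero_iff, norm_inv, inv_lt_comm₀ (by linarith) (by norm_num)]
      linarith
    have hsc : (starRingEnd ℂ) s ∈ ball (0 : ℂ) (16 / 5) := by
      rw [mem_ball_zero_iff, RCLike.norm_conj]; linarith
    have s1 : Summable fun i => innerPart ψ (Ms i) (ψ s) :=
      .of_norm_bounded (hsum 28).summable fun i => hKb i _ hψs
    have s2 : Summable fun i => principalPart (Ms i) s⁻¹ :=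
      .of_norm_bounded (hsum 4).summable fun i => hκb i _ hsi
    have s3 : Summable fun i => principalPart (Ms i) ((starRingEnd ℂ) s) :=
      .of_norm_bounded (hsum 4).summable fun i => hκb i _ hsc
    have s4 : Summable fun i => conjFun (principalPart (Ms i)) s :=
      Complex.hasSum_conj'.2 (by simpa [conjFun] using s3.hasSum) |>.summable
    have s5 : Summable fun i => Ms i s :=
      .of_norm_bounded (by simpa using (hsum 1).summable) fun i => (hprop i).2 s hs
    have e4 : conjFun (fun x => ∑' i, principalPart (Ms i) x) s
        = ∑' i, conjFun (principalPart (Ms i)) s := by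
      simp only [conjFun]
      exact Complex.conj_tsum _
    rw [e4, ← s2.tsum_sub s4, ← s1.tsum_add (s2.sub s4)]
    have e5 (i : ℕ) : innerPart ψ (Ms i) (ψ s)
        + (principalPart (Ms i) s⁻¹ - conjFun (principalPart (Ms i)) s) = Ms i s - Ms (i + 1) s := by
      rw [innerPart_add_eq hψ hε' (hprop i).1 (by linarith) (by linarith), hsucc]
      ring
    -- The series telescopes to its initial term `Ms 0 = L`.
    rw [tsum_congr e5, s5.tsum_sub ((summable_nat_add_iff 1).2 s5), s5.tsum_eq_zero_add]
    simp [hMs]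

end Gluing

end SLELoop

namespace SLELoop

open Metric

/-! ### Inverting almost identical maps -/

section NearIdentity

variable {θ : ℂ → ℂ} {W : Set ℂ} {e : ℝ}

lemma norm_defect_sub_le (hθ : DifferentiableOn ℂ θ W) (he : ∀ w ∈ W, ‖θ w - w‖ ≤ e) {ζ x y : ℂ}
    (hζ : ball ζ (1 / 16) ⊆ W) (hx : ‖x - ζ‖ < 1 / 32) (hy : ‖y - ζ‖ < 1 / 32) :
    ‖(θ x - x) - (θ y - y)‖ ≤ 64 * e * ‖x - y‖ := by
  have hd : DifferentiableOn ℂ (fun w => θ w - w) (ball ζ (1 / 16)) :=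
    (hθ.mono hζ).sub differentiableOn_id
  refine (convex_ball ζ (1 / 32)).norm_image_sub_le_of_norm_deriv_le (𝕜 := ℂ)
    (f := fun w => θ w - w) (fun z hz => ?_) (fun z hz => ?_)
    (by rwa [mem_ball, dist_eq_norm]) (by rwa [mem_ball, dist_eq_norm])
  · exact hd.differentiableAt (isOpen_ball.mem_nhds (ball_subset_ball (by norm_num) hz))
  · have hsub : closedBall z (1 / 64) ⊆ ball ζ (1 / 16) := by
      refine closedBall_subset_ball' ?_
      rw [mem_ball] at hz
      linarith
    have := Complex.norm_deriv_le_of_forall_mem_sphere_norm_le (by norm_num)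
      (hd.mono (closure_ball_subset_closedBall.trans hsub)).diffContOnCl
      (fun w hw => he w (hζ (hsub (sphere_subset_closedBall hw))))
    calc _ ≤ e / (1 / 64) := this
      _ = 64 * e := by ring

lemma eq_of_near_identity (hθ : DifferentiableOn ℂ θ W) (he : ∀ w ∈ W, ‖θ w - w‖ ≤ e)
    (he1 : e < 1 / 128) {x y : ℂ} (hx : x ∈ W) (hy : y ∈ W) (hxy : θ x = θ y)
    (hζ : ball (θ x) (1 / 16) ⊆ W) : x = y := by
  have h1 : ‖x - θ x‖ < 1 / 32 := by rw [norm_sub_rev]; linarith [he x hx]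
  have h2 : ‖y - θ x‖ < 1 / 32 := by rw [norm_sub_rev, hxy]; linarith [he y hy]
  have h3 := norm_defect_sub_le hθ he hζ h1 h2
  have e1 : (θ x - x) - (θ y - y) = -(x - y) := by rw [hxy]; ring
  rw [e1, norm_neg] at h3
  have h5 : ‖x - y‖ = 0 := by nlinarith [norm_nonneg (x - y)]
  exact sub_eq_zero.1 (norm_eq_zero.1 h5)

/-- Quantitative open mapping on the disc of radius `1/32`: the image contains the disc of radius
`(1/32 - 2e)/2` about `θ ζ`, and this contains `ζ` exactly because `e < 1/128`. Local constancy is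
excluded since `θ - id` is a contraction. -/
lemma exists_preimage_of_near_identity (hθ : DifferentiableOn ℂ θ W)
    (he : ∀ w ∈ W, ‖θ w - w‖ ≤ e) (he1 : e < 1 / 128) {ζ : ℂ} (hζ : ball ζ (1 / 16) ⊆ W) :
    ∃ w ∈ W, θ w = ζ := by
  have hsub : closedBall ζ (1 / 32) ⊆ W :=
    (closedBall_subset_ball (by norm_num)).trans hζ
  have hζW : ζ ∈ W := hζ (mem_ball_self (by norm_num))
  have hdc : DiffContOnCl ℂ θ (ball ζ (1 / 32)) :=
    (hθ.mono (closure_ball_subset_closedBall.trans hsub)).diffContOnCl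
  have hb (z : ℂ) (hz : z ∈ sphere ζ (1 / 32)) : 1 / 32 - 2 * e ≤ ‖θ z - θ ζ‖ := by
    have h1 := he z (hsub (sphere_subset_closedBall hz))
    have h2 := he ζ hζW
    rw [mem_sphere, dist_eq_norm] at hz
    have e1 : z - ζ = (θ z - θ ζ) - (θ z - z) + (θ ζ - ζ) := by ring
    have h3 := norm_add_le ((θ z - θ ζ) - (θ z - z)) (θ ζ - ζ)
    have h4 := norm_sub_le (θ z - θ ζ) (θ z - z)
    rw [← e1] at h3
    linarith
  by_cases hconst : ∃ᶠ z in 𝓝 ζ, θ z ≠ θ ζ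
  · have := hdc.ball_subset_image_closedBall (by norm_num) hb hconst
    obtain ⟨w, hw, hwζ⟩ := this (show ζ ∈ ball (θ ζ) ((1 / 32 - 2 * e) / 2) by
      rw [mem_ball, dist_eq_norm, norm_sub_rev]; linarith [he ζ hζW])
    exact ⟨w, hsub hw, hwζ⟩
  · exfalso
    rw [not_frequently] at hconst
    have hn : ∀ᶠ z in 𝓝[≠] ζ, θ z = θ ζ ∧ ‖z - ζ‖ < 1 / 32 := by
      refine Filter.Eventually.filter_mono nhdsWithin_le_nhds ?_
      filter_upwards [hconst, ball_mem_nhds ζ (by norm_num : (0 : ℝ) < 1 / 32)] with z h1 h2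
      exact ⟨not_not.1 h1, by rwa [← dist_eq_norm]⟩
    obtain ⟨z, ⟨h1, h2⟩, hne⟩ := (hn.and self_mem_nhdsWithin).exists
    have h3 := norm_defect_sub_le hθ he hζ h2 (y := ζ) (by simp)
    have e1 : (θ z - z) - (θ ζ - ζ) = -(z - ζ) := by rw [h1]; ring
    rw [e1, norm_neg] at h3
    have h5 : ‖z - ζ‖ = 0 := by nlinarith [norm_nonneg (z - ζ)]
    exact hne (sub_eq_zero.1 (norm_eq_zero.1 h5))

/-- A holomorphic map close to the identity on `W` has a holomorphic inverse on any open set that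
stays away from the complement of `W`. -/
lemma exists_inverse_of_near_identity (hW : IsOpen W) (hθ : DifferentiableOn ℂ θ W)
    (he : ∀ w ∈ W, ‖θ w - w‖ ≤ e) (he1 : e < 1 / 128) {Z : Set ℂ} (hZo : IsOpen Z)
    (hZ : ∀ ζ ∈ Z, ball ζ (1 / 16) ⊆ W) :
    ∃ G : ℂ → ℂ, DifferentiableOn ℂ G Z ∧ (∀ ζ ∈ Z, G ζ ∈ W ∧ θ (G ζ) = ζ ∧ ‖G ζ - ζ‖ ≤ e) ∧
      ∀ w ∈ W, θ w ∈ Z → G (θ w) = w := by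
  have hex (ζ : ℂ) : ∃ w, ζ ∈ Z → w ∈ W ∧ θ w = ζ := by
    by_cases h : ζ ∈ Z
    · obtain ⟨w, hw, h'⟩ := exists_preimage_of_near_identity hθ he he1 (hZ ζ h)
      exact ⟨w, fun _ => ⟨hw, h'⟩⟩
    · exact ⟨0, fun h' => absurd h' h⟩
  choose G hG using hex
  have hleft (w : ℂ) (hw : w ∈ W) (hwZ : θ w ∈ Z) : G (θ w) = w := by
    obtain ⟨h1, h2⟩ := hG _ hwZ
    refine eq_of_near_identity hθ he he1 h1 hw h2 ?_
    rw [h2]; exact hZ _ hwZ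
  refine ⟨G, fun ζ hζ => ?_, fun ζ hζ => ⟨(hG ζ hζ).1, (hG ζ hζ).2, ?_⟩, hleft⟩
  · have hU : IsOpen (W ∩ θ ⁻¹' Z) := hθ.continuousOn.isOpen_inter_preimage hW hZo
    have := analyticAt_leftInvOn (f := θ) (G := G) hU (hθ.mono Set.inter_subset_left)
      (fun x hx y hy hxy => eq_of_near_identity hθ he he1 hx.1 hy.1 hxy (hZ _ hx.2))
      (fun x hx => hleft x hx.1 hx.2) (z := G ζ) ⟨(hG ζ hζ).1, by
        rw [Set.mem_preimage, (hG ζ hζ).2]; exact hζ⟩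
    rw [(hG ζ hζ).2] at this
    exact this.differentiableAt.differentiableWithinAt
  · have := he _ (hG ζ hζ).1
    rwa [(hG ζ hζ).2, norm_sub_rev] at this

end NearIdentity

end SLELoop

namespace SLELoop

open Metric

/-! ### The two coordinate changes -/

/-- The coordinate change near the unit circle. -/
noncomputable def outerMap (κ : ℂ → ℂ) (w : ℂ) : ℂ := w * Complex.exp (κ w⁻¹ - conjFun κ w)

/-- The coordinate change near the origin. -/
noncomputable def innerMap (K : ℂ → ℂ) (w : ℂ) : ℂ := w * Complex.exp (-K w)

lemma norm_mul_exp_sub_le {w x : ℂ} {b : ℝ} (hx : ‖x‖ ≤ b) (hb : b ≤ 1) :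
    ‖w * Complex.exp x - w‖ ≤ ‖w‖ * (2 * b) := by
  have e : w * Complex.exp x - w = w * (Complex.exp x - 1) := by ring
  rw [e, norm_mul]
  have := Complex.norm_exp_sub_one_le (hx.trans hb)
  gcongr
  linarith

section Outer

variable {κ : ℂ → ℂ} {b : ℝ}

lemma ball_subset_annulus {a c r : ℝ} {ζ : ℂ} (h1 : a + r ≤ ‖ζ‖) (h2 : ‖ζ‖ + r ≤ c) :
    ball ζ r ⊆ annulus a c := fun x hx => by
  rw [mem_ball, dist_eq_norm] at hx
  have h3 := norm_add_le (x - ζ) ζ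
  have h4 := norm_sub_le x (x - ζ)
  rw [sub_add_cancel] at h3
  rw [sub_sub_cancel] at h4
  exact ⟨by linarith, by linarith⟩

lemma inv_mem_ball {w : ℂ} (hw : w ∈ annulus (5 / 16) (16 / 5)) : w⁻¹ ∈ ball (0 : ℂ) (16 / 5) := by
  have := hw.1
  rw [mem_ball_zero_iff, norm_inv, inv_lt_comm₀ (by linarith) (by norm_num)]
  linarith

lemma ne_zero_of_mem_annulus {a c : ℝ} (ha : 0 ≤ a) {w : ℂ} (hw : w ∈ annulus a c) : w ≠ 0 :=
  norm_pos_iff.1 (ha.trans_lt hw.1)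

lemma differentiableOn_outerMap (hκ : DifferentiableOn ℂ κ (ball 0 (16 / 5))) :
    DifferentiableOn ℂ (outerMap κ) (annulus (5 / 16) (16 / 5)) := by
  intro w hw
  refine DifferentiableAt.differentiableWithinAt ?_
  have h0 := ne_zero_of_mem_annulus (by norm_num) hw
  have h1 : DifferentiableAt ℂ (fun w => κ w⁻¹) w :=
    (hκ.differentiableAt (isOpen_ball.mem_nhds (inv_mem_ball hw))).fun_comp' w
      (differentiableAt_inv h0)
  have h2 : DifferentiableAt ℂ (conjFun κ) w :=
    DifferentiableAt.conjFun (hκ.differentiableAt (isOpen_ball.mem_nhds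
      (by rw [mem_ball_zero_iff, RCLike.norm_conj]; exact hw.2)))
  exact differentiableAt_id.mul (h1.sub h2).cexp

lemma norm_outer_exponent_le (hκb : ∀ x ∈ ball (0 : ℂ) (16 / 5), ‖κ x‖ ≤ b / 2) {w : ℂ}
    (hw : w ∈ annulus (5 / 16) (16 / 5)) : ‖κ w⁻¹ - conjFun κ w‖ ≤ b := by
  have h1 := hκb _ (inv_mem_ball hw)
  have h2 := hκb ((starRingEnd ℂ) w) (by rw [mem_ball_zero_iff, RCLike.norm_conj]; exact hw.2)
  refine (norm_sub_le _ _).trans ?_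
  rw [conjFun, RCLike.norm_conj]
  linarith

lemma norm_outerMap_sub_le (hb : b ≤ 1 / 1000)
    (hκb : ∀ x ∈ ball (0 : ℂ) (16 / 5), ‖κ x‖ ≤ b / 2) {w : ℂ}
    (hw : w ∈ annulus (5 / 16) (16 / 5)) : ‖outerMap κ w - w‖ ≤ 7 * b := by
  have h1 := norm_outer_exponent_le hκb hw
  have hb0 := (norm_nonneg _).trans h1
  refine (norm_mul_exp_sub_le h1 (by linarith)).trans ?_
  nlinarith [hw.2]

lemma conj_outer_exponent (w : ℂ) :
    (starRingEnd ℂ) (κ w⁻¹ - conjFun κ w)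
      = -(κ ((starRingEnd ℂ) w⁻¹)⁻¹ - conjFun κ ((starRingEnd ℂ) w⁻¹)) := by
  simp [conjFun]

/-- The exponent changes sign under conjugation combined with the reflection `w ↦ 1 / conj w`, so
the map commutes with this reflection. Hence it preserves the unit circle, the fixed set of the
reflection. -/
lemma outerMap_reflect (w : ℂ) :
    outerMap κ ((starRingEnd ℂ) w⁻¹) = ((starRingEnd ℂ) (outerMap κ w))⁻¹ := by
  have := conj_outer_exponent (κ := κ) w
  rw [outerMap, outerMap, map_mul, ← Complex.exp_conj, this, mul_inv, Complex.exp_neg, inv_inv,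
    map_inv₀]

lemma conj_inv_eq_self {w : ℂ} (hw : ‖w‖ = 1) : (starRingEnd ℂ) w⁻¹ = w := by
  have h0 : w ≠ 0 := norm_pos_iff.1 (by rw [hw]; exact one_pos)
  have h : w * (starRingEnd ℂ) w = 1 := by
    rw [Complex.mul_conj, Complex.normSq_eq_norm_sq, hw]; norm_num
  rw [map_inv₀]
  exact (eq_inv_of_mul_eq_one_left h).symm

lemma norm_eq_one_of_conj_inv {w : ℂ} (h0 : w ≠ 0) (h : (starRingEnd ℂ) w⁻¹ = w) : ‖w‖ = 1 := by
  have := congrArg norm h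
  rw [RCLike.norm_conj, norm_inv] at this
  have hp := norm_pos_iff.2 h0
  have h2 : ‖w‖ * ‖w‖ = 1 := by
    nth_rewrite 1 [← this]; exact inv_mul_cancel₀ hp.ne'
  nlinarith

lemma norm_outerMap_of_norm_eq_one {w : ℂ} (hw : ‖w‖ = 1) : ‖outerMap κ w‖ = 1 := by
  have h0 : w ≠ 0 := norm_pos_iff.1 (by rw [hw]; exact one_pos)
  refine norm_eq_one_of_conj_inv (mul_ne_zero h0 (Complex.exp_ne_zero _)) ?_
  rw [map_inv₀, ← outerMap_reflect, conj_inv_eq_self hw]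

/-- The coordinate change near the unit circle preserves the unit circle and is invertible. -/
lemma exists_outer_inverse (hb : b ≤ 1 / 1000) (hκ : DifferentiableOn ℂ κ (ball 0 (16 / 5)))
    (hκb : ∀ x ∈ ball (0 : ℂ) (16 / 5), ‖κ x‖ ≤ b / 2) :
    ∃ A : ℂ → ℂ, DifferentiableOn ℂ A (annulus (3 / 8) 3) ∧
      (∀ ζ ∈ annulus (3 / 8) 3, A ζ ∈ annulus (5 / 16) (16 / 5) ∧ outerMap κ (A ζ) = ζ ∧
        ‖A ζ - ζ‖ ≤ 7 * b) ∧
      (∀ w ∈ annulus (5 / 16) (16 / 5), outerMap κ w ∈ annulus (3 / 8) 3 → A (outerMap κ w) = w) ∧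
      (∀ ζ, ‖ζ‖ = 1 → ‖A ζ‖ = 1) ∧ ∀ ζ, 3 / 8 < ‖ζ‖ → ‖ζ‖ < 1 → ‖A ζ‖ < 1 := by
  obtain ⟨A, hA, hA1, hA2⟩ := exists_inverse_of_near_identity (isOpen_annulus _ _)
    (differentiableOn_outerMap hκ) (fun w hw => norm_outerMap_sub_le hb hκb hw) (by linarith)
    (isOpen_annulus (3 / 8) 3)
    (fun ζ hζ => ball_subset_annulus (by linarith [hζ.1]) (by linarith [hζ.2]))
  -- The point `A ζ` and its reflection in the unit circle are both preimages of `ζ`, so they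
  -- coincide.
  have hcirc (ζ : ℂ) (hζ : ‖ζ‖ = 1) : ‖A ζ‖ = 1 := by
    have hζA : ζ ∈ annulus (3 / 8) 3 := ⟨by rw [hζ]; norm_num, by rw [hζ]; norm_num⟩
    obtain ⟨h1, h2, h3⟩ := hA1 ζ hζA
    have h0 := ne_zero_of_mem_annulus (by norm_num) h1
    refine norm_eq_one_of_conj_inv h0 ?_
    have hm : (starRingEnd ℂ) (A ζ)⁻¹ ∈ annulus (5 / 16) (16 / 5) := by
      have hp := norm_pos_iff.2 h0
      refine ⟨?_, ?_⟩ <;> rw [RCLike.norm_conj, norm_inv]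
      · rw [lt_inv_comm₀ (by norm_num) hp]; linarith [h1.2]
      · rw [inv_lt_comm₀ hp (by norm_num)]; linarith [h1.1]
    have he : outerMap κ ((starRingEnd ℂ) (A ζ)⁻¹) = ζ := by
      rw [outerMap_reflect, h2, ← map_inv₀, conj_inv_eq_self hζ]
    have := hA2 _ hm (by rw [he]; exact hζA)
    rw [he] at this
    exact this.symm
  refine ⟨A, hA, hA1, hA2, hcirc, fun ζ h1 h2 => ?_⟩
  have hmem {s : ℝ} (hs : s * ‖ζ‖ ∈ Set.Ioo (3 / 8 : ℝ) 3) (hs0 : 0 ≤ s) :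
      (s : ℂ) * ζ ∈ annulus (3 / 8) 3 := by
    have : ‖(s : ℂ) * ζ‖ = s * ‖ζ‖ := by rw [norm_mul, Complex.norm_real, Real.norm_of_nonneg hs0]
    exact ⟨this ▸ hs.1, this ▸ hs.2⟩
  have hle (ξ : ℂ) (hξ : ξ ∈ annulus (3 / 8) 3) : ‖A ξ‖ ≤ ‖ξ‖ + 7 * b := by
    have := norm_add_le (A ξ - ξ) ξ
    rw [sub_add_cancel] at this
    linarith [(hA1 ξ hξ).2.2]
  by_contra hcon
  -- If `‖A ζ‖ ≥ 1`, then on the segment from `ζ / 2` to `ζ` the modulus of `A` takes the value `1`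
  -- at some `s ζ`; since `outerMap κ` preserves the circle, `‖s ζ‖ = 1`, contradicting `‖ζ‖ < 1`.
  -- The bound `7/8 ≤ ‖ζ‖` keeps the segment in the domain of `A`.
  rw [not_lt] at hcon
  have hζA : ζ ∈ annulus (3 / 8) 3 := ⟨h1, by linarith⟩
  have h34 : 7 / 8 ≤ ‖ζ‖ := by linarith [hle ζ hζA]
  have hcont : ContinuousOn (fun s : ℝ => ‖A ((s : ℂ) * ζ)‖) (Set.Icc (1 / 2) 1) := by
    refine (hA.continuousOn.comp (by fun_prop) fun s hs => hmem ?_ (by linarith [hs.1])).norm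
    constructor <;> nlinarith [hs.1, hs.2]
  have hhalf : ‖A (((1 / 2 : ℝ) : ℂ) * ζ)‖ ≤ 1 := by
    have hm := hmem (s := 1 / 2) (by constructor <;> linarith) (by norm_num)
    have := hle _ hm
    rw [norm_mul, Complex.norm_real] at this
    norm_num at this ⊢
    linarith
  obtain ⟨s, hs, hs1⟩ := intermediate_value_Icc (by norm_num : (1 / 2 : ℝ) ≤ 1) hcont
    (show (1 : ℝ) ∈ _ from ⟨hhalf, by simpa using hcon⟩)
  have hsm := hmem (s := s) (by constructor <;> nlinarith [hs.1, hs.2]) (by linarith [hs.1])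
  have h3 := norm_outerMap_of_norm_eq_one (κ := κ) hs1
  rw [(hA1 _ hsm).2.1, norm_mul, Complex.norm_real, Real.norm_of_nonneg (by linarith [hs.1])] at h3
  nlinarith [hs.1, hs.2]

end Outer

lemma exists_inner_inverse {K : ℂ → ℂ} {b : ℝ} (hb : b ≤ 1 / 1000)
    (hK : DifferentiableOn ℂ K (ball 0 (5 / 8))) (hKb : ∀ x ∈ ball (0 : ℂ) (5 / 8), ‖K x‖ ≤ b) :
    ∃ B : ℂ → ℂ, DifferentiableOn ℂ B (ball 0 (9 / 16)) ∧
      (∀ ζ ∈ ball (0 : ℂ) (9 / 16), B ζ ∈ ball (0 : ℂ) (5 / 8) ∧ innerMap K (B ζ) = ζ ∧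
        ‖B ζ - ζ‖ ≤ 7 * b) ∧
      ∀ w ∈ ball (0 : ℂ) (5 / 8), innerMap K w ∈ ball (0 : ℂ) (9 / 16) → B (innerMap K w) = w := by
  refine exists_inverse_of_near_identity (θ := innerMap K) (e := 7 * b) isOpen_ball
    (differentiableOn_id.mul hK.fun_neg.cexp)
    (fun w hw => ?_) (by linarith) isOpen_ball (fun ζ hζ => ?_)
  · have h1 := hKb w hw
    have h0 := (norm_nonneg _).trans h1
    refine (norm_mul_exp_sub_le (b := b) (by rwa [norm_neg]) (by linarith)).trans ?_
    nlinarith [mem_ball_zero_iff.1 hw]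
  · refine ball_subset_ball' ?_
    rw [mem_ball] at hζ
    linarith

end SLELoop

namespace SLELoop

open Metric

/-! ### The perturbed conformal map -/

/-- A perturbation `p` of the conformal map `g` near the boundary of the disc, which differs from
`g` by the change of coordinate `ψ` in an annulus. -/
structure Perturbation (ε : ℝ) (g p ψ : ℂ → ℂ) : Prop where
  nearId : NearId ε ψ
  cont : ContinuousOn p {w | 1 / 8 ≤ ‖w‖ ∧ ‖w‖ ≤ 1}
  diff : DifferentiableOn ℂ p (annulus (1 / 8) 1)
  inj : Set.InjOn p {w | 1 / 8 ≤ ‖w‖ ∧ ‖w‖ ≤ 1}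
  compat : ∀ w ∈ annulus (1 / 8) (7 / 8), g (ψ w) = p w
  separated : ∀ w₁ w₂, ‖w₁‖ ≤ 15 / 32 → 31 / 64 ≤ ‖w₂‖ → ‖w₂‖ ≤ 1 → g w₁ ≠ p w₂

section Glue

variable {ε b : ℝ} {g p ψ K κ : ℂ → ℂ}

/-- The coordinate changes glue `g` and `p` to an injective holomorphic map of the disc. -/
lemma exists_glued_map (hg : DifferentiableOn ℂ g (ball 0 1)) (hgi : Set.InjOn g (ball 0 1))
    (hp : Perturbation ε g p ψ) (hε : ε ≤ 1 / 1000) (hb : b ≤ 1 / 1000)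
    (hK : DifferentiableOn ℂ K (ball 0 (5 / 8))) (hKb : ∀ x ∈ ball (0 : ℂ) (5 / 8), ‖K x‖ ≤ b)
    (hκ : DifferentiableOn ℂ κ (ball 0 (16 / 5)))
    (hκb : ∀ x ∈ ball (0 : ℂ) (16 / 5), ‖κ x‖ ≤ b / 2)
    (hglue : ∀ s : ℂ, 5 / 16 < ‖s‖ → ‖s‖ < 9 / 16 →
      K (ψ s) + (κ s⁻¹ - conjFun κ s) = Complex.log (ψ s / s)) :
    ∃ F : ℂ → ℂ, DifferentiableOn ℂ F (ball 0 1) ∧ ContinuousOn F (closedBall 0 1) ∧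
      Set.InjOn F (closedBall 0 1) ∧ F '' sphere 0 1 = p '' sphere 0 1 ∧
      ∀ᶠ w in 𝓝 (0 : ℂ), F (innerMap K w) = g w := by
  obtain ⟨A, hAd, hA1, hA2, hA3, hA4⟩ := exists_outer_inverse hb hκ hκb
  obtain ⟨B, hBd, hB1, hB2⟩ := exists_inner_inverse hb hK hKb
  have hb0 : 0 ≤ b := (norm_nonneg _).trans (hKb 0 (by simp))
  have hA5 (ζ : ℂ) (h1 : 3 / 8 < ‖ζ‖) (h2 : ‖ζ‖ ≤ 1) : ‖A ζ‖ ≤ 1 := by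
    rcases h2.lt_or_eq with h | h
    · exact (hA4 ζ h1 h).le
    · exact (hA3 ζ h).le
  have hnear {x ζ : ℂ} (h : ‖x - ζ‖ ≤ 7 * b) : ‖ζ‖ - 7 * b ≤ ‖x‖ ∧ ‖x‖ ≤ ‖ζ‖ + 7 * b := by
    have h3 := norm_add_le (x - ζ) ζ
    have h4 := norm_sub_le x (x - ζ)
    rw [sub_add_cancel] at h3
    rw [sub_sub_cancel] at h4
    exact ⟨by linarith, by linarith⟩
  -- The two formulas agree for `3/8 < |ζ| < 1/2`, so each of them describes `F` on an open
  -- neighbourhood of its own region, whatever the threshold `7/16`.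
  set F : ℂ → ℂ := fun ζ => if ‖ζ‖ < 7 / 16 then g (B ζ) else p (A ζ) with hF
  have hagree (ζ : ℂ) (h1 : 3 / 8 < ‖ζ‖) (h2 : ‖ζ‖ < 1 / 2) : g (B ζ) = p (A ζ) := by
    have hζA : ζ ∈ annulus (3 / 8) 3 := ⟨h1, by linarith⟩
    obtain ⟨ha1, ha2, ha3⟩ := hA1 ζ hζA
    obtain ⟨hn1, hn2⟩ := hnear ha3
    set w := A ζ
    have hw : w ∈ annulus (1 / 8) (7 / 8) := ⟨by linarith, by linarith⟩
    have hw0 : w ≠ 0 := ne_zero_of_mem_annulus (by norm_num) hw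
    have hψw := hp.nearId.norm_le hw
    have hψw' := hp.nearId.le_norm hw
    have hψ0 : ψ w ≠ 0 := norm_pos_iff.1 (by linarith)
    have hψm : ψ w ∈ ball (0 : ℂ) (5 / 8) := by rw [mem_ball_zero_iff]; linarith
    -- The exponential of the gluing equation says that `innerMap K ∘ ψ = outerMap κ`; hence `B ζ =
    -- ψ (A ζ)`, and `g ∘ ψ = p` gives the agreement.
    have hβ : innerMap K (ψ w) = ζ := by
      rw [← ha2, innerMap, outerMap]
      have e : κ w⁻¹ - conjFun κ w = Complex.log (ψ w / w) + -K (ψ w) := by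
        rw [← hglue w (by linarith) (by linarith)]; ring
      rw [e, Complex.exp_add, Complex.exp_log (div_ne_zero hψ0 hw0)]
      field_simp
    have := hB2 _ hψm (by rw [hβ, mem_ball_zero_iff]; linarith)
    rw [hβ] at this
    rw [this, hp.compat w hw]
  have hFin (ζ : ℂ) (h : ‖ζ‖ < 1 / 2) : F ζ = g (B ζ) := by
    simp only [hF]
    split_ifs with h'
    · rfl
    · exact (hagree ζ (by linarith) h).symm
  have hFout (ζ : ℂ) (h : 3 / 8 < ‖ζ‖) : F ζ = p (A ζ) := by
    simp only [hF]
    split_ifs with h'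
    · exact hagree ζ h (by linarith)
    · rfl
  have hBball (ζ : ℂ) (h : ‖ζ‖ < 1 / 2) : ζ ∈ ball (0 : ℂ) (9 / 16) ∧ B ζ ∈ ball (0 : ℂ) 1 := by
    have hm : ζ ∈ ball (0 : ℂ) (9 / 16) := by rw [mem_ball_zero_iff]; linarith
    exact ⟨hm, ball_subset_ball (by norm_num) (hB1 ζ hm).1⟩
  have hAset (ζ : ℂ) (h1 : 3 / 8 < ‖ζ‖) (h2 : ‖ζ‖ ≤ 1) :
      ζ ∈ annulus (3 / 8) 3 ∧ A ζ ∈ {w : ℂ | 1 / 8 ≤ ‖w‖ ∧ ‖w‖ ≤ 1} := by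
    have hm : ζ ∈ annulus (3 / 8) 3 := ⟨h1, by linarith⟩
    have := (hA1 ζ hm).1.1
    exact ⟨hm, by linarith, hA5 ζ h1 h2⟩
  refine ⟨F, fun ζ hζ => ?_, fun ζ hζ => ?_, fun x hx y hy hxy => ?_, ?_, ?_⟩
  · rw [mem_ball_zero_iff] at hζ
    refine DifferentiableAt.differentiableWithinAt ?_
    rcases lt_or_ge ‖ζ‖ (1 / 2) with h | h
    · obtain ⟨h1, h2⟩ := hBball ζ h
      refine DifferentiableAt.congr_of_eventuallyEq (f := fun ζ => g (B ζ))
        ((hg.differentiableAt (isOpen_ball.mem_nhds h2)).fun_comp' ζ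
          (hBd.differentiableAt (isOpen_ball.mem_nhds h1))) ?_
      filter_upwards [(isOpen_lt continuous_norm continuous_const).mem_nhds h] with x hx
      exact hFin x hx
    · have h3 : 3 / 8 < ‖ζ‖ := by linarith
      obtain ⟨h1, -⟩ := hAset ζ h3 hζ.le
      have h2 : A ζ ∈ annulus (1 / 8) 1 := ⟨by linarith [(hA1 ζ h1).1.1], hA4 ζ h3 hζ⟩
      refine DifferentiableAt.congr_of_eventuallyEq (f := fun ζ => p (A ζ))
        ((hp.diff.differentiableAt ((isOpen_annulus _ _).mem_nhds h2)).fun_comp' ζ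
          (hAd.differentiableAt ((isOpen_annulus _ _).mem_nhds h1))) ?_
      filter_upwards [(isOpen_lt continuous_const continuous_norm).mem_nhds h3] with x hx
      exact hFout x hx
  · rw [mem_closedBall_zero_iff] at hζ
    rcases lt_or_ge ‖ζ‖ (1 / 2) with h | h
    · obtain ⟨h1, h2⟩ := hBball ζ h
      refine ContinuousAt.continuousWithinAt (ContinuousAt.congr (f := fun ζ => g (B ζ)) ?_ ?_)
      · exact ContinuousAt.comp (g := g) (f := B)
          (hg.differentiableAt (isOpen_ball.mem_nhds h2)).continuousAt
          (hBd.differentiableAt (isOpen_ball.mem_nhds h1)).continuousAt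
      · filter_upwards [(isOpen_lt continuous_norm continuous_const).mem_nhds h] with x hx
        exact (hFin x hx).symm
    · have h3 : 3 / 8 < ‖ζ‖ := by linarith
      obtain ⟨h1, h2⟩ := hAset ζ h3 hζ
      have hn : {x : ℂ | 3 / 8 < ‖x‖} ∈ 𝓝 ζ :=
        (isOpen_lt continuous_const continuous_norm).mem_nhds h3
      rw [← continuousWithinAt_inter hn]
      have hc : ContinuousWithinAt (p ∘ A) (closedBall 0 1 ∩ {x : ℂ | 3 / 8 < ‖x‖}) ζ :=
        ContinuousWithinAt.comp (hp.cont _ h2)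
          (hAd.differentiableAt ((isOpen_annulus _ _).mem_nhds h1)).continuousAt.continuousWithinAt
          fun x hx => (hAset x hx.2 (mem_closedBall_zero_iff.1 hx.1)).2
      exact hc.congr (fun x hx => hFout x hx.2) (hFout ζ h3)
  · rw [mem_closedBall_zero_iff] at hx hy
    -- Points that lie in no common chart are treated by separation: `A` and `B` move points by at
    -- most `7b`, which turns the bounds `7/16` and `1/2` into `15/32` and `31/64`.
    have mixed (x y : ℂ) (hx : ‖x‖ ≤ 7 / 16) (hy1 : 1 / 2 ≤ ‖y‖) (hy : ‖y‖ ≤ 1) : F x ≠ F y := by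
      obtain ⟨h1, h2⟩ := hBball x (by linarith)
      obtain ⟨h3, h4⟩ := hAset y (by linarith) hy
      rw [hFin x (by linarith), hFout y (by linarith)]
      have h5 := hnear (hB1 x h1).2.2
      have h6 := hnear (hA1 y h3).2.2
      exact hp.separated _ _ (by linarith) (by linarith) h4.2
    have hinn (x y : ℂ) (hx : ‖x‖ < 1 / 2) (hy : ‖y‖ < 1 / 2) (hxy : F x = F y) : x = y := by
      obtain ⟨h1, h2⟩ := hBball x hx
      obtain ⟨h3, h4⟩ := hBball y hy
      rw [hFin x hx, hFin y hy] at hxy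
      rw [← (hB1 x h1).2.1, ← (hB1 y h3).2.1, hgi h2 h4 hxy]
    have hout (x y : ℂ) (hx0 : 3 / 8 < ‖x‖) (hy0 : 3 / 8 < ‖y‖) (hx : ‖x‖ ≤ 1) (hy : ‖y‖ ≤ 1)
        (hxy : F x = F y) : x = y := by
      obtain ⟨h1, h2⟩ := hAset x hx0 hx
      obtain ⟨h3, h4⟩ := hAset y hy0 hy
      rw [hFout x hx0, hFout y hy0] at hxy
      rw [← (hA1 x h1).2.1, ← (hA1 y h3).2.1, hp.inj h2 h4 hxy]
    rcases lt_or_ge ‖x‖ (1 / 2) with h1 | h1 <;> rcases lt_or_ge ‖y‖ (1 / 2) with h2 | h2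
    · exact hinn x y h1 h2 hxy
    · rcases le_or_gt ‖x‖ (7 / 16) with h3 | h3
      · exact absurd hxy (mixed x y h3 h2 hy)
      · exact hout x y (by linarith) (by linarith) hx hy hxy
    · rcases le_or_gt ‖y‖ (7 / 16) with h3 | h3
      · exact absurd hxy.symm (mixed y x h3 h1 hx)
      · exact hout x y (by linarith) (by linarith) hx hy hxy
    · exact hout x y (by linarith) (by linarith) hx hy hxy
  · ext z
    constructor
    · rintro ⟨ζ, hζ, rfl⟩
      rw [mem_sphere_zero_iff_norm] at hζ
      exact ⟨A ζ, mem_sphere_zero_iff_norm.2 (hA3 ζ hζ), (hFout ζ (by rw [hζ]; norm_num)).symm⟩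
    · rintro ⟨w, hw, rfl⟩
      rw [mem_sphere_zero_iff_norm] at hw
      have h1 := norm_outerMap_of_norm_eq_one (κ := κ) hw
      refine ⟨outerMap κ w, mem_sphere_zero_iff_norm.2 h1, ?_⟩
      rw [hFout _ (by rw [h1]; norm_num), hA2 w ⟨by rw [hw]; norm_num, by rw [hw]; norm_num⟩
        ⟨by rw [h1]; norm_num, by rw [h1]; norm_num⟩]
  · have h0 : (0 : ℂ) ∈ ball (0 : ℂ) (5 / 8) := by simp
    have hc : ContinuousAt (innerMap K) 0 :=
      continuousAt_id.mul (hK.differentiableAt (isOpen_ball.mem_nhds h0)).continuousAt.neg.cexp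
    have h00 : innerMap K 0 = 0 := by simp [innerMap]
    have hev : ∀ᶠ w in 𝓝 (0 : ℂ), innerMap K w ∈ ball (0 : ℂ) (1 / 2) :=
      hc.eventually_mem (isOpen_ball.mem_nhds (by rw [h00]; simp))
    filter_upwards [hev, isOpen_ball.eventually_mem h0] with w h1 h2
    rw [mem_ball_zero_iff] at h1
    rw [hFin _ h1, hB2 w h2 (hBball _ h1).1]

end Glue

end SLELoop

/-! ### Normalisation of the glued map and its first coordinates -/

namespace SLELoop

open Metric

lemma Curve.a_one (η : Curve) : η.a 1 = deriv (deriv η.shape.f) 0 / 2 := by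
  simp [Curve.a, iteratedDeriv_succ, iteratedDeriv_zero]

lemma Curve.a_two (η : Curve) : η.a 2 = deriv (deriv (deriv η.shape.f)) 0 / 6 := by
  simp [Curve.a, iteratedDeriv_succ, iteratedDeriv_zero, Nat.factorial]

/-- The curve with a given uniformising map, after normalising the rotation. -/
lemma exists_curve_of_map {F : ℂ → ℂ} (hF : DifferentiableOn ℂ F (ball 0 1))
    (hFc : ContinuousOn F (closedBall 0 1)) (hFi : Set.InjOn F (closedBall 0 1)) (hF0 : F 0 = 0)
    {D lam : ℂ} (hD : deriv F 0 = D) (hlam : ‖lam‖ = 1) {c : ℝ} (hc : D * lam = Complex.exp c) :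
    ∃ η : Curve, η.trace = F '' sphere 0 1 ∧ η.c = c ∧
      η.a 1 = lam ^ 2 * deriv (deriv F) 0 * Complex.exp (-c) / 2 := by
  have hl0 : lam ≠ 0 := norm_pos_iff.1 (by rw [hlam]; exact one_pos)
  have hmaps : Set.MapsTo (fun z => lam * z) (closedBall (0 : ℂ) 1) (closedBall 0 1) := fun z hz => by
    rw [mem_closedBall_zero_iff] at hz ⊢
    rwa [norm_mul, hlam, one_mul]
  have hmaps' : Set.MapsTo (fun z => lam * z) (ball (0 : ℂ) 1) (ball 0 1) := fun z hz => by
    rw [mem_ball_zero_iff] at hz ⊢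
    rwa [norm_mul, hlam, one_mul]
  set f : ℂ → ℂ := fun z => Complex.exp (-c) * F (lam * z) with hf
  have hd : deriv f = fun z => Complex.exp (-c) * (lam * deriv F (lam * z)) := by
    funext z
    simp only [hf]
    rw [deriv_const_mul_field, deriv_comp_mul_left, smul_eq_mul]
  have hdd : deriv (deriv f) 0 = Complex.exp (-c) * (lam * (lam * deriv (deriv F) 0)) := by
    rw [hd, deriv_const_mul_field, deriv_const_mul_field, deriv_comp_mul_left, smul_eq_mul, mul_zero]
  have hdiff : DifferentiableOn ℂ f (ball 0 1) :=
    (hF.comp (by fun_prop) hmaps').const_mul _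
  have hcont : ContinuousOn f (closedBall 0 1) :=
    continuousOn_const.mul (hFc.comp (by fun_prop) hmaps)
  refine ⟨⟨c, ⟨f, ⟨hdiff, by rwa [closure_ball _ one_ne_zero]⟩, ?_, by simp [hf, hF0], ?_⟩⟩, ?_, rfl, ?_⟩
  · intro x hx y hy hxy
    have := hFi (hmaps hx) (hmaps hy) (mul_left_cancel₀ (Complex.exp_ne_zero _) hxy)
    exact mul_left_cancel₀ hl0 this
  · rw [hd]
    simp only [mul_zero, hD]
    rw [mul_comm lam, hc, ← Complex.exp_add, neg_add_cancel, Complex.exp_zero]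
  · have e (z : ℂ) : Complex.exp (c : ℂ) * f z = F (lam * z) := by
      simp only [hf]
      rw [← mul_assoc, ← Complex.exp_add, add_neg_cancel, Complex.exp_zero, one_mul]
    simp only [Curve.trace, e]
    ext z
    constructor
    · rintro ⟨x, hx, rfl⟩
      refine ⟨lam * x, ?_, rfl⟩
      rw [mem_sphere_zero_iff_norm] at hx ⊢
      rw [norm_mul, hlam, hx, one_mul]
    · rintro ⟨x, hx, rfl⟩
      refine ⟨lam⁻¹ * x, ?_, ?_⟩
      · rw [mem_sphere_zero_iff_norm] at hx ⊢
        rw [norm_mul, norm_inv, hlam, hx, inv_one, one_mul]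
      · simp only [mul_inv_cancel_left₀ hl0]
  · rw [Curve.a_one, hdd]
    ring

variable {K F g : ℂ → ℂ}

lemma hasDerivAt_innerMap {w : ℂ} (hK : DifferentiableAt ℂ K w) :
    HasDerivAt (innerMap K) (Complex.exp (-K w) * (1 - w * deriv K w)) w := by
  have := (hasDerivAt_id' w).fun_mul hK.hasDerivAt.fun_neg.cexp
  exact this.congr_deriv (by ring)

lemma deriv_deriv_innerMap_zero (hK : DifferentiableOn ℂ K (ball 0 (5 / 8))) :
    HasDerivAt (deriv (innerMap K)) (-2 * deriv K 0 * Complex.exp (-K 0)) 0 := by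
  have h0 : (0 : ℂ) ∈ ball (0 : ℂ) (5 / 8) := by simp
  have hK0 := hK.differentiableAt (isOpen_ball.mem_nhds h0)
  have hK1 := (hK.deriv isOpen_ball).differentiableAt (isOpen_ball.mem_nhds h0)
  have h1 : deriv (innerMap K) =ᶠ[𝓝 0] fun w => Complex.exp (-K w) * (1 - w * deriv K w) := by
    filter_upwards [isOpen_ball.mem_nhds h0] with w hw
    exact (hasDerivAt_innerMap (hK.differentiableAt (isOpen_ball.mem_nhds hw))).deriv
  refine HasDerivAt.congr_of_eventuallyEq ?_ h1
  have := hK0.hasDerivAt.fun_neg.cexp.fun_mul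
    (((hasDerivAt_id' (0 : ℂ)).fun_mul hK1.hasDerivAt).const_sub 1)
  exact this.congr_deriv (by simp; ring)

/-- First two derivatives at `0` of `F`, when `F ∘ innerMap K = g` near `0`. -/
lemma derivs_of_comp_innerMap (hK : DifferentiableOn ℂ K (ball 0 (5 / 8)))
    (hF : DifferentiableOn ℂ F (ball 0 1)) (h : ∀ᶠ w in 𝓝 (0 : ℂ), F (innerMap K w) = g w) :
    deriv F 0 = deriv g 0 * Complex.exp (K 0) ∧
      deriv (deriv F) 0
        = (deriv (deriv g) 0 + 2 * deriv g 0 * deriv K 0) * Complex.exp (K 0) ^ 2 := by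
  have h0 : (0 : ℂ) ∈ ball (0 : ℂ) (5 / 8) := by simp
  have h00 : innerMap K 0 = 0 := by simp [innerMap]
  have hβ0 := hasDerivAt_innerMap (hK.differentiableAt (isOpen_ball.mem_nhds h0))
  have h1 : deriv g =ᶠ[𝓝 0] fun w => deriv F (innerMap K w) * deriv (innerMap K) w := by
    have hev : ∀ᶠ w in 𝓝 (0 : ℂ), innerMap K w ∈ ball (0 : ℂ) 1 :=
      hβ0.continuousAt.eventually_mem (isOpen_ball.mem_nhds (by rw [h00]; simp))
    filter_upwards [h.eventually_nhds, hev, isOpen_ball.eventually_mem h0] with w hw h2 h3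
    have : deriv g w = deriv (F ∘ innerMap K) w := by
      refine EventuallyEq.deriv_eq ?_
      filter_upwards [hw] with x hx using hx.symm
    rw [this]
    exact ((hF.differentiableAt (isOpen_ball.mem_nhds h2)).hasDerivAt.comp w
      (hasDerivAt_innerMap (hK.differentiableAt
        (isOpen_ball.mem_nhds h3))).differentiableAt.hasDerivAt).deriv
  have hF1 : DifferentiableAt ℂ (deriv F) (innerMap K 0) := by
    rw [h00]; exact (hF.deriv isOpen_ball).differentiableAt (isOpen_ball.mem_nhds (by simp))
  have e1 : deriv g 0 = deriv F 0 * Complex.exp (-K 0) := by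
    rw [h1.self_of_nhds]
    simp only [hβ0.deriv, h00]
    simp
  have e2 : deriv (deriv g) 0 = deriv (deriv F) 0 * Complex.exp (-K 0) * Complex.exp (-K 0)
      + deriv F 0 * (-2 * deriv K 0 * Complex.exp (-K 0)) := by
    rw [h1.deriv_eq]
    have := (hF1.hasDerivAt.comp 0 hβ0).fun_mul (deriv_deriv_innerMap_zero hK)
    simp only [Function.comp_def] at this
    rw [this.deriv, h00, hβ0.deriv]
    simp
  have e3 : Complex.exp (-K 0) * Complex.exp (K 0) = 1 := by
    rw [← Complex.exp_add, neg_add_cancel, Complex.exp_zero]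
  rw [e2, e1]
  generalize Complex.exp (-K 0) = x at *
  generalize Complex.exp (K 0) = y at *
  constructor
  · linear_combination -deriv F 0 * e3
  · linear_combination -(deriv (deriv F) 0) * (x * y + 1) * e3

/-- The curve obtained from `η` by a small perturbation, with its first coordinates. -/
theorem exists_perturbed_curve {ε : ℝ} {p ψ : ℂ → ℂ} {η : Curve}
    (hp : Perturbation ε η.map p ψ) (hε : ε ≤ 1 / 10 ^ 6) :
    ∃ (η' : Curve) (K κ : ℂ → ℂ), η'.trace = p '' sphere 0 1 ∧
      η'.c = η.c + (K 0).re ∧ η'.a 1 = Complex.exp ((K 0).re : ℂ) * (η.a 1 + deriv K 0) ∧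
      DifferentiableOn ℂ K (ball 0 (5 / 8)) ∧ (∀ x ∈ ball (0 : ℂ) (5 / 8), ‖K x‖ ≤ 1000 * ε) ∧
      DifferentiableOn ℂ κ (ball 0 (16 / 5)) ∧ (∀ x ∈ ball (0 : ℂ) (16 / 5), ‖κ x‖ ≤ 500 * ε) ∧
      ∀ s : ℂ, 5 / 16 < ‖s‖ → ‖s‖ < 9 / 16 →
        K (ψ s) + (κ s⁻¹ - conjFun κ s) = Complex.log (ψ s / s) := by
  have hε0 := hp.nearId.nonneg
  have hquot (s : ℂ) (hs : s ∈ annulus (1 / 8) (7 / 8)) : ψ s / s = 1 + (ψ s - s) / s ∧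
      ‖(ψ s - s) / s‖ ≤ 8 * ε := by
    have h0 : s ≠ 0 := ne_zero_of_mem_annulus (by norm_num) hs
    refine ⟨by field_simp; ring, ?_⟩
    rw [norm_div, div_le_iff₀ (norm_pos_iff.2 h0)]
    nlinarith [hp.nearId.close s hs, hs.1]
  have hL : DifferentiableOn ℂ (fun s => Complex.log (ψ s / s)) (annulus (1 / 8) (7 / 8)) := by
    intro s hs
    obtain ⟨h1, h2⟩ := hquot s hs
    have h0 : s ≠ 0 := ne_zero_of_mem_annulus (by norm_num) hs
    refine DifferentiableAt.differentiableWithinAt (DifferentiableAt.clog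
      ((hp.nearId.diff.differentiableAt ((isOpen_annulus _ _).mem_nhds hs)).fun_div
        differentiableAt_id h0) ?_)
    simp only [h1]
    exact Complex.mem_slitPlane_of_norm_lt_one (by linarith)
  have hm : ∀ s ∈ annulus (1 / 8) (7 / 8), ‖Complex.log (ψ s / s)‖ ≤ 16 * ε := by
    intro s hs
    obtain ⟨h1, h2⟩ := hquot s hs
    simp only [h1]
    have := Complex.norm_log_one_add_half_le_self (z := (ψ s - s) / s) (by linarith)
    linarith
  -- The logarithm is bounded by `16ε`, so `K` and `κ` are bounded by `56 · 16ε ≤ 1000ε` and `8 ·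
  -- 16ε ≤ 500ε`. With `b = 1000ε`, the hypothesis `ε ≤ 10⁻⁶` gives the bound `b ≤ 1/1000` required
  -- for gluing.
  obtain ⟨K, κ, hK, hKb, hκ, hκb, hglue⟩ :=
    exists_gluing_solution hp.nearId (by linarith) hL hm
  obtain ⟨F, hF, hFc, hFi, hFt, hFg⟩ := exists_glued_map (b := 1000 * ε) η.map_differentiableOn
    (η.map_injOn.mono ball_subset_closedBall) hp (by linarith) (by linarith) hK
    (fun x hx => (hKb x hx).trans (by linarith)) hκ
    (fun x hx => (hκb x hx).trans (by linarith)) hglue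
  have hF0 : F 0 = 0 := by
    have := hFg.self_of_nhds
    rwa [η.map_zero, innerMap, zero_mul] at this
  obtain ⟨hd1, hd2⟩ := derivs_of_comp_innerMap hK hF hFg
  -- The derivative at `0` is `e^c e^{K 0}`; the rotation by `-Im (K 0)` makes it positive, equal to
  -- `e^(c + Re (K 0))`.
  obtain ⟨η', ht, hc, ha⟩ := exists_curve_of_map hF hFc hFi hF0 hd1
    (lam := Complex.exp (-((K 0).im : ℂ) * Complex.I)) (c := η.c + (K 0).re)
    (by rw [← Complex.ofReal_neg, Complex.norm_exp_ofReal_mul_I]) (by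
      rw [η.deriv_map_zero, ← Complex.exp_add, ← Complex.exp_add]
      congr 1
      push_cast
      linear_combination -Complex.re_add_im (K 0))
  refine ⟨η', K, κ, ht.trans hFt, hc, ?_, hK, fun x hx => (hKb x hx).trans (by linarith), hκ,
    fun x hx => (hκb x hx).trans (by linarith), hglue⟩
  have hdd : deriv (deriv η.map) 0 = Complex.exp (η.c : ℂ) * (2 * η.a 1) := by
    rw [funext η.deriv_map, deriv_const_mul_field, Curve.a_one]; ring
  rw [ha, hd2, hdd, η.deriv_map_zero, ← Complex.exp_nat_mul, ← Complex.exp_nat_mul]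
  have : Complex.exp ((2 : ℕ) * (-((K 0).im : ℂ) * Complex.I)) * Complex.exp ((2 : ℕ) * K 0)
      * Complex.exp (-((η.c + (K 0).re : ℝ) : ℂ)) * Complex.exp (η.c : ℂ)
      = Complex.exp ((K 0).re : ℂ) := by
    rw [← Complex.exp_add, ← Complex.exp_add, ← Complex.exp_add]
    congr 1
    push_cast
    linear_combination -2 * Complex.re_add_im (K 0)
  rw [← this]
  ring

end SLELoop

/-! ### Flows read in the uniformising coordinate -/

namespace SLELoop

open Metric

/-- A holomorphic flow of `v`, uniform away from the origin. -/
def IsUniformFlow (v : ℂ → ℂ) (φ : ℂ → ℂ → ℂ) : Prop :=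
  ∀ ρ : ℝ, 0 < ρ → ∃ τ : ℝ, 0 < τ ∧ ∃ C : ℝ, 0 < C ∧
    (∀ t : ℂ, ‖t‖ < τ → DifferentiableOn ℂ (φ t) {z | ρ < ‖z‖} ∧ Set.InjOn (φ t) {z | ρ < ‖z‖}) ∧
    ∀ z : ℂ, ρ < ‖z‖ → φ 0 z = z ∧ ∀ t : ℂ, ‖t‖ < τ →
      HasDerivAt (fun s => φ s z) (v (φ t z)) t ∧ ‖φ t z - z‖ ≤ C * ‖t‖

lemma isUniformFlow_translation : IsUniformFlow (vecField (-1)) fun t z => z - t := by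
  intro ρ _
  refine ⟨1, one_pos, 1, one_pos, fun t _ => ⟨by fun_prop, fun x _ y _ h => sub_left_injective h⟩,
    fun z _ => ⟨sub_zero z, fun t _ => ⟨?_, by simp⟩⟩⟩
  rw [vecField_neg_one]
  exact (hasDerivAt_id' t).const_sub z

lemma isUniformFlow_sqrtFlow : IsUniformFlow (vecField (-2)) sqrtFlow := by
  intro ρ hρ
  have hne {z : ℂ} (hz : ρ < ‖z‖) : z ≠ 0 := norm_pos_iff.1 (hρ.trans hz)
  have hlt {t z : ℂ} (ht : ‖t‖ < ρ ^ 2 / 4) (hz : ρ < ‖z‖) : ‖2 * t / z ^ 2‖ < 1 :=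
    norm_two_mul_div_sq_lt hρ hz.le (by nlinarith)
  have hder {t z : ℂ} (ht : ‖t‖ < ρ ^ 2 / 4) (hz : ρ < ‖z‖) :=
    hasDerivAt_sqrtFlow (hne hz) (hlt ht hz)
  refine ⟨ρ ^ 2 / 4, by positivity, 2 / ρ, by positivity, fun t ht => ⟨fun z hz => ?_, ?_⟩,
    fun z hz => ⟨sqrtFlow_zero z, fun t ht => ⟨?_, ?_⟩⟩⟩
  · have h0 := hne hz
    have h1 := one_sub_mem_slitPlane (hlt ht hz)
    refine DifferentiableAt.differentiableWithinAt ?_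
    unfold sqrtFlow
    have h2 : DifferentiableAt ℂ (fun x => 1 - 2 * t / x ^ 2) z :=
      ((differentiableAt_const (2 * t)).fun_div (differentiableAt_fun_id.fun_pow (x := z) 2)
        (pow_ne_zero 2 h0)).const_sub 1
    exact differentiableAt_fun_id.fun_mul ((h2.clog h1).div_const 2).cexp
  · intro x hx y hy hxy
    -- Equality of the squares gives `x = y` or `x = -y`; the second is impossible because `sqrtFlow
    -- t` is odd and does not vanish.
    have h2 : x ^ 2 = y ^ 2 := by
      have := congrArg (· ^ 2) hxy
      simp only [sqrtFlow_sq (hne hx) (hlt ht hx), sqrtFlow_sq (hne hy) (hlt ht hy)] at this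
      exact sub_left_injective this
    rcases sq_eq_sq_iff_eq_or_eq_neg.1 h2 with h | h
    · exact h
    · exfalso
      have h3 : sqrtFlow t x = -sqrtFlow t y := by simp [sqrtFlow, h]
      rw [h3] at hxy
      exact sqrtFlow_ne_zero (hne hy) (self_eq_neg.1 hxy.symm)
  · rw [vecField_neg_two]
    exact hder ht hz
  · have hb : ∀ s ∈ ball (0 : ℂ) (ρ ^ 2 / 4), ‖-(sqrtFlow s z)⁻¹‖ ≤ 2 / ρ := by
      intro s hs
      rw [mem_ball_zero_iff] at hs
      have h1 := sqrtFlow_sq (hne hz) (hlt hs hz)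
      have h2 : ρ ^ 2 / 4 ≤ ‖sqrtFlow s z‖ ^ 2 := by
        rw [← norm_pow, h1]
        have := norm_sub_norm_le (z ^ 2) (2 * s)
        rw [norm_pow, norm_mul, Complex.norm_ofNat] at this
        nlinarith
      have h3 : ρ / 2 ≤ ‖sqrtFlow s z‖ := by
        refine (sq_le_sq₀ (by positivity) (norm_nonneg _)).1 ?_
        linarith [show (ρ / 2) ^ 2 = ρ ^ 2 / 4 by ring]
      rw [norm_neg, norm_inv, show 2 / ρ = (ρ / 2)⁻¹ by field_simp]
      exact inv_anti₀ (by positivity) h3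
    have := (convex_ball (0 : ℂ) (ρ ^ 2 / 4)).norm_image_sub_le_of_norm_hasDerivWithin_le
      (fun s hs => (hder (mem_ball_zero_iff.1 hs) hz).hasDerivWithinAt) hb
      (mem_ball_self (by positivity)) (mem_ball_zero_iff.2 ht)
    simpa [sqrtFlow_zero] using this

/-- First order Taylor bound for holomorphic maps into the unit disc. -/
lemma norm_sub_sub_mul_le {h : ℂ → ℂ} {τ : ℝ} (hh : DifferentiableOn ℂ h (ball 0 τ))
    (hm : Set.MapsTo h (ball 0 τ) (ball 0 1)) {x : ℂ} (hx : HasDerivAt h x 0) {t : ℂ}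
    (ht : ‖t‖ < τ) :
    ‖h t - h 0‖ ≤ 2 / τ * ‖t‖ ∧ ‖h t - h 0 - t * x‖ ≤ 4 / τ ^ 2 * ‖t‖ ^ 2 := by
  have hτ : 0 < τ := (norm_nonneg t).trans_lt ht
  have h0 : (0 : ℂ) ∈ ball (0 : ℂ) τ := mem_ball_self hτ
  have hm2 : Set.MapsTo h (ball 0 τ) (closedBall (h 0) 2) := fun s hs => by
    rw [mem_closedBall, dist_eq_norm]
    have h1 := mem_ball_zero_iff.1 (hm hs)
    have h2 := mem_ball_zero_iff.1 (hm h0)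
    linarith [norm_sub_le (h s) (h 0)]
  have hxb : ‖x‖ ≤ 2 / τ := hx.deriv ▸ Complex.norm_deriv_le_div_of_mapsTo_ball hh hm2 hτ
  have ht' : t ∈ ball (0 : ℂ) τ := mem_ball_zero_iff.2 ht
  refine ⟨?_, ?_⟩
  · simpa [dist_eq_norm] using Complex.dist_le_div_mul_dist_of_mapsTo_ball hh hm2 ht'
  · have := Complex.dist_le_mul_div_pow_of_mapsTo_ball_of_isLittleO (f := fun s => h s - s * x)
      (c := 0) (z := t) (R₁ := τ) (R₂ := 4) (n := 1)
      (hh.fun_sub (differentiableOn_id.mul_const x)) (fun s hs => ?_) ?_ ht'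
    · simp only [dist_eq_norm, zero_mul, sub_zero] at this
      rw [show h t - h 0 - t * x = h t - t * x - h 0 by ring]
      refine this.trans_eq (by ring)
    · simp only [mem_closedBall, dist_eq_norm, zero_mul, sub_zero]
      have h1 : ‖h s - h 0‖ ≤ 2 := by simpa [dist_eq_norm] using hm2 hs
      have h2 : ‖s * x‖ ≤ 2 := by
        rw [norm_mul]
        calc ‖s‖ * ‖x‖ ≤ τ * (2 / τ) := by
              gcongr
              exact (mem_ball_zero_iff.1 hs).le
          _ = 2 := by field_simp
      rw [show h s - s * x - h 0 = h s - h 0 - s * x by ring]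
      linarith [norm_sub_le (h s - h 0) (s * x)]
    · have := hx.isLittleO
      simp only [sub_zero, smul_eq_mul] at this
      simp only [zero_mul, sub_zero, pow_one]
      refine (this.norm_right).congr_left fun s => by ring

lemma isCompact_norm_Icc (a b : ℝ) : IsCompact {w : ℂ | a ≤ ‖w‖ ∧ ‖w‖ ≤ b} := by
  refine (isCompact_closedBall (0 : ℂ) b).of_isClosed_subset
    ((isClosed_le continuous_const continuous_norm).inter
      (isClosed_le continuous_norm continuous_const)) fun w hw => mem_closedBall_zero_iff.2 hw.2

variable {v : ℂ → ℂ} {φ : ℂ → ℂ → ℂ}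

lemma IsUniformFlow.isFlowNear (hφ : IsUniformFlow v φ) (η : Curve) : IsFlowNear v η.trace φ := by
  obtain ⟨ρ, hρ, hρt⟩ := exists_pos_le_norm η.isCompact_trace η.zero_notMem_trace
  obtain ⟨τ, hτ, C, hC, -, h2⟩ := hφ (ρ / 2) (by positivity)
  exact ⟨{z | ρ / 2 < ‖z‖}, isOpen_lt continuous_const continuous_norm,
    fun z hz => by have := hρt z hz; exact (by linarith : ρ / 2 < ‖z‖), τ, hτ,
    fun z hz => ⟨(h2 z hz).1, fun t ht => ((h2 z hz).2 t ht).1⟩⟩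

/-- The flow of a vector field, read in the uniformising coordinate of a curve. -/
theorem exists_perturbation (hφ : IsUniformFlow v φ) (η : Curve) :
    ∃ C : ℝ, 0 < C ∧ ∃ τ : ℝ, 0 < τ ∧ ∃ ψ : ℂ → ℂ → ℂ, ∀ t : ℂ, ‖t‖ < τ →
      Perturbation (C * ‖t‖) η.map (fun w => φ t (η.map w)) (ψ t) ∧
      ∀ w ∈ annulus (1 / 8) (7 / 8),
        ‖ψ t w - w - t * (v (η.map w) / deriv η.map w)‖ ≤ C * ‖t‖ ^ 2 := by
  set g := η.map with hg
  have hgi : Set.InjOn g (ball 0 1) := η.map_injOn.mono ball_subset_closedBall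
  have hcont {a b : ℝ} (hb : b ≤ 1) : ContinuousOn g {w | a ≤ ‖w‖ ∧ ‖w‖ ≤ b} :=
    η.map_continuousOn.mono fun w hw => mem_closedBall_zero_iff.2 (hw.2.trans hb)
  have hA := (isCompact_norm_Icc (1 / 8) 1).image_of_continuousOn (hcont le_rfl)
  obtain ⟨ρ, hρ, hρA⟩ := exists_pos_le_norm hA (by
    rintro ⟨w, ⟨h1, h2⟩, h3⟩
    have : w = 0 := η.map_injOn (mem_closedBall_zero_iff.2 h2) (by simp) (h3.trans η.map_zero.symm)
    rw [this, norm_zero] at h1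
    norm_num at h1)
  have hρ' {w : ℂ} (h1 : 1 / 8 ≤ ‖w‖) (h2 : ‖w‖ ≤ 1) : ρ / 2 < ‖g w‖ := by
    have := hρA _ (Set.mem_image_of_mem g (show w ∈ {w : ℂ | 1 / 8 ≤ ‖w‖ ∧ ‖w‖ ≤ 1} from ⟨h1, h2⟩))
    linarith
  obtain ⟨τ, hτ, C, hC, hd, hf⟩ := hφ (ρ / 2) (by positivity)
  have hopen : IsOpen (g '' ball 0 1) := η.isOpen_image_map isOpen_ball subset_rfl
  -- A displacement below `δ` keeps the image of the annulus inside the interior of the curve, where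
  -- `g⁻¹` is defined; a displacement below `δ'`, introduced next, preserves the separation of inner
  -- and outer points. The time bound `τ₁` ensures both.
  obtain ⟨δ, hδ, hδsub⟩ := ((isCompact_norm_Icc (1 / 8) (7 / 8)).image_of_continuousOn
    (hcont (by norm_num))).exists_thickening_subset_open hopen (by
      rintro _ ⟨w, ⟨-, h2⟩, rfl⟩
      exact Set.mem_image_of_mem _ (mem_ball_zero_iff.2 (by linarith)))
  obtain ⟨δ', hδ', hsep⟩ : ∃ δ' > 0, ∀ w₁ w₂ : ℂ, ‖w₁‖ ≤ 15 / 32 → 31 / 64 ≤ ‖w₂‖ → ‖w₂‖ ≤ 1 →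
      δ' ≤ ‖g w₁ - g w₂‖ := by
    have hS1 := (isCompact_norm_Icc 0 (15 / 32)).image_of_continuousOn (hcont (by norm_num))
    have hS2 := (isCompact_norm_Icc (31 / 64) 1).image_of_continuousOn (hcont le_rfl)
    have hdisj : Disjoint (g '' {w | 0 ≤ ‖w‖ ∧ ‖w‖ ≤ 15 / 32}) (g '' {w | 31 / 64 ≤ ‖w‖ ∧ ‖w‖ ≤ 1}) := by
      rw [Set.disjoint_left]
      rintro _ ⟨x, ⟨-, hx⟩, rfl⟩ ⟨y, ⟨hy1, hy2⟩, hxy⟩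
      have : y = x := η.map_injOn (mem_closedBall_zero_iff.2 hy2)
        (mem_closedBall_zero_iff.2 (by linarith)) hxy
      rw [this] at hy1
      linarith
    obtain ⟨r, hr, hlt⟩ := exists_pos_forall_lt_edist hS1 hS2.isClosed hdisj
    refine ⟨r, by exact_mod_cast hr, fun w₁ w₂ h1 h2 h3 => ?_⟩
    have := hlt _ (Set.mem_image_of_mem g ⟨norm_nonneg w₁, h1⟩) _ (Set.mem_image_of_mem g ⟨h2, h3⟩)
    rw [edist_dist, dist_eq_norm, ← ENNReal.ofReal_coe_nnreal] at this
    exact (ENNReal.ofReal_lt_ofReal_iff'.1 this).1.le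
  set τ₁ := min τ (min (δ / C) (δ' / C)) with hτ₁
  have hτ₁0 : 0 < τ₁ := by positivity
  have ht1 {t : ℂ} (ht : ‖t‖ < τ₁) : ‖t‖ < τ := ht.trans_le (min_le_left _ _)
  have ht2 {t : ℂ} (ht : ‖t‖ < τ₁) : C * ‖t‖ < δ := by
    have := ht.trans_le ((min_le_right _ _).trans (min_le_left _ _))
    rw [lt_div_iff₀ hC] at this
    linarith
  have ht3 {t : ℂ} (ht : ‖t‖ < τ₁) : C * ‖t‖ < δ' := by
    have := ht.trans_le ((min_le_right _ _).trans (min_le_right _ _))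
    rw [lt_div_iff₀ hC] at this
    linarith
  have hmem {t w : ℂ} (ht : ‖t‖ < τ₁) (hw : w ∈ annulus (1 / 8) (7 / 8)) :
      φ t (g w) ∈ g '' ball 0 1 := by
    refine hδsub (mem_thickening_iff.2 ⟨g w, Set.mem_image_of_mem _ ⟨hw.1.le, hw.2.le⟩, ?_⟩)
    rw [dist_eq_norm]
    exact (((hf _ (hρ' hw.1.le (by linarith [hw.2]))).2 t (ht1 ht)).2).trans_lt (ht2 ht)
  set G := Function.invFunOn g (ball 0 1) with hGdef
  have hG : Set.LeftInvOn G g (ball 0 1) := hgi.leftInvOn_invFunOn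
  have hGd {z : ℂ} (hz : z ∈ g '' ball 0 1) : DifferentiableAt ℂ G z := by
    obtain ⟨w, hw, rfl⟩ := hz
    exact (analyticAt_leftInvOn isOpen_ball η.map_differentiableOn hgi hG hw).differentiableAt
  have hGm {z : ℂ} (hz : z ∈ g '' ball 0 1) : G z ∈ ball (0 : ℂ) 1 := by
    obtain ⟨w, hw, rfl⟩ := hz
    rwa [hG hw]
  have hGr {z : ℂ} (hz : z ∈ g '' ball 0 1) : g (G z) = z := by
    obtain ⟨w, hw, rfl⟩ := hz
    rw [hG hw]
  have hball {w : ℂ} (hw : w ∈ annulus (1 / 8) (7 / 8)) : w ∈ ball (0 : ℂ) 1 :=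
    mem_ball_zero_iff.2 (hw.2.trans (by norm_num))
  -- For fixed `w`, the function `t ↦ G (φ t (g w))` is holomorphic in the disc of radius `τ₁` with
  -- values in the unit disc, so its Taylor bounds in `t` depend on `τ₁` only and are uniform in
  -- `w`.
  have key {t w : ℂ} (ht : ‖t‖ < τ₁) (hw : w ∈ annulus (1 / 8) (7 / 8)) :
      ‖G (φ t (g w)) - w‖ ≤ 2 / τ₁ * ‖t‖ ∧
        ‖G (φ t (g w)) - w - t * (v (g w) / deriv g w)‖ ≤ 4 / τ₁ ^ 2 * ‖t‖ ^ 2 := by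
    obtain ⟨hf0, hft⟩ := hf _ (hρ' hw.1.le (by linarith [hw.2]))
    have hh0 : G (φ 0 (g w)) = w := by rw [hf0, hG (hball hw)]
    have hder0 : HasDerivAt (fun t => G (φ t (g w))) (v (g w) / deriv g w) 0 := by
      have h1 := (hft 0 (by simpa using hτ)).1
      have h2 : HasDerivAt G (deriv G (g w)) (φ 0 (g w)) := by
        rw [hf0]
        exact (hGd (Set.mem_image_of_mem g (hball hw))).hasDerivAt
      refine (h2.comp 0 h1).congr_deriv ?_
      have := deriv_leftInvOn_mul isOpen_ball η.map_differentiableOn hgi hG (hball hw)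
      rw [hf0, eq_div_iff (deriv_ne_zero_of_injOn isOpen_ball η.map_differentiableOn hgi (hball hw))]
      linear_combination v (g w) * this
    have := norm_sub_sub_mul_le (h := fun t => G (φ t (g w))) (τ := τ₁) (fun t ht => ?_)
      (fun t ht => hGm (hmem (mem_ball_zero_iff.1 ht) hw)) hder0 ht
    · simpa only [hh0] using this
    · have ht := mem_ball_zero_iff.1 ht
      exact ((hGd (hmem ht hw)).comp t
        (hft t (ht1 ht)).1.differentiableAt).differentiableWithinAt
  have hC' : 0 < 2 / τ₁ + 4 / τ₁ ^ 2 := by positivity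
  refine ⟨2 / τ₁ + 4 / τ₁ ^ 2, hC', τ₁, hτ₁0, fun t w => G (φ t (g w)), fun t ht => ⟨?_, ?_⟩⟩
  · have hmaps : Set.MapsTo g {w | 1 / 8 ≤ ‖w‖ ∧ ‖w‖ ≤ 1} {z | ρ / 2 < ‖z‖} :=
      fun w hw => hρ' hw.1 hw.2
    have hann {a b : ℝ} (hb : b ≤ 1) : DifferentiableOn ℂ g (annulus a b) :=
      η.map_differentiableOn.mono fun w hw => mem_ball_zero_iff.2 (hw.2.trans_le hb)
    have hp1 : DifferentiableOn ℂ (fun w => φ t (g w)) (annulus (1 / 8) 1) :=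
      (hd t (ht1 ht)).1.comp (hann le_rfl) fun w hw => hmaps ⟨hw.1.le, hw.2.le⟩
    refine ⟨⟨fun w hw => ?_, fun w hw => ?_⟩, ?_, hp1, ?_, fun w hw => hGr (hmem ht hw), ?_⟩
    · exact ((hGd (hmem ht hw)).comp w (hp1.differentiableAt
        ((isOpen_annulus _ _).mem_nhds ⟨hw.1, hw.2.trans (by norm_num)⟩))).differentiableWithinAt
    · refine (key ht hw).1.trans ?_
      have : 0 ≤ 4 / τ₁ ^ 2 * ‖t‖ := by positivity
      linarith
    · exact (hd t (ht1 ht)).1.continuousOn.comp (hcont le_rfl) hmaps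
    · exact (hd t (ht1 ht)).2.comp
        (η.map_injOn.mono fun w hw => mem_closedBall_zero_iff.2 hw.2) hmaps
    · intro w₁ w₂ h1 h2 h3 h4
      have h5 := ((hf _ (hρ' (by linarith) h3)).2 t (ht1 ht)).2
      rw [← h4] at h5
      linarith [hsep w₁ w₂ h1 h2 h3, ht3 ht]
  · intro w hw
    refine (key ht hw).2.trans ?_
    have : 0 ≤ 2 / τ₁ * ‖t‖ ^ 2 := by positivity
    linarith

end SLELoop

/-! ### Fourier coefficients on the circle of radius `1/2` -/

namespace SLELoop

open Metric

/-- The average over the circle of radius `1 / 2`. -/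
noncomputable def avg (f : ℂ → ℂ) : ℂ := Real.circleAverage f 0 (1 / 2)

variable {f g : ℂ → ℂ}

lemma norm_eq_half {s : ℂ} (hs : s ∈ sphere (0 : ℂ) (1 / 2)) : ‖s‖ = 1 / 2 :=
  mem_sphere_zero_iff_norm.1 hs

lemma ne_zero_of_mem_half {s : ℂ} (hs : s ∈ sphere (0 : ℂ) (1 / 2)) : s ≠ 0 :=
  norm_pos_iff.1 (by rw [norm_eq_half hs]; norm_num)

lemma continuousOn_half_div (hf : ContinuousOn f (sphere 0 (1 / 2))) :
    ContinuousOn (fun s => f s / s) (sphere 0 (1 / 2)) :=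
  hf.div continuousOn_id fun _ hs => ne_zero_of_mem_half hs

lemma continuousOn_half_mul (hf : ContinuousOn f (sphere 0 (1 / 2))) :
    ContinuousOn (fun s => s * f s) (sphere 0 (1 / 2)) := continuousOn_id.mul hf

lemma avg_congr (h : ∀ s ∈ sphere (0 : ℂ) (1 / 2), f s = g s) : avg f = avg g :=
  Real.circleAverage_congr_sphere (by rwa [abs_of_pos (by norm_num)])

lemma avg_add (hf : ContinuousOn f (sphere 0 (1 / 2))) (hg : ContinuousOn g (sphere 0 (1 / 2))) :
    avg (fun s => f s + g s) = avg f + avg g :=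
  Real.circleAverage_add (hf.circleIntegrable (by norm_num)) (hg.circleIntegrable (by norm_num))

lemma avg_const_mul (c : ℂ) (f : ℂ → ℂ) : avg (fun s => c * f s) = c * avg f :=
  Real.circleAverage_fun_smul (𝕜 := ℂ) (a := c)

lemma avg_sub (hf : ContinuousOn f (sphere 0 (1 / 2))) (hg : ContinuousOn g (sphere 0 (1 / 2))) :
    avg (fun s => f s - g s) = avg f - avg g := by
  have := avg_add hf (hg.const_mul (-1))
  rw [avg_const_mul] at this
  simpa [← sub_eq_add_neg] using this

lemma avg_conj (hf : ContinuousOn f (sphere 0 (1 / 2))) :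
    avg (fun s => (starRingEnd ℂ) (f s)) = (starRingEnd ℂ) (avg f) :=
  (Complex.conjCLE : ℂ →L[ℝ] ℂ).circleAverage_comp_comm (hf.circleIntegrable (by norm_num))

lemma norm_avg_le {M : ℝ} (h : ∀ s ∈ sphere (0 : ℂ) (1 / 2), ‖f s‖ ≤ M) : ‖avg f‖ ≤ M := by
  rw [avg, Real.circleAverage_eq_circleIntegral (by norm_num)]
  refine (circleIntegral.norm_two_pi_i_inv_smul_integral_le_of_norm_le_const (C := 2 * M)
    (by norm_num) fun z hz => ?_).trans_eq (by ring)
  rw [sub_zero, norm_smul, norm_inv, norm_eq_half hz]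
  linarith [h z hz]

lemma avg_div_pow {r : ℝ} (hr : 1 / 2 < r) (hf : DifferentiableOn ℂ f (ball 0 r)) (n : ℕ) :
    avg (fun s => f s / s ^ n) = iteratedDeriv n f 0 / n.factorial := by
  have := (hf.mono (closedBall_subset_ball hr)).circleIntegral_one_div_sub_center_pow_smul
    (by norm_num) n
  rw [avg, Real.circleAverage_eq_circleIntegral (by norm_num)]
  have e : (fun z : ℂ => (z - 0)⁻¹ • (f z / z ^ n)) = fun z => (1 / (z - 0) ^ (n + 1)) • f z := by
    funext z
    simp only [sub_zero, smul_eq_mul, pow_succ, mul_inv, div_eq_mul_inv]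
    ring
  rw [e, this, smul_smul, smul_eq_mul, div_eq_mul_inv, ← mul_assoc,
    inv_mul_cancel₀ Complex.two_pi_I_ne_zero, one_mul, div_eq_inv_mul]

lemma avg_eq {r : ℝ} (hr : 1 / 2 < r) (hf : DifferentiableOn ℂ f (ball 0 r)) : avg f = f 0 := by
  simpa using avg_div_pow hr hf 0

lemma avg_div {r : ℝ} (hr : 1 / 2 < r) (hf : DifferentiableOn ℂ f (ball 0 r)) :
    avg (fun s => f s / s) = deriv f 0 := by
  simpa [iteratedDeriv_one] using avg_div_pow hr hf 1

lemma avg_mul {r : ℝ} (hr : 1 / 2 < r) (hf : DifferentiableOn ℂ f (ball 0 r)) :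
    avg (fun s => s * f s) = 0 := by
  simpa using avg_eq hr (differentiableOn_id.fun_mul hf)

section Outer

variable {κ : ℂ → ℂ}

lemma differentiableOn_conjFun {r : ℝ} (hκ : DifferentiableOn ℂ κ (ball 0 r)) :
    DifferentiableOn ℂ (conjFun κ) (ball 0 r) := fun x hx =>
  (DifferentiableAt.conjFun (hκ.differentiableAt (isOpen_ball.mem_nhds (by
    rw [mem_ball_zero_iff] at hx ⊢; rwa [RCLike.norm_conj])))).differentiableWithinAt

lemma inv_eq_conj {s : ℂ} (hs : s ∈ sphere (0 : ℂ) (1 / 2)) : s⁻¹ = (starRingEnd ℂ) (4 * s) := by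
  rw [Complex.inv_def, Complex.normSq_eq_norm_sq, norm_eq_half hs]
  simp only [map_mul, map_ofNat]
  push_cast
  ring

/-- The first Fourier coefficients of `κ (s⁻¹) - conj (κ (conj s))`. -/
lemma avg_outer (hκ : DifferentiableOn ℂ κ (ball 0 (16 / 5))) :
    (avg fun s => κ s⁻¹ - conjFun κ s).re = 0 ∧
      avg (fun s => (κ s⁻¹ - conjFun κ s) / s)
        = -(starRingEnd ℂ) (avg fun s => s * (κ s⁻¹ - conjFun κ s)) := by
  set h := conjFun κ with hh
  have hd : DifferentiableOn ℂ h (ball 0 (16 / 5)) := differentiableOn_conjFun hκ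
  have hd4 : DifferentiableOn ℂ (fun s => h (4 * s)) (ball 0 (4 / 5)) :=
    hd.comp (by fun_prop) fun s hs => by
      rw [mem_ball_zero_iff] at hs ⊢
      rw [norm_mul, Complex.norm_ofNat]
      linarith
  have hsub {r : ℝ} (hr : 1 / 2 < r) : sphere (0 : ℂ) (1 / 2) ⊆ ball 0 r :=
    sphere_subset_closedBall.trans (closedBall_subset_ball hr)
  have hc : ContinuousOn h (sphere 0 (1 / 2)) := hd.continuousOn.mono (hsub (by norm_num))
  have hc4 : ContinuousOn (fun s => h (4 * s)) (sphere 0 (1 / 2)) :=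
    hd4.continuousOn.mono (hsub (by norm_num))
  -- On this circle `s⁻¹ = conj (4 s)`, which makes `κ(s⁻¹)` the conjugate of the holomorphic
  -- function `h (4 s)`. Every average below then follows from the mean value property.
  have hκinv {s : ℂ} (hs : s ∈ sphere (0 : ℂ) (1 / 2)) : κ s⁻¹ = (starRingEnd ℂ) (h (4 * s)) := by
    rw [inv_eq_conj hs, hh, conjFun, Complex.conj_conj]
  have hcκ : ContinuousOn (fun s => κ s⁻¹) (sphere 0 (1 / 2)) :=
    (Complex.continuous_conj.comp_continuousOn hc4).congr fun s hs => hκinv hs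
  have e0 : avg (fun s => κ s⁻¹) = (starRingEnd ℂ) (h 0) := by
    rw [avg_congr fun s hs => hκinv hs, avg_conj hc4, avg_eq (by norm_num) hd4, mul_zero]
  have e1 : avg (fun s => κ s⁻¹ / s) = 0 := by
    rw [avg_congr (g := fun s => (starRingEnd ℂ) (4 * (s * h (4 * s)))) fun s hs => ?_,
      avg_conj (f := fun s => 4 * (s * h (4 * s)))
        (continuousOn_const.mul (continuousOn_half_mul hc4)), avg_const_mul,
      avg_mul (by norm_num) hd4, mul_zero, map_zero]
    rw [div_eq_mul_inv, hκinv hs, inv_eq_conj hs, ← map_mul]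
    ring_nf
  have e2 : avg (fun s => s * κ s⁻¹) = (starRingEnd ℂ) (deriv h 0) := by
    rw [avg_congr (g := fun s => (starRingEnd ℂ) ((1 / 4) * (h (4 * s) / s))) fun s hs => ?_,
      avg_conj (f := fun s => (1 / 4) * (h (4 * s) / s))
        (continuousOn_const.mul (continuousOn_half_div hc4)),
      avg_const_mul, avg_div (by norm_num) hd4, deriv_comp_mul_left]
    · simp
    · have : s = (starRingEnd ℂ) (1 / 4 * s⁻¹) := by
        have h4 : (starRingEnd ℂ) (4 : ℂ) = 4 := map_ofNat _ 4
        rw [inv_eq_conj hs]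
        simp [h4]
      rw [hκinv hs]
      nth_rewrite 1 [this]
      rw [← map_mul]
      ring_nf
  constructor
  · rw [avg_sub hcκ hc, e0, avg_eq (by norm_num) hd]
    simp
  · have e3 : avg (fun s => (κ s⁻¹ - h s) / s) = -deriv h 0 := by
      simp only [sub_div]
      rw [avg_sub (continuousOn_half_div hcκ) (continuousOn_half_div hc), e1, avg_div (by norm_num) hd,
        zero_sub]
    have e4 : avg (fun s => s * (κ s⁻¹ - h s)) = (starRingEnd ℂ) (deriv h 0) := by
      simp only [mul_sub]
      rw [avg_sub (continuousOn_half_mul hcκ) (continuousOn_half_mul hc), e2,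
        avg_mul (by norm_num) hd, sub_zero]
    rw [e3, e4, Complex.conj_conj]

/-- Approximate solutions of the additive gluing problem on a circle. -/
lemma gluing_expansion {K Y : ℂ → ℂ} {r : ℝ} (hK : DifferentiableOn ℂ K (ball 0 (5 / 8)))
    (hκ : DifferentiableOn ℂ κ (ball 0 (16 / 5))) (hY : ContinuousOn Y (sphere 0 (1 / 2)))
    (h : ∀ s ∈ sphere (0 : ℂ) (1 / 2), ‖K s + (κ s⁻¹ - conjFun κ s) - Y s‖ ≤ r) :
    |(K 0).re - (avg Y).re| ≤ r ∧
      ‖deriv K 0 - avg (fun s => Y s / s) - (starRingEnd ℂ) (avg fun s => s * Y s)‖ ≤ 3 * r := by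
  obtain ⟨hk0, hk1⟩ := avg_outer hκ
  set k : ℂ → ℂ := fun s => κ s⁻¹ - conjFun κ s with hk
  have hKc : ContinuousOn K (sphere 0 (1 / 2)) := hK.continuousOn.mono
    (sphere_subset_closedBall.trans (closedBall_subset_ball (by norm_num)))
  have hne (s : ℂ) (hs : s ∈ sphere (0 : ℂ) (1 / 2)) := ne_zero_of_mem_half hs
  have hkc : ContinuousOn k (sphere 0 (1 / 2)) := by
    refine ContinuousOn.sub (hκ.continuousOn.comp (continuousOn_inv₀.mono hne) fun s hs => ?_)
      ((differentiableOn_conjFun hκ).continuousOn.mono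
        (sphere_subset_closedBall.trans (closedBall_subset_ball (by norm_num))))
    rw [mem_ball_zero_iff, norm_inv, norm_eq_half hs]
    norm_num
  replace h : ∀ s ∈ sphere (0 : ℂ) (1 / 2), ‖K s + k s - Y s‖ ≤ r := h
  have b0 := norm_avg_le h
  rw [avg_sub (hKc.fun_add hkc) hY, avg_add hKc hkc, avg_eq (by norm_num) hK] at b0
  have b1 : ‖avg fun s => K s / s + k s / s - Y s / s‖ ≤ 2 * r := norm_avg_le fun s hs => by
    rw [← add_div, ← sub_div, norm_div, norm_eq_half hs]
    linarith [h s hs]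
  rw [avg_sub ((continuousOn_half_div hKc).fun_add (continuousOn_half_div hkc)) (continuousOn_half_div hY), avg_add (continuousOn_half_div hKc) (continuousOn_half_div hkc),
    avg_div (by norm_num) hK] at b1
  have b2 : ‖avg fun s => s * K s + s * k s - s * Y s‖ ≤ r / 2 := norm_avg_le fun s hs => by
    rw [← mul_add, ← mul_sub, norm_mul, norm_eq_half hs]
    linarith [h s hs]
  rw [avg_sub ((continuousOn_half_mul hKc).fun_add (continuousOn_half_mul hkc)) (continuousOn_half_mul hY), avg_add (continuousOn_half_mul hKc) (continuousOn_half_mul hkc),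
    avg_mul (by norm_num) hK, zero_add] at b2
  have hr : 0 ≤ r := (norm_nonneg _).trans b0
  constructor
  · have := (Complex.abs_re_le_norm _).trans b0
    rw [Complex.sub_re, Complex.add_re, hk0, add_zero] at this
    exact this
  -- The average of `K + k` divided by `s` gives `K'(0)` plus an unknown coefficient of `k`. By the
  -- symmetry of `k` the latter is minus the conjugate of the average of `s k`, which equals that of
  -- `s Y` up to the error because `s K` has average `0`.
  · have e : deriv K 0 - avg (fun s => Y s / s) - (starRingEnd ℂ) (avg fun s => s * Y s)
        = (deriv K 0 + avg (fun s => k s / s) - avg fun s => Y s / s)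
          + (starRingEnd ℂ) (avg (fun s => s * k s) - avg fun s => s * Y s) := by
      rw [hk1, map_sub]; ring
    rw [e]
    refine (norm_add_le _ _).trans ?_
    rw [RCLike.norm_conj]
    linarith

end Outer

end SLELoop

/-! ### First-order expansion of the coordinates along a flow -/

namespace SLELoop

open Metric

lemma norm_sub_le_of_norm_le {K : ℂ → ℂ} {M : ℝ} (hK : DifferentiableOn ℂ K (ball 0 (5 / 8)))
    (hM : ∀ x ∈ ball (0 : ℂ) (5 / 8), ‖K x‖ ≤ M) {s w : ℂ} (hs : ‖s‖ = 1 / 2)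
    (hw : ‖w - s‖ < 1 / 8) : ‖K w - K s‖ ≤ 16 * M * ‖w - s‖ := by
  have hsub : ball s (1 / 8) ⊆ ball (0 : ℂ) (5 / 8) := ball_subset_ball' (by
    rw [dist_zero_right, hs]; norm_num)
  have hmaps : Set.MapsTo K (ball s (1 / 8)) (closedBall (K s) (2 * M)) := fun x hx => by
    rw [mem_closedBall, dist_eq_norm]
    linarith [norm_sub_le (K x) (K s), hM x (hsub hx), hM s (hsub (mem_ball_self (by norm_num)))]
  have := Complex.dist_le_div_mul_dist_of_mapsTo_ball (hK.mono hsub) hmaps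
    (z := w) (by rwa [mem_ball, dist_eq_norm])
  rw [dist_eq_norm, dist_eq_norm] at this
  linarith

/-- First order expansion of `K (ψ s) - K s - log (ψ s / s)`. -/
lemma norm_gluing_remainder_le {ψ X K k : ℂ → ℂ} {C δ : ℝ} {t s : ℂ} (hδ : ‖t‖ = δ)
    (hC : 0 < C) (hCδ : C * δ ≤ 1 / 10) (hK : DifferentiableOn ℂ K (ball 0 (5 / 8)))
    (hM : ∀ x ∈ ball (0 : ℂ) (5 / 8), ‖K x‖ ≤ 1000 * (C * δ)) (hs : ‖s‖ = 1 / 2)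
    (h1 : ‖ψ s - s‖ ≤ C * δ) (h2 : ‖ψ s - s - t * X s‖ ≤ C * δ ^ 2)
    (hglue : K (ψ s) + k s = Complex.log (ψ s / s)) :
    ‖K s + k s - t * (X s / s)‖ ≤ (2 * C + 16004 * C ^ 2) * δ ^ 2 := by
  have hδ0 : 0 ≤ δ := hδ ▸ norm_nonneg t
  have hs0 : s ≠ 0 := norm_pos_iff.1 (by rw [hs]; norm_num)
  set z := (ψ s - s) / s with hz
  have e1 : ψ s / s = 1 + z := by rw [hz]; field_simp; ring
  have hz1 : ‖z‖ ≤ 2 * (C * δ) := by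
    rw [hz, norm_div, hs]; linarith
  have b1 : ‖Complex.log (1 + z) - z‖ ≤ 4 * C ^ 2 * δ ^ 2 := by
    refine (Complex.norm_log_one_add_sub_self_le (by linarith)).trans ?_
    have h3 : (1 - ‖z‖)⁻¹ ≤ 2 := by
      rw [inv_le_comm₀ (by linarith) two_pos]; linarith
    have h4 : ‖z‖ ^ 2 ≤ (2 * (C * δ)) ^ 2 := by gcongr
    have h5 : 0 ≤ ‖z‖ ^ 2 := by positivity
    nlinarith
  have b2 : ‖z - t * (X s / s)‖ ≤ 2 * C * δ ^ 2 := by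
    rw [hz, show (ψ s - s) / s - t * (X s / s) = (ψ s - s - t * X s) / s by field_simp, norm_div, hs]
    linarith
  have b3 : ‖K (ψ s) - K s‖ ≤ 16000 * C ^ 2 * δ ^ 2 := by
    refine (norm_sub_le_of_norm_le hK hM hs (by linarith)).trans ?_
    have : 16 * (1000 * (C * δ)) * ‖ψ s - s‖ ≤ 16 * (1000 * (C * δ)) * (C * δ) := by gcongr
    linarith
  have e2 : K s + k s - t * (X s / s)
      = (Complex.log (1 + z) - z) + (z - t * (X s / s)) - (K (ψ s) - K s) := by
    rw [← e1, ← hglue]; ring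
  rw [e2]
  refine (norm_sub_le _ _).trans ?_
  linarith [norm_add_le (Complex.log (1 + z) - z) (z - t * (X s / s))]

/-- The expansion of the first coordinates of a curve along a flow. -/
theorem exists_curve_expansion {v : ℂ → ℂ} {φ : ℂ → ℂ → ℂ} (hφ : IsUniformFlow v φ) (η : Curve)
    {X : ℂ → ℂ} (hX : ∀ w, X w = v (η.map w) / deriv η.map w)
    (hXc : ContinuousOn X (sphere 0 (1 / 2))) :
    ∃ B : ℝ, 0 < B ∧ ∃ τ : ℝ, 0 < τ ∧ ∀ t : ℂ, ‖t‖ < τ → ∃ (η' : Curve) (u : ℝ) (y : ℂ),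
      η'.trace = φ t '' η.trace ∧ η'.c = η.c + u ∧
      η'.a 1 = Complex.exp (u : ℂ) * (η.a 1 + y) ∧ |u| ≤ B * ‖t‖ ∧ |u| ≤ 1 ∧ ‖y‖ ≤ B * ‖t‖ ∧
      |u - (t * avg fun s => X s / s).re| ≤ B * ‖t‖ ^ 2 ∧
      ‖y - t * avg (fun s => X s / s ^ 2) - (starRingEnd ℂ) (t * avg X)‖ ≤ B * ‖t‖ ^ 2 := by
  obtain ⟨C, hC, τ, hτ, ψ, hψ⟩ := exists_perturbation hφ η
  -- The first term comes from Cauchy's estimate for `K'(0)` on the circle of radius `1/2`, the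
  -- second is three times the gluing remainder; `τ` is such that `C ‖t‖ ≤ 10⁻⁶`.
  refine ⟨2000 * C + 3 * (2 * C + 16004 * C ^ 2), by positivity, min τ (1 / 10 ^ 6 / C),
    by positivity, fun t ht => ?_⟩
  obtain ⟨hp, hψX⟩ := hψ t (ht.trans_le (min_le_left _ _))
  have hCt : C * ‖t‖ ≤ 1 / 10 ^ 6 := by
    have := ht.trans_le (min_le_right _ _)
    rw [lt_div_iff₀ hC] at this
    linarith
  obtain ⟨η', K, κ, h1, h2, h3, hK, hKb, hκ, hκb, hglue⟩ := exists_perturbed_curve hp hCt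
  have hYc : ContinuousOn (fun s => t * (X s / s)) (sphere 0 (1 / 2)) :=
    (continuousOn_half_div hXc).const_mul t
  obtain ⟨b1, b2⟩ := gluing_expansion hK hκ hYc
    (r := (2 * C + 16004 * C ^ 2) * ‖t‖ ^ 2) fun s hs => by
      have hs := norm_eq_half hs
      have hmem : s ∈ annulus (1 / 8) (7 / 8) := ⟨by rw [hs]; norm_num, by rw [hs]; norm_num⟩
      exact norm_gluing_remainder_le (k := fun s => κ s⁻¹ - conjFun κ s) rfl hC
        (hCt.trans (by norm_num)) hK hKb hs (hp.nearId.close s hmem)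
        (by rw [hX]; exact hψX s hmem) (hglue s (by rw [hs]; norm_num) (by rw [hs]; norm_num))
  rw [avg_const_mul] at b1
  have e1 : avg (fun s => t * (X s / s) / s) = t * avg fun s => X s / s ^ 2 := by
    rw [← avg_const_mul]
    exact avg_congr fun s hs => by rw [pow_two, mul_div_assoc, div_div]
  have e2 : avg (fun s => s * (t * (X s / s))) = t * avg X := by
    rw [← avg_const_mul]
    exact avg_congr fun s hs => by have := ne_zero_of_mem_half hs; field_simp
  rw [e1, e2] at b2
  have h0 : (0 : ℂ) ∈ ball (0 : ℂ) (5 / 8) := by simp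
  have hu : |(K 0).re| ≤ 1000 * (C * ‖t‖) := (Complex.abs_re_le_norm _).trans (hKb 0 h0)
  have hsub : closedBall (0 : ℂ) (1 / 2) ⊆ ball 0 (5 / 8) := closedBall_subset_ball (by norm_num)
  have hy : ‖deriv K 0‖ ≤ 1000 * (C * ‖t‖) / (1 / 2) :=
    Complex.norm_deriv_le_of_forall_mem_sphere_norm_le (by norm_num)
      (hK.mono (closure_ball_subset_closedBall.trans hsub)).diffContOnCl
      fun s hs => hKb s (hsub (sphere_subset_closedBall hs))
  have hE : 0 ≤ C ^ 2 * ‖t‖ := by positivity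
  have hE2 : 0 ≤ C ^ 2 * ‖t‖ ^ 2 := by positivity
  have hE3 : 0 ≤ C * ‖t‖ := by positivity
  have hE4 : 0 ≤ C * ‖t‖ ^ 2 := by positivity
  refine ⟨η', (K 0).re, deriv K 0, ?_, h2, h3, ?_, ?_, ?_, ?_, ?_⟩
  · rw [h1, η.trace_eq, Set.image_image]
  · linarith
  · linarith
  · linarith
  · linarith
  · linarith

end SLELoop

/-! ### Lie derivatives of `c` and `a_1`, and the averages for `v_{-1}` -/

namespace SLELoop

open Metric

lemma isLittleO_of_norm_le_sq {E : ℂ → ℂ} {B : ℝ} (h : ∀ᶠ t in 𝓝 (0 : ℂ), ‖E t‖ ≤ B * ‖t‖ ^ 2) :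
    E =o[𝓝 0] fun t : ℂ => t := by
  have h1 : E =O[𝓝 0] fun t : ℂ => t ^ 2 :=
    IsBigO.of_bound B (by simpa only [norm_pow] using h)
  refine h1.trans_isLittleO ?_
  simpa using isLittleO_pow_pow (𝕜 := ℂ) one_lt_two

lemma ofReal_re_eq (z : ℂ) : ((z.re : ℝ) : ℂ) = z / 2 + (starRingEnd ℂ) z / 2 := by
  rw [Complex.re_eq_add_conj]; ring

/-- The Lie derivatives of the coordinates `c` and `a_1`. -/
theorem hasLieDerivAt_of_isUniformFlow {v : ℂ → ℂ} {φ : ℂ → ℂ → ℂ} (hφ : IsUniformFlow v φ)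
    (η : Curve) {X : ℂ → ℂ} (hX : ∀ w, X w = v (η.map w) / deriv η.map w)
    (hXc : ContinuousOn X (sphere 0 (1 / 2))) :
    (∃ β, HasLieDerivAt v (fun η => (η.c : ℂ)) η ((avg fun s => X s / s) / 2) β) ∧
      ∃ β, HasLieDerivAt v (fun η => η.a 1) η
        (avg (fun s => X s / s ^ 2) + η.a 1 * (avg fun s => X s / s) / 2) β := by
  obtain ⟨B, hB, τ, hτ, h⟩ := exists_curve_expansion hφ η hX hXc
  generalize hx1 : (avg fun s => X s / s) = x₁ at *
  generalize hx2 : (avg fun s => X s / s ^ 2) = x₂ at *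
  generalize hx0 : avg X = x₀ at *
  -- Outside the disc of radius `τ` the values `η, 0, 0` are placeholders, so that the curves can be
  -- chosen for all `t` at once.
  have h' : ∀ t : ℂ, ∃ (η' : Curve) (u : ℝ) (y : ℂ), ‖t‖ < τ →
      η'.trace = φ t '' η.trace ∧ η'.c = η.c + u ∧
      η'.a 1 = Complex.exp (u : ℂ) * (η.a 1 + y) ∧ |u| ≤ B * ‖t‖ ∧ |u| ≤ 1 ∧ ‖y‖ ≤ B * ‖t‖ ∧
      |u - (t * x₁).re| ≤ B * ‖t‖ ^ 2 ∧
      ‖y - t * x₂ - (starRingEnd ℂ) (t * x₀)‖ ≤ B * ‖t‖ ^ 2 := fun t => by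
    by_cases ht : ‖t‖ < τ
    · obtain ⟨η', u, y, h1⟩ := h t ht
      exact ⟨η', u, y, fun _ => h1⟩
    · exact ⟨η, 0, 0, fun h => absurd h ht⟩
  choose ηt u y hη using h'
  have hev : ∀ᶠ t in 𝓝 (0 : ℂ), ‖t‖ < τ := by
    filter_upwards [ball_mem_nhds (0 : ℂ) hτ] with t ht using mem_ball_zero_iff.1 ht
  have htr : ∀ᶠ t in 𝓝 (0 : ℂ), (ηt t).trace = φ t '' η.trace :=
    hev.mono fun t ht => (hη t ht).1
  refine ⟨⟨(starRingEnd ℂ) x₁ / 2, φ, hφ.isFlowNear η, ηt, htr, ?_⟩,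
    ⟨(starRingEnd ℂ) x₀ + η.a 1 * (starRingEnd ℂ) x₁ / 2, φ, hφ.isFlowNear η, ηt, htr, ?_⟩⟩
  · refine isLittleO_of_norm_le_sq (B := B) (hev.mono fun t ht => ?_)
    obtain ⟨-, h2, -, -, -, -, h7, -⟩ := hη t ht
    have e : ((ηt t).c : ℂ) - η.c - t * (x₁ / 2) - (starRingEnd ℂ) t * ((starRingEnd ℂ) x₁ / 2)
        = ((u t - (t * x₁).re : ℝ) : ℂ) := by
      rw [h2, Complex.ofReal_sub, ofReal_re_eq, map_mul]
      push_cast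
      ring
    rw [e, Complex.norm_real]
    exact h7
  · refine isLittleO_of_norm_le_sq (B := ‖η.a 1‖ * B + B + B ^ 2 * ‖η.a 1‖ + 2 * B ^ 2)
      (hev.mono fun t ht => ?_)
    obtain ⟨-, -, h3, h4, h5, h6, h7, h8⟩ := hη t ht
    have hu : ‖(u t : ℂ)‖ ≤ 1 := by rwa [Complex.norm_real]
    have hu' : ‖(u t : ℂ)‖ ≤ B * ‖t‖ := by rwa [Complex.norm_real]
    have b1 : ‖Complex.exp (u t) - 1 - u t‖ ≤ (B * ‖t‖) ^ 2 :=
      (Complex.norm_exp_sub_one_sub_id_le hu).trans (by gcongr)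
    have b2 : ‖Complex.exp (u t) - 1‖ ≤ 2 * (B * ‖t‖) :=
      (Complex.norm_exp_sub_one_le hu).trans (by gcongr)
    -- Expansion of `e^u (a_1 + y)`: to first order it changes by `a_1 u + y`, with `u = Re (t x₁)`
    -- split into its `t` and `conj t` parts; the other terms are quadratic.
    have e : (ηt t).a 1 - η.a 1 - t * (x₂ + η.a 1 * x₁ / 2)
          - (starRingEnd ℂ) t * ((starRingEnd ℂ) x₀ + η.a 1 * (starRingEnd ℂ) x₁ / 2)
        = η.a 1 * ((u t - (t * x₁).re : ℝ) : ℂ) + (y t - t * x₂ - (starRingEnd ℂ) (t * x₀))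
          + (Complex.exp (u t) - 1 - u t) * η.a 1 + (Complex.exp (u t) - 1) * y t := by
      rw [h3, Complex.ofReal_sub, ofReal_re_eq, map_mul, map_mul]
      ring
    rw [e]
    have c1 : ‖η.a 1 * ((u t - (t * x₁).re : ℝ) : ℂ)‖ ≤ ‖η.a 1‖ * (B * ‖t‖ ^ 2) := by
      rw [norm_mul, Complex.norm_real]
      gcongr
      exact h7
    have c2 : ‖(Complex.exp (u t) - 1 - u t) * η.a 1‖ ≤ (B * ‖t‖) ^ 2 * ‖η.a 1‖ := by
      rw [norm_mul]; gcongr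
    have c3 : ‖(Complex.exp (u t) - 1) * y t‖ ≤ 2 * (B * ‖t‖) * (B * ‖t‖) := by
      rw [norm_mul]; gcongr
    refine (norm_add_le _ _).trans ((add_le_add_left (norm_add₃_le) _).trans ?_)
    linarith

/-- The second derivative of a product. -/
lemma iteratedDeriv_two_mul {f g : ℂ → ℂ} {z : ℂ} (hf : AnalyticAt ℂ f z) (hg : AnalyticAt ℂ g z) :
    iteratedDeriv 2 (fun w => f w * g w) z
      = f z * iteratedDeriv 2 g z + 2 * deriv f z * deriv g z + iteratedDeriv 2 f z * g z := by
  have := iteratedDeriv_mul (n := 2) hf.contDiffAt hg.contDiffAt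
  simp only [Finset.sum_range_succ, Finset.sum_range_zero, iteratedDeriv_one, iteratedDeriv_zero] at this
  refine this.trans ?_
  simp

/-- The first two derivatives of a reciprocal. -/
lemma derivs_of_mul_eq_const {f g : ℂ → ℂ} {z c : ℂ} (hf : AnalyticAt ℂ f z) (hg : AnalyticAt ℂ g z)
    (h : ∀ᶠ w in 𝓝 z, f w * g w = c) :
    f z * deriv g z + deriv f z * g z = 0 ∧
      f z * iteratedDeriv 2 g z + 2 * deriv f z * deriv g z + iteratedDeriv 2 f z * g z = 0 := by
  constructor
  · have h1 := (hf.differentiableAt.hasDerivAt.fun_mul hg.differentiableAt.hasDerivAt).deriv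
    rw [EventuallyEq.deriv_eq h, deriv_const] at h1
    linear_combination -h1
  · have h1 : (fun w => f w * g w) =ᶠ[𝓝 z] fun _ => c := h
    rw [← iteratedDeriv_two_mul hf hg, h1.iteratedDeriv_eq 2, iteratedDeriv_const]
    simp

section Coordinates

variable (η : Curve)

lemma analyticAt_map : AnalyticAt ℂ η.map 0 :=
  η.map_differentiableOn.analyticAt (isOpen_ball.mem_nhds (by simp))

lemma deriv_deriv_map_zero : deriv (deriv η.map) 0 = Complex.exp (η.c : ℂ) * (2 * η.a 1) := by
  rw [funext η.deriv_map, deriv_const_mul_field, Curve.a_one]; ring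

lemma iteratedDeriv_two_deriv_map_zero :
    iteratedDeriv 2 (deriv η.map) 0 = Complex.exp (η.c : ℂ) * (6 * η.a 2) := by
  rw [iteratedDeriv_succ, iteratedDeriv_one, funext η.deriv_map]
  have : deriv (fun z => Complex.exp (η.c : ℂ) * deriv η.shape.f z)
      = fun z => Complex.exp (η.c : ℂ) * deriv (deriv η.shape.f) z := by
    funext z; rw [deriv_const_mul_field]
  rw [this, deriv_const_mul_field, Curve.a_two]
  ring

lemma deriv_map_ne_zero {z : ℂ} (hz : z ∈ ball (0 : ℂ) 1) : deriv η.map z ≠ 0 :=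
  deriv_ne_zero_of_injOn isOpen_ball η.map_differentiableOn (η.map_injOn.mono ball_subset_closedBall) hz

lemma differentiableOn_deriv_map : DifferentiableOn ℂ (deriv η.map) (ball 0 1) :=
  η.map_differentiableOn.deriv isOpen_ball

/-- With `g = η.map`, the function `-1/g'` is holomorphic in the disc, so the averages are its first
two Taylor coefficients; these are found by differentiating `(-1/g') g' = -1` with Leibniz's rule.
-/
lemma avg_translation :
    avg (fun s => -1 / deriv η.map s / s) = Complex.exp (-(η.c : ℂ)) * (2 * η.a 1) ∧
      avg (fun s => -1 / deriv η.map s / s ^ 2)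
        = Complex.exp (-(η.c : ℂ)) * (3 * η.a 2 - 4 * η.a 1 ^ 2) := by
  have hd : DifferentiableOn ℂ (fun s => -1 / deriv η.map s) (ball 0 1) :=
    (differentiableOn_const _).fun_div (differentiableOn_deriv_map η) fun z hz => deriv_map_ne_zero η hz
  have hmem : ball (0 : ℂ) 1 ∈ 𝓝 (0 : ℂ) := isOpen_ball.mem_nhds (by simp)
  have h := derivs_of_mul_eq_const (c := -1) (hd.analyticAt hmem) (analyticAt_map η).deriv (by
    filter_upwards [hmem] with z hz
    have := deriv_map_ne_zero η hz
    field_simp)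
  rw [avg_div (by norm_num) hd, avg_div_pow (by norm_num) hd]
  rw [deriv_deriv_map_zero, iteratedDeriv_two_deriv_map_zero, η.deriv_map_zero] at h
  obtain ⟨h1, h2⟩ := h
  generalize deriv (fun s => -1 / deriv η.map s) 0 = p at *
  generalize iteratedDeriv 2 (fun s => -1 / deriv η.map s) 0 = q at *
  rw [Complex.exp_neg]
  have h3 := Complex.exp_ne_zero (η.c : ℂ)
  generalize Complex.exp (η.c : ℂ) = x at *
  have hp : p = x⁻¹ * (2 * η.a 1) := by
    field_simp at h1 ⊢
    linear_combination h1
  refine ⟨hp, ?_⟩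
  rw [hp] at h2
  simp only [Nat.factorial, Nat.succ_eq_add_one]
  field_simp at h2 ⊢
  push_cast
  linear_combination h2

end Coordinates

end SLELoop

/-! ### The average for `v_{-2}` and the coefficients `P` -/

namespace SLELoop

open Metric

/-- Taylor coefficients at `0` of `g z / z`. -/
lemma derivs_dslope_zero {g : ℂ → ℂ} (hg : DifferentiableOn ℂ g (ball 0 1)) (hg0 : g 0 = 0) :
    2 * deriv (dslope g 0) 0 = deriv (deriv g) 0 ∧
      3 * iteratedDeriv 2 (dslope g 0) 0 = iteratedDeriv 2 (deriv g) 0 := by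
  have hmem : ball (0 : ℂ) 1 ∈ 𝓝 (0 : ℂ) := isOpen_ball.mem_nhds (by simp)
  set d := dslope g 0 with hd
  have hdd : DifferentiableOn ℂ d (ball 0 1) := (Complex.differentiableOn_dslope hmem).2 hg
  have hda : AnalyticAt ℂ d 0 := hdd.analyticAt hmem
  have hid : AnalyticAt ℂ (fun w : ℂ => w) 0 := analyticAt_id
  have e : g = fun w => w * d w := by
    funext w
    have := sub_smul_dslope g 0 w
    simp only [sub_zero, hg0, smul_eq_mul] at this
    exact this.symm
  have hi : iteratedDeriv 2 (fun w : ℂ => w) 0 = 0 := by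
    simp [iteratedDeriv_succ]
  constructor
  · have h2 := iteratedDeriv_two_mul hid hda
    rw [← e, hi, iteratedDeriv_succ, iteratedDeriv_one] at h2
    rw [h2]
    simp
  · have e1 : deriv g =ᶠ[𝓝 0] fun w => d w + w * deriv d w := by
      filter_upwards [hmem] with w hw
      conv_lhs => rw [e]
      have := ((hasDerivAt_id' w).fun_mul
        (hdd.differentiableAt (isOpen_ball.mem_nhds hw)).hasDerivAt).deriv
      rw [this, one_mul]
    have h2 := iteratedDeriv_two_mul hid hda.deriv
    rw [e1.iteratedDeriv_eq 2, iteratedDeriv_fun_add hda.contDiffAt (hid.fun_mul hda.deriv).contDiffAt,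
      h2, hi]
    simp [iteratedDeriv_succ]
    ring

variable (η : Curve)

/-- Writing `η.map s = s d(s)`, the averaged function is `q(s)/s²` with `q = -1/(d g')` holomorphic,
where `g = η.map`. The average is the second Taylor coefficient of `q`, found by differentiating `q
d g' = -1`. -/
lemma avg_sqrtFlow :
    avg (fun s => -(η.map s)⁻¹ / deriv η.map s / s)
      = Complex.exp (-2 * (η.c : ℂ)) * (4 * η.a 2 - 7 * η.a 1 ^ 2) := by
  have hmem : ball (0 : ℂ) 1 ∈ 𝓝 (0 : ℂ) := isOpen_ball.mem_nhds (by simp)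
  set d := dslope η.map 0 with hd
  have hdd : DifferentiableOn ℂ d (ball 0 1) :=
    (Complex.differentiableOn_dslope hmem).2 η.map_differentiableOn
  have hmap (w : ℂ) : w * d w = η.map w := by
    have := sub_smul_dslope η.map 0 w
    simpa only [sub_zero, η.map_zero, smul_eq_mul] using this
  have hd0 : d 0 = Complex.exp (η.c : ℂ) := by rw [hd, dslope_same, η.deriv_map_zero]
  have hdne {w : ℂ} (hw : w ∈ ball (0 : ℂ) 1) : d w ≠ 0 := by
    intro h
    rcases eq_or_ne w 0 with rfl | hw0
    · exact Complex.exp_ne_zero _ (hd0.symm.trans h)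
    · refine hw0 (η.map_injOn (ball_subset_closedBall hw) (by simp) ?_)
      rw [← hmap w, h, mul_zero, η.map_zero]
  have hDd : DifferentiableOn ℂ (fun w => d w * deriv η.map w) (ball 0 1) :=
    hdd.fun_mul (differentiableOn_deriv_map η)
  have hDne {w : ℂ} (hw : w ∈ ball (0 : ℂ) 1) : d w * deriv η.map w ≠ 0 :=
    mul_ne_zero (hdne hw) (deriv_map_ne_zero η hw)
  have hq : DifferentiableOn ℂ (fun w => -1 / (d w * deriv η.map w)) (ball 0 1) :=
    (differentiableOn_const _).fun_div hDd fun w hw => hDne hw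
  rw [avg_congr (g := fun s => -1 / (d s * deriv η.map s) / s ^ 2) fun s hs => ?_,
    avg_div_pow (by norm_num) hq]
  · obtain ⟨h1, h2⟩ := derivs_of_mul_eq_const (c := -1) (hq.analyticAt hmem) (hDd.analyticAt hmem) (by
      filter_upwards [hmem] with z hz
      have := hdne hz
      have := deriv_map_ne_zero η hz
      field_simp)
    obtain ⟨hd1, hd2⟩ := derivs_dslope_zero η.map_differentiableOn η.map_zero
    have hD1 : deriv (fun w => d w * deriv η.map w) 0
        = deriv d 0 * deriv η.map 0 + d 0 * deriv (deriv η.map) 0 :=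
      ((hdd.differentiableAt hmem).hasDerivAt.fun_mul
        ((differentiableOn_deriv_map η).differentiableAt hmem).hasDerivAt).deriv
    have hD2 := iteratedDeriv_two_mul (hdd.analyticAt hmem) (analyticAt_map η).deriv
    rw [← hd] at hd1 hd2
    rw [deriv_deriv_map_zero] at hd1 hD1 hD2
    rw [iteratedDeriv_two_deriv_map_zero] at hd2 hD2
    rw [η.deriv_map_zero, hd0] at hD1 hD2
    rw [hD1] at h1 h2
    rw [hD2, η.deriv_map_zero, hd0] at h2
    rw [η.deriv_map_zero, hd0] at h1
    generalize deriv (fun w => -1 / (d w * deriv η.map w)) 0 = p at *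
    generalize iteratedDeriv 2 (fun w => -1 / (d w * deriv η.map w)) 0 = q at *
    have hx2 : Complex.exp (-2 * (η.c : ℂ)) = (Complex.exp (η.c : ℂ))⁻¹ ^ 2 := by
      rw [← Complex.exp_neg, ← Complex.exp_nat_mul]
      push_cast; ring_nf
    rw [hx2]
    have h3 := Complex.exp_ne_zero (η.c : ℂ)
    generalize Complex.exp (η.c : ℂ) = x at *
    have hd1' : deriv d 0 = x * η.a 1 := by linear_combination hd1 / 2
    have hd2' : iteratedDeriv 2 d 0 = x * (2 * η.a 2) := by linear_combination hd2 / 3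
    rw [hd1'] at h1 h2
    rw [hd2'] at h2
    have hp : p = x⁻¹ ^ 2 * (3 * η.a 1) := by
      field_simp at h1 ⊢
      linear_combination h1
    rw [hp] at h2
    simp only [Nat.factorial, Nat.succ_eq_add_one]
    field_simp at h2 ⊢
    push_cast
    linear_combination h2
  · have hs0 := ne_zero_of_mem_half hs
    have hs1 : s ∈ ball (0 : ℂ) 1 := mem_ball_zero_iff.2 (by rw [norm_eq_half hs]; norm_num)
    have := hdne hs1
    have := deriv_map_ne_zero η hs1
    rw [← hmap s]
    field_simp

lemma sphere_half_subset : sphere (0 : ℂ) (1 / 2) ⊆ ball 0 1 :=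
  sphere_subset_closedBall.trans (closedBall_subset_ball (by norm_num))

lemma continuousOn_deriv_map_half : ContinuousOn (deriv η.map) (sphere 0 (1 / 2)) :=
  (differentiableOn_deriv_map η).continuousOn.mono sphere_half_subset

lemma isLieCoeff_neg_one_c : IsLieCoeff (-1) (fun η => (η.c : ℂ)) (MvPolynomial.X 1) := by
  intro η
  have hc : ContinuousOn (fun s => -1 / deriv η.map s) (sphere 0 (1 / 2)) :=
    continuousOn_const.div (continuousOn_deriv_map_half η)
      fun s hs => deriv_map_ne_zero η (sphere_half_subset hs)
  have h := (hasLieDerivAt_of_isUniformFlow isUniformFlow_translation η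
    (fun w => by rw [vecField_neg_one]) hc).1
  rw [(avg_translation η).1] at h
  convert! h using 2
  simp only [Curve.scaledEval, MvPolynomial.eval_X]
  push_cast
  ring_nf

/-- The coefficient of `a_1²` is `-4 + 1`: the `-4` comes from the translation of the expansion, the
`1` from the rescaling of `f` that keeps `f'(0) = 1`. -/
lemma isLieCoeff_neg_one_a_one : IsLieCoeff (-1) (fun η => η.a 1)
    (MvPolynomial.C 3 * MvPolynomial.X 2 - MvPolynomial.C 3 * MvPolynomial.X 1 ^ 2) := by
  intro η
  have hc : ContinuousOn (fun s => -1 / deriv η.map s) (sphere 0 (1 / 2)) :=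
    continuousOn_const.div (continuousOn_deriv_map_half η)
      fun s hs => deriv_map_ne_zero η (sphere_half_subset hs)
  have h := (hasLieDerivAt_of_isUniformFlow isUniformFlow_translation η
    (fun w => by rw [vecField_neg_one]) hc).2
  rw [(avg_translation η).1, (avg_translation η).2] at h
  convert! h using 2
  simp only [Curve.scaledEval, map_sub, map_mul, map_pow, MvPolynomial.eval_X, MvPolynomial.eval_C]
  push_cast
  ring_nf

lemma isLieCoeff_neg_two_c : IsLieCoeff (-2) (fun η => (η.c : ℂ))
    (MvPolynomial.C 2 * MvPolynomial.X 2 - MvPolynomial.C (7 / 2) * MvPolynomial.X 1 ^ 2) := by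
  intro η
  have hne (s : ℂ) (hs : s ∈ sphere (0 : ℂ) (1 / 2)) : η.map s ≠ 0 := fun h =>
    ne_zero_of_mem_half hs (η.map_injOn (ball_subset_closedBall (sphere_half_subset hs)) (by simp)
      (h.trans η.map_zero.symm))
  have hc : ContinuousOn (fun s => -(η.map s)⁻¹ / deriv η.map s) (sphere 0 (1 / 2)) :=
    (((η.map_differentiableOn.continuousOn.mono sphere_half_subset).inv₀ hne).neg).div
      (continuousOn_deriv_map_half η) fun s hs => deriv_map_ne_zero η (sphere_half_subset hs)
  have h := (hasLieDerivAt_of_isUniformFlow isUniformFlow_sqrtFlow η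
    (fun w => by rw [vecField_neg_two]) hc).1
  rw [avg_sqrtFlow η] at h
  convert! h using 2
  simp only [Curve.scaledEval, map_sub, map_mul, map_pow, MvPolynomial.eval_X, MvPolynomial.eval_C]
  push_cast
  ring_nf

theorem coeffP0_neg_one : coeffP0 (-1) = MvPolynomial.X 1 :=
  epsilon_isLieCoeff_eq hasUniqueFlow_vecField_neg_one
    (fun _ _ h => by rw [(Curve.eqOn_of_trace_eq h).1]) isLieCoeff_neg_one_c

theorem coeffP_neg_one_one : coeffP (-1) 1
    = MvPolynomial.C 3 * MvPolynomial.X 2 - MvPolynomial.C 3 * MvPolynomial.X 1 ^ 2 :=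
  epsilon_isLieCoeff_eq hasUniqueFlow_vecField_neg_one
    (fun _ _ h => Curve.a_eq_of_trace_eq h 1) isLieCoeff_neg_one_a_one

theorem coeffP0_neg_two : coeffP0 (-2)
    = MvPolynomial.C 2 * MvPolynomial.X 2 - MvPolynomial.C (7 / 2) * MvPolynomial.X 1 ^ 2 :=
  epsilon_isLieCoeff_eq hasUniqueFlow_vecField_neg_two
    (fun _ _ h => by rw [(Curve.eqOn_of_trace_eq h).1]) isLieCoeff_neg_two_c

end SLELoop

/-! ### The Schwarzian term and the coefficients `Q` -/

namespace SLELoop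

open Metric

section Schwarzian

variable {f G : ℂ → ℂ}

lemma analyticAt_schwarzian {z : ℂ} (hG : AnalyticAt ℂ G z) (h : deriv G z ≠ 0) :
    AnalyticAt ℂ (schwarzian G) z :=
  (hG.deriv.deriv.fun_div hG.deriv h).deriv.fun_sub
    (analyticAt_const.fun_mul ((hG.deriv.deriv.fun_div hG.deriv h).fun_pow 2))

/-- The Schwarzian derivative at `0` of the inverse of a normalised map. -/
lemma schwarzian_leftInv_zero (hf : DifferentiableOn ℂ f (ball 0 1)) (hf0 : f 0 = 0)
    (hf1 : deriv f 0 = 1) (hG : AnalyticAt ℂ G 0) (hG1 : deriv G 0 = 1)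
    (h : ∀ w ∈ ball (0 : ℂ) 1, deriv G (f w) * deriv f w = 1) :
    schwarzian G 0 = 3 / 2 * deriv (deriv f) 0 ^ 2 - iteratedDeriv 2 (deriv f) 0 := by
  have hmem : ball (0 : ℂ) 1 ∈ 𝓝 (0 : ℂ) := isOpen_ball.mem_nhds (by simp)
  have hfa : AnalyticAt ℂ f 0 := hf.analyticAt hmem
  have hG' : AnalyticAt ℂ (deriv G) (f 0) := by rw [hf0]; exact hG.deriv
  have hP : AnalyticAt ℂ (fun w => deriv G (f w)) 0 := hG'.comp hfa
  obtain ⟨h1, h2⟩ := derivs_of_mul_eq_const hP hfa.deriv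
    (by filter_upwards [hmem] with w hw using h w hw)
  have hd1 : deriv (fun w => deriv G (f w)) =ᶠ[𝓝 0] fun w => deriv (deriv G) (f w) * deriv f w := by
    filter_upwards [hfa.continuousAt.eventually hG'.eventually_analyticAt,
      hfa.eventually_analyticAt] with w hw1 hw2
    exact (hw1.differentiableAt.hasDerivAt.comp w hw2.differentiableAt.hasDerivAt).deriv
  have hd2 : iteratedDeriv 2 (fun w => deriv G (f w)) 0
      = deriv (deriv (deriv G)) 0 + deriv (deriv G) 0 * deriv (deriv f) 0 := by
    rw [iteratedDeriv_succ, iteratedDeriv_one, hd1.deriv_eq]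
    have := ((hG'.deriv.differentiableAt.hasDerivAt.comp 0 hfa.differentiableAt.hasDerivAt).fun_mul
      hfa.deriv.differentiableAt.hasDerivAt).deriv
    simp only [Function.comp_apply, hf0, hf1, mul_one] at this
    exact this
  rw [hd2] at h2
  have hd3 := hd1.self_of_nhds
  simp only [hf0, hf1, mul_one] at hd3
  simp only [hd3, hf0, hG1, hf1, one_mul, mul_one] at h1 h2
  have hS : deriv (fun w => deriv (deriv G) w / deriv G w) 0
      = deriv (deriv (deriv G)) 0 - deriv (deriv G) 0 ^ 2 := by
    have := (hG.deriv.deriv.differentiableAt.hasDerivAt.fun_div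
      hG.deriv.differentiableAt.hasDerivAt (by rw [hG1]; exact one_ne_zero)).deriv
    rw [this, hG1]
    ring
  rw [schwarzian, hS, hG1]
  have e1 : deriv (deriv G) 0 = -deriv (deriv f) 0 := by linear_combination h1
  rw [e1] at h2 ⊢
  linear_combination h2

end Schwarzian

variable (η : Curve)

lemma analyticAt_inv : AnalyticAt ℂ η.shape.inv 0 ∧ deriv η.shape.inv 0 = 1 ∧
    ∀ w ∈ ball (0 : ℂ) 1, deriv η.shape.inv (η.shape.f w) * deriv η.shape.f w = 1 := by
  have hf := η.shape.diffCont.differentiableOn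
  have hi : Set.InjOn η.shape.f (ball 0 1) := η.shape.injOn.mono ball_subset_closedBall
  have h0 : (0 : ℂ) ∈ ball (0 : ℂ) 1 := by simp
  have h1 := analyticAt_leftInvOn isOpen_ball hf hi hi.leftInvOn_invFunOn h0
  have h2 (w : ℂ) (hw : w ∈ ball (0 : ℂ) 1) :=
    deriv_leftInvOn_mul isOpen_ball hf hi hi.leftInvOn_invFunOn hw
  rw [η.shape.map_zero] at h1
  refine ⟨h1, ?_, h2⟩
  have := h2 0 h0
  rwa [η.shape.map_zero, η.shape.deriv_zero, mul_one] at this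

lemma exists_differentiableOn_schwarzian :
    ∃ r > 0, DifferentiableOn ℂ (schwarzian η.shape.inv) (ball 0 r) := by
  obtain ⟨h1, h2, -⟩ := analyticAt_inv η
  obtain ⟨r, hr, h⟩ := Metric.eventually_nhds_iff_ball.1
    (analyticAt_schwarzian h1 (by rw [h2]; exact one_ne_zero)).eventually_analyticAt
  exact ⟨r, hr, fun z hz => (h z hz).differentiableAt.differentiableWithinAt⟩

/-- Substitute `f''(0) = 2 a_1` and `f'''(0) = 6 a_2`; the value is `-𝓢 f (0)`, as expected from the
cocycle rule with `f'(0) = 1`. -/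
lemma schwarzian_inv_zero : schwarzian η.shape.inv 0 = 6 * η.a 1 ^ 2 - 6 * η.a 2 := by
  obtain ⟨h1, h2, h3⟩ := analyticAt_inv η
  rw [schwarzian_leftInv_zero η.shape.diffCont.differentiableOn η.shape.map_zero η.shape.deriv_zero
    h1 h2 h3, Curve.a_one, Curve.a_two, iteratedDeriv_succ, iteratedDeriv_one]
  ring

/-- `vartheta` is computed by any small circle. -/
lemma vartheta_eq {v : ℂ → ℂ} {x : ℂ} {r₀ : ℝ} (hr₀ : 0 < r₀)
    (h : ∀ r : ℝ, 0 < r → r < r₀ → Complex.exp (-(η.c : ℂ)) / (2 * Complex.I * Real.pi) *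
      (∮ z in C(0, r), schwarzian η.shape.inv z * v (Complex.exp (η.c : ℂ) * z)) = x) :
    vartheta η v = x := by
  refine Tendsto.limUnder_eq (tendsto_const_nhds.congr' ?_)
  filter_upwards [Ioo_mem_nhdsGT hr₀] with r hr using (h r hr.1 hr.2).symm

/-- The vector field is constant and the Schwarzian is holomorphic near `0`, so Cauchy's theorem
applies. -/
lemma vartheta_neg_one : vartheta η (vecField (-1)) = 0 := by
  obtain ⟨r₀, hr₀, hS⟩ := exists_differentiableOn_schwarzian η
  refine vartheta_eq η hr₀ fun r h0 hr => ?_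
  have hd : DiffContOnCl ℂ (fun z => schwarzian η.shape.inv z * -1) (ball 0 r) :=
    ((hS.mono (closure_ball_subset_closedBall.trans (closedBall_subset_ball hr))).mul_const
      _).diffContOnCl
  simp only [vecField_neg_one]
  rw [hd.circleIntegral_eq_zero h0.le, mul_zero]

/-- The vector field contributes the simple pole `-e^(-c)/z`, so Cauchy's formula evaluates the
Schwarzian at `0`; the second factor `e^(-c)` is the prefactor of the integral. -/
lemma vartheta_neg_two : vartheta η (vecField (-2))
    = -Complex.exp (-2 * (η.c : ℂ)) * (6 * η.a 1 ^ 2 - 6 * η.a 2) := by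
  obtain ⟨r₀, hr₀, hS⟩ := exists_differentiableOn_schwarzian η
  refine vartheta_eq η hr₀ fun r h0 hr => ?_
  have e : (fun z => schwarzian η.shape.inv z * vecField (-2) (Complex.exp (η.c : ℂ) * z))
      = fun z => -Complex.exp (-(η.c : ℂ)) * ((z - 0)⁻¹ • schwarzian η.shape.inv z) := by
    funext z
    rw [vecField_neg_two, mul_inv, Complex.exp_neg, sub_zero, smul_eq_mul]
    ring
  have hd : DiffContOnCl ℂ (schwarzian η.shape.inv) (ball 0 r) :=
    (hS.mono (closure_ball_subset_closedBall.trans (closedBall_subset_ball hr))).diffContOnCl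
  have h1 := hd.circleIntegral_sub_inv_smul (mem_ball_self h0)
  rw [e, circleIntegral.integral_const_mul, h1, schwarzian_inv_zero, smul_eq_mul,
    show -2 * (η.c : ℂ) = -(η.c : ℂ) + -(η.c : ℂ) by ring, Complex.exp_add]
  have := Complex.I_ne_zero
  have := Complex.ofReal_ne_zero.2 Real.pi_ne_zero
  field_simp

/-- A polynomial satisfying the specification makes the epsilon choice satisfy it too, and values on
curves determine polynomials. -/
lemma coeffQ0_eq {κ : ℝ} {n : ℤ} {q : MvPolynomial ℕ+ ℂ}
    (h : ∀ η : Curve, -((centralCharge κ : ℂ) / 12) * vartheta η (vecField n) = η.scaledEval n q) :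
    coeffQ0 κ n = q :=
  eq_of_scaledEval_eq (n := n) fun η => by
    rw [← h η]
    exact (Classical.epsilon_spec (p := fun q => ∀ η : Curve,
      -((centralCharge κ : ℂ) / 12) * vartheta η (vecField n) = η.scaledEval n q) ⟨q, h⟩ η).symm

theorem coeffQ0_neg_one (κ : ℝ) : coeffQ0 κ (-1) = 0 :=
  coeffQ0_eq fun η => by simp [vartheta_neg_one, Curve.scaledEval]

theorem coeffQ0_neg_two (κ : ℝ) : coeffQ0 κ (-2)
    = MvPolynomial.C (-(centralCharge κ : ℂ) / 2) * (MvPolynomial.X 2 - MvPolynomial.X 1 ^ 2) :=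
  coeffQ0_eq fun η => by
    simp only [vartheta_neg_two, Curve.scaledEval, map_mul, map_sub, map_pow, MvPolynomial.eval_X,
      MvPolynomial.eval_C]
    push_cast
    ring_nf

end SLELoop

theorem corollaryC (κ : ℝ) (hκ0 : 0 < κ) (hκ4 : κ ≤ 4) (lam : ℂ)
    (hlam : lam = (6 - (κ : ℂ)) / (2 * (κ : ℂ)) ∨ lam = (3 * (κ : ℂ) - 8) / 16) :
    (SLELoop.opL κ lam (-1) ^ 2 - (2 / 3 * (2 * lam + 1)) • SLELoop.opL κ lam (-2))
      (1 : MvPolynomial ℕ+ ℂ) = 0 :=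
  SLELoop.singular_vector_of_coeff κ hκ0 lam hlam SLELoop.coeffP0_neg_one
    SLELoop.coeffP_neg_one_one SLELoop.coeffP0_neg_two (SLELoop.coeffQ0_neg_one κ)
    (SLELoop.coeffQ0_neg_two κ)
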